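/- Let $k$ be a field whose separable closure $k^{sep}$ is an infinite extension of $k$, and let $\mathcal{C}$ be a nonzero finite semisimple tensor $1$-category over $k$, that is, a $k$-linear category which is $k$-linearly equivalent to the category of finite-dimensional modules over a finite-dimensional $k$-algebra, in which every object is a finite direct sum of simple objects, and which is equipped with a $k$-bilinear rigid monoidal structure. A separable right $\mathcal{C}$-module category is a finite semisimple $k$-linear category with a coherent bilinear right action of $\mathcal{C}$ that is equivalent, as a right $\mathcal{C}$-module category, to the category of left $A$-modules in $\mathcal{C}$ for some separable algebra $A$ in $\mathcal{C}$ (the multiplication $A\otimes A\to A$ splits as a map of $A$-$A$-bimodules). Let $\mathbf{Mod}(\mathcal{C})$ be the $2$-category of separable right $\mathcal{C}$-module categories, $k$-linear module functors and module natural transformations. An object $\mathcal{M}$ of it is called simple if $\mathrm{Id}_{\mathcal{M}}$ is a simple object of the category of module endofunctors of $\mathcal{M}$, and indecomposable if it is nonzero and not equivalent to a direct sum of two nonzero objects. Then the following hold. 1. $\mathbf{Mod}(\mathcal{C})$ has infinitely many equivalence classes of simple objects. 2. Let $\mathcal{M}$ be a nonzero separable right $\mathcal{C}$-module category. (a) For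 every finite separable field extension $k'/k$, the Deligne tensor product $\mathbf{Vect}_{k'}\boxtimes_k\mathcal{M}$ is a separable right $\mathcal{C}$-module category. It has a direct summand in $\mathbf{Mod}(\mathcal{C})$ that is simple and indecomposable. For every direct summand $\mathcal{M}'$ of it in $\mathbf{Mod}(\mathcal{C})$ and every simple object $Y$ of the category $\mathcal{M}'$, one has $\dim_k \mathrm{End}_{\mathcal{M}'}(Y)\ge [k':k]$. (b) For every integer $n\ge 0$ there are a finite separable field extension $k'/k$ with $[k':k]\ge n$ and a direct summand $\mathcal{M}'$ of $\mathbf{Vect}_{k'}\boxtimes_k\mathcal{M}$ in $\mathbf{Mod}(\mathcal{C})$ that is simple and indecomposable, such that the category $\mathcal{M}'$ has a simple object and $\dim_k \mathrm{End}_{\mathcal{M}'}(Y)\ge n$ for every simple object $Y$ of $\mathcal{M}'$. -/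

import Mathlib

open CategoryTheory

universe w u v u₁ v₁ u₂ v₂ u₃ v₃ u₄ v₄

noncomputable section

namespace TensorModule

open MonoidalCategory MonoidalRightAction Limits

/-! ## Finite semisimple linear categories -/

/-- A `k`-linear category is finite if it is `k`-linearly equivalent to the category of
finite-dimensional modules over a finite-dimensional `k`-algebra. -/
def IsFiniteCat (k : Type w) [Field k] (M : Type u₁) [Category.{v₁} M] [Preadditive M]
    [Linear k M] : Prop :=
  ∃ (R : Type v₁) (_ : Ring R) (_ : Algebra k R) (_ : FiniteDimensional k R)
    (E : M ≌ FGModuleCat.{v₁} R) (_ : E.functor.Additive), E.functor.Linear k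

/-- Every object is a finite direct sum of simple objects. -/
def IsSemisimpleCat (M : Type u₁) [Category.{v₁} M] [Preadditive M] : Prop :=
  ∀ X : M, ∃ (n : ℕ) (S : Fin n → M) (b : Bicone S),
    (∀ i, Simple (S i)) ∧ Nonempty b.IsBilimit ∧ Nonempty (X ≅ b.pt)

/-- A linear category is nonzero if it has an object which is not a zero object. -/
def IsNonzeroCat (M : Type u₁) [Category.{v₁} M] : Prop :=
  ∃ X : M, ¬ IsZero X

/-! ## Linear right module categories and their functors -/

/-- The right action `M × C ⥤ M` is `k`-bilinear. -/
class BilinearAction (k : Type w) [Field k] (C : Type u) [Category.{v} C] [MonoidalCategory C]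
    [Preadditive C] [Linear k C] (M : Type u₁) [Category.{v₁} M] [Preadditive M] [Linear k M]
    [MonoidalRightAction C M] : Prop where
  add_left : ∀ {m m' : M} (f g : m ⟶ m') (c : C), (f + g) ⊵ᵣ c = f ⊵ᵣ c + g ⊵ᵣ c
  smul_left : ∀ {m m' : M} (r : k) (f : m ⟶ m') (c : C), (r • f) ⊵ᵣ c = r • (f ⊵ᵣ c)
  add_right : ∀ (m : M) {c c' : C} (f g : c ⟶ c'), m ⊴ᵣ (f + g) = m ⊴ᵣ f + m ⊴ᵣ g
  smul_right : ∀ (m : M) {c c' : C} (r : k) (f : c ⟶ c'), m ⊴ᵣ (r • f) = r • (m ⊴ᵣ f)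

/-- A `k`-linear right `C`-module functor: a `k`-linear functor `F` with coherent natural
isomorphisms `F m ⊙ᵣ c ≅ F (m ⊙ᵣ c)`. -/
structure ModFunctor (k : Type w) [Field k] (C : Type u) [Category.{v} C] [MonoidalCategory C]
    (M : Type u₁) [Category.{v₁} M] [Preadditive M] [Linear k M] [MonoidalRightAction C M]
    (N : Type u₂) [Category.{v₂} N] [Preadditive N] [Linear k N] [MonoidalRightAction C N] where
  functor : M ⥤ N
  [additive : functor.Additive]
  [linear : functor.Linear k]
  [rightLinear : functor.RightLinear C]

attribute [instance] ModFunctor.additive ModFunctor.linear ModFunctor.rightLinear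

namespace ModFunctor

open Functor.LaxRightLinear Functor.OplaxRightLinear Functor.RightLinear

section

variable {k : Type w} [Field k] {C : Type u} [Category.{v} C] [MonoidalCategory C]
  {M : Type u₁} [Category.{v₁} M] [Preadditive M] [Linear k M] [MonoidalRightAction C M]
  {N : Type u₂} [Category.{v₂} N] [Preadditive N] [Linear k N] [MonoidalRightAction C N]
  {P : Type u₃} [Category.{v₃} P] [Preadditive P] [Linear k P] [MonoidalRightAction C P]
  {Q : Type u₄} [Category.{v₄} Q] [Preadditive Q] [Linear k Q] [MonoidalRightAction C Q]

/-- A module natural transformation. -/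
@[ext]
structure Hom (F G : ModFunctor k C M N) where
  nat : F.functor ⟶ G.functor
  comm : ∀ (m : M) (c : C),
    μᵣ F.functor m c ≫ nat.app (m ⊙ᵣ c) = nat.app m ⊵ᵣ c ≫ μᵣ G.functor m c

instance : Category (ModFunctor k C M N) where
  Hom F G := Hom F G
  id F := { nat := 𝟙 _, comm := by simp }
  comp a b :=
    { nat := a.nat ≫ b.nat
      comm := by
        intro m c
        simp [reassoc_of% a.comm, b.comm] }

@[ext]
lemma hom_ext {F G : ModFunctor k C M N} {a b : F ⟶ G} (h : ∀ m, a.nat.app m = b.nat.app m) :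
    a = b :=
  Hom.ext (by ext m; exact h m)

@[simp] lemma id_nat (F : ModFunctor k C M N) : Hom.nat (𝟙 F) = 𝟙 _ := rfl

@[simp] lemma comp_nat {F G H : ModFunctor k C M N} (a : F ⟶ G) (b : G ⟶ H) :
    (a ≫ b).nat = a.nat ≫ b.nat := rfl

/-- Isomorphisms of module functors from componentwise isomorphisms. -/
def isoMk {F G : ModFunctor k C M N} (e : F.functor ≅ G.functor)
    (h : ∀ (m : M) (c : C),
      μᵣ F.functor m c ≫ e.hom.app (m ⊙ᵣ c) = e.hom.app m ⊵ᵣ c ≫ μᵣ G.functor m c) :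
    F ≅ G where
  hom := { nat := e.hom, comm := h }
  inv :=
    { nat := e.inv
      comm := by
        intro m c
        rw [← cancel_epi (e.hom.app m ⊵ᵣ c), ← reassoc_of% (h m c)]
        simp [← comp_actionHomLeft_assoc] }
  hom_inv_id := by ext; simp
  inv_hom_id := by ext; simp

/-- The identity module functor. -/
def id (k : Type w) [Field k] (C : Type u) [Category.{v} C] [MonoidalCategory C]
    (M : Type u₁) [Category.{v₁} M] [Preadditive M] [Linear k M] [MonoidalRightAction C M] :
    ModFunctor k C M M where
  functor := 𝟭 M
  rightLinear :=
    { μᵣ := fun _ _ => 𝟙 _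
      δᵣ := fun _ _ => 𝟙 _
      μᵣ_comp_δᵣ := by simp
      δᵣ_comp_μᵣ := by simp }

/-- Composition of module functors (in diagrammatic order). -/
def comp (F : ModFunctor k C M N) (G : ModFunctor k C N P) : ModFunctor k C M P where
  functor := F.functor ⋙ G.functor
  rightLinear :=
    { μᵣ := fun m c => μᵣ G.functor (F.functor.obj m) c ≫ G.functor.map (μᵣ F.functor m c)
      δᵣ := fun m c => G.functor.map (δᵣ F.functor m c) ≫ δᵣ G.functor (F.functor.obj m) c
      μᵣ_naturality_right := by
        intro m c c' f
        simp [← Functor.map_comp]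
      μᵣ_naturality_left := by
        intro m m' f c
        simp [← Functor.map_comp]
      μᵣ_associativity := by
        intro m c c'
        have h := congrArg G.functor.map (μᵣ_associativity F.functor m c c')
        have h' := μᵣ_naturality_left G.functor (μᵣ F.functor m c) c'
        simp only [Functor.map_comp] at h
        simp only [Functor.comp_obj, Functor.comp_map, Category.assoc, h, comp_actionHomLeft,
          μᵣ_associativity_assoc, reassoc_of% h']
      μᵣ_unitality := by
        intro m
        simp [← Functor.map_comp]
      δᵣ_naturality_right := by
        intro m c c' f
        have h := congrArg G.functor.map (δᵣ_naturality_right F.functor m f)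
        simp only [Functor.map_comp] at h
        simp only [Functor.comp_obj, Functor.comp_map, Category.assoc, reassoc_of% h,
          δᵣ_naturality_right]
      δᵣ_naturality_left := by
        intro m m' f c
        have h := congrArg G.functor.map (δᵣ_naturality_left F.functor f c)
        simp only [Functor.map_comp] at h
        simp only [Functor.comp_obj, Functor.comp_map, Category.assoc, reassoc_of% h,
          δᵣ_naturality_left]
      δᵣ_associativity := by
        intro m c c'
        have h := congrArg G.functor.map (δᵣ_associativity F.functor m c c')
        have h' := δᵣ_naturality_left G.functor (δᵣ F.functor m c) c'
        simp only [Functor.map_comp] at h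
        simp only [Functor.comp_obj, Functor.comp_map, Category.assoc, comp_actionHomLeft,
          δᵣ_associativity, reassoc_of% h, reassoc_of% h']
      δᵣ_unitality_inv := by
        intro m
        have h := congrArg G.functor.map (δᵣ_unitality_inv (C := C) F.functor m)
        simp only [Functor.map_comp] at h
        simp only [Functor.comp_obj, Functor.comp_map, ← reassoc_of% h, ← δᵣ_unitality_inv]
      μᵣ_comp_δᵣ := by intros; simp [← Functor.map_comp_assoc]
      δᵣ_comp_μᵣ := by intros; simp [← Functor.map_comp] }

@[simp] lemma id_functor : (id k C M).functor = 𝟭 M := rfl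

@[simp] lemma comp_functor (F : ModFunctor k C M N) (G : ModFunctor k C N P) :
    (F.comp G).functor = F.functor ⋙ G.functor := rfl

@[simp] lemma id_μᵣ (m : M) (c : C) : μᵣ (id k C M).functor m c = 𝟙 _ := rfl

@[simp] lemma comp_μᵣ (F : ModFunctor k C M N) (G : ModFunctor k C N P) (m : M) (c : C) :
    μᵣ (F.comp G).functor m c =
      μᵣ G.functor (F.functor.obj m) c ≫ G.functor.map (μᵣ F.functor m c) := rfl

end

section

variable {k : Type w} [Field k] {C : Type u} [Category.{v} C] [MonoidalCategory C]
  [Preadditive C] [Linear k C]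
  {M : Type u₁} [Category.{v₁} M] [Preadditive M] [Linear k M] [MonoidalRightAction C M]
  {N : Type u₂} [Category.{v₂} N] [Preadditive N] [Linear k N] [MonoidalRightAction C N]
  [BilinearAction k C N]

lemma zero_actionHomLeft (k : Type w) [Field k] [Linear k C] [Linear k N] [BilinearAction k C N]
    (n n' : N) (c : C) : (0 : n ⟶ n') ⊵ᵣ c = 0 := by
  simpa using BilinearAction.smul_left (k := k) (0 : k) (0 : n ⟶ n') c

lemma neg_actionHomLeft (k : Type w) [Field k] [Linear k C] [Linear k N] [BilinearAction k C N]
    {n n' : N} (f : n ⟶ n') (c : C) : (-f) ⊵ᵣ c = -(f ⊵ᵣ c) := by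
  simpa using BilinearAction.smul_left (k := k) (-1 : k) f c

instance (F G : ModFunctor k C M N) : Zero (F ⟶ G) where
  zero := { nat := 0, comm := by simp [zero_actionHomLeft k] }

instance (F G : ModFunctor k C M N) : Add (F ⟶ G) where
  add a b :=
    { nat := a.nat + b.nat
      comm := by
        intro m c
        simp [a.comm, b.comm, BilinearAction.add_left (k := k)] }

instance (F G : ModFunctor k C M N) : Neg (F ⟶ G) where
  neg a :=
    { nat := -a.nat
      comm := by
        intro m c
        simp [a.comm, neg_actionHomLeft k] }

instance (F G : ModFunctor k C M N) : AddCommGroup (F ⟶ G) where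
  add_assoc a b c := Hom.ext (add_assoc a.nat b.nat c.nat)
  zero_add a := Hom.ext (zero_add a.nat)
  add_zero a := Hom.ext (add_zero a.nat)
  neg_add_cancel a := Hom.ext (neg_add_cancel a.nat)
  add_comm a b := Hom.ext (add_comm a.nat b.nat)
  nsmul := nsmulRec
  zsmul := zsmulRec

@[simp] lemma zero_nat (F G : ModFunctor k C M N) : (0 : F ⟶ G).nat = 0 := rfl

@[simp] lemma add_nat {F G : ModFunctor k C M N} (a b : F ⟶ G) :
    (a + b).nat = a.nat + b.nat := rfl

instance : Preadditive (ModFunctor k C M N) where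
  add_comp := by intros; ext; simp
  comp_add := by intros; ext; simp

end

end ModFunctor

/-- Two linear right `C`-module categories are equivalent: there is a module functor between them
which is an equivalence of categories. -/
def ModEquivalent (k : Type w) [Field k] (C : Type u) [Category.{v} C] [MonoidalCategory C]
    (M : Type u₁) [Category.{v₁} M] [Preadditive M] [Linear k M] [MonoidalRightAction C M]
    (N : Type u₂) [Category.{v₂} N] [Preadditive N] [Linear k N] [MonoidalRightAction C N] :
    Prop :=
  ∃ F : ModFunctor k C M N, F.functor.IsEquivalence

/-- `M` is equivalent to the direct sum (that is, the product, with the componentwise action) of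
the module categories `M₁` and `M₂`. A module functor into the product is a pair of module
functors. -/
def IsDirectSum (k : Type w) [Field k] (C : Type u) [Category.{v} C] [MonoidalCategory C]
    (M : Type u₁) [Category.{v₁} M] [Preadditive M] [Linear k M] [MonoidalRightAction C M]
    (M₁ : Type u₂) [Category.{v₂} M₁] [Preadditive M₁] [Linear k M₁] [MonoidalRightAction C M₁]
    (M₂ : Type u₃) [Category.{v₃} M₂] [Preadditive M₂] [Linear k M₂] [MonoidalRightAction C M₂] :
    Prop :=
  ∃ (F₁ : ModFunctor k C M M₁) (F₂ : ModFunctor k C M M₂),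
    (F₁.functor.prod' F₂.functor).IsEquivalence

/-! ## Algebras, their modules, and separability -/

section Algebras

variable {C : Type u} [Category.{v} C] [MonoidalCategory C]

open MonObj

/-- An algebra object is separable if its multiplication has a section which is a map of
bimodules. -/
def IsSeparableAlg (A : C) [MonObj A] : Prop :=
  ∃ s : A ⟶ A ⊗ A, s ≫ μ = 𝟙 A ∧
    A ◁ s ≫ (α_ A A A).inv ≫ μ ▷ A = μ ≫ s ∧
    s ▷ A ≫ (α_ A A A).hom ≫ A ◁ μ = μ ≫ s

variable (A : C) [MonObj A]

variable {A} in
/-- The left `A`-module `m ⊗ c`, for a left `A`-module `m` and an object `c`. -/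
def modTensor (m : Mod C A) (c : C) : Mod C A where
  X := m.X ⊗ c
  mod :=
    { smul := (α_ A m.X c).inv ≫ γ[A, m.X] ▷ c
      one_smul := by
        have h := ModObj.one_smul_self A m.X
        simp only [selfLeftAction_actionHomLeft, selfLeftAction_actionUnitIso]
        rw [associator_inv_naturality_left_assoc, ← comp_whiskerRight, h]
        simp
      mul_smul := by
        have h := ModObj.mul_smul_self A m.X
        simp only [selfLeftAction_actionHomLeft, selfLeftAction_actionHomRight,
          selfLeftAction_actionAssocIso]
        rw [associator_inv_naturality_left_assoc, ← comp_whiskerRight, h]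
        simp }

/-- The right action of `C` on the category of left `A`-modules in `C`. -/
instance modRightActionStruct : MonoidalRightActionStruct C (Mod C A) where
  actionObj := modTensor
  actionHomLeft {m m'} f c := Mod.Hom.mk' (f.hom ▷ c : m.X ⊗ c ⟶ m'.X ⊗ c) (by
    have h : γ[A, m.X] ≫ f.hom = A ◁ f.hom ≫ γ[A, m'.X] := f.isModHom.smul_hom
    change ((α_ A m.X c).inv ≫ γ[A, m.X] ▷ c) ≫ f.hom ▷ c =
      A ◁ (f.hom ▷ c) ≫ (α_ A m'.X c).inv ≫ γ[A, m'.X] ▷ c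
    rw [Category.assoc, ← comp_whiskerRight, h]
    simp)
  actionHomRight m c c' f := Mod.Hom.mk' (m.X ◁ f : m.X ⊗ c ⟶ m.X ⊗ c') (by
    change ((α_ A m.X c).inv ≫ γ[A, m.X] ▷ c) ≫ m.X ◁ f =
      A ◁ (m.X ◁ f) ≫ (α_ A m.X c').inv ≫ γ[A, m.X] ▷ c'
    have h : γ[A, m.X] ▷ c ≫ m.X ◁ f = _ := (whisker_exchange γ[A, m.X] f).symm
    rw [Category.assoc, h]
    simp)
  actionAssocIso m c c' :=
    { hom := Mod.Hom.mk' ((α_ m.X c c').inv : m.X ⊗ c ⊗ c' ⟶ (m.X ⊗ c) ⊗ c') (by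
        change ((α_ A m.X (c ⊗ c')).inv ≫ γ[A, m.X] ▷ (c ⊗ c')) ≫ (α_ m.X c c').inv =
          A ◁ (α_ m.X c c').inv ≫ (α_ A (m.X ⊗ c) c').inv ≫
            ((α_ A m.X c).inv ≫ γ[A, m.X] ▷ c) ▷ c'
        simp)
      inv := Mod.Hom.mk' ((α_ m.X c c').hom : (m.X ⊗ c) ⊗ c' ⟶ m.X ⊗ c ⊗ c') (by
        change ((α_ A (m.X ⊗ c) c').inv ≫ ((α_ A m.X c).inv ≫ γ[A, m.X] ▷ c) ▷ c') ≫
            (α_ m.X c c').hom =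
          A ◁ (α_ m.X c c').hom ≫ (α_ A m.X (c ⊗ c')).inv ≫ γ[A, m.X] ▷ (c ⊗ c')
        simp)
      hom_inv_id := Mod.hom_ext _ _ (α_ m.X c c').inv_hom_id
      inv_hom_id := Mod.hom_ext _ _ (α_ m.X c c').hom_inv_id }
  actionUnitIso m :=
    { hom := Mod.Hom.mk' ((ρ_ m.X).hom : m.X ⊗ 𝟙_ C ⟶ m.X) (by
        change ((α_ A m.X (𝟙_ C)).inv ≫ γ[A, m.X] ▷ 𝟙_ C) ≫ (ρ_ m.X).hom =
          A ◁ (ρ_ m.X).hom ≫ γ[A, m.X]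
        have h : γ[A, m.X] ▷ 𝟙_ C ≫ (ρ_ m.X).hom = (ρ_ (A ⊗ m.X)).hom ≫ γ[A, m.X] :=
          rightUnitor_naturality _
        rw [Category.assoc, h]
        simp)
      inv := Mod.Hom.mk' ((ρ_ m.X).inv : m.X ⟶ m.X ⊗ 𝟙_ C) (by
        change γ[A, m.X] ≫ (ρ_ m.X).inv =
          A ◁ (ρ_ m.X).inv ≫ (α_ A m.X (𝟙_ C)).inv ≫ γ[A, m.X] ▷ 𝟙_ C
        have h : γ[A, m.X] ≫ (ρ_ m.X).inv = (ρ_ (A ⊗ m.X)).inv ≫ γ[A, m.X] ▷ 𝟙_ C :=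
          rightUnitor_inv_naturality _
        rw [h]
        simp)
      hom_inv_id := Mod.hom_ext _ _ (ρ_ m.X).hom_inv_id
      inv_hom_id := Mod.hom_ext _ _ (ρ_ m.X).inv_hom_id }

instance modRightAction : MonoidalRightAction C (Mod C A) where
  actionHom_def _ _ := rfl
  actionHomRight_id c m := Mod.hom_ext _ _ (whiskerLeft_id m.X c)
  id_actionHomLeft c m := Mod.hom_ext _ _ (id_whiskerRight m.X c)
  actionHom_comp {c c' c'' m m' m''} f f' g g' := Mod.hom_ext _ _ (by
    change (f.hom ≫ f'.hom) ▷ c ≫ m''.X ◁ (g ≫ g') =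
      (f.hom ▷ c ≫ m'.X ◁ g) ≫ f'.hom ▷ c' ≫ m''.X ◁ g'
    rw [comp_whiskerRight, MonoidalCategory.whiskerLeft_comp, Category.assoc, Category.assoc,
      whisker_exchange_assoc])
  actionAssocIso_hom_naturality {m m' c₁ c₂ c₃ c₄} f g h := Mod.hom_ext _ _ (by
    have e := associator_inv_naturality f.hom g h
    simp only [MonoidalCategory.tensorHom_def] at e
    change (f.hom ▷ (c₁ ⊗ c₃) ≫ m'.X ◁ (g ⊗ₘ h)) ≫ (α_ m'.X c₂ c₄).inv =
      (α_ m.X c₁ c₃).inv ≫ (f.hom ▷ c₁ ≫ m'.X ◁ g) ▷ c₃ ≫ (m'.X ⊗ c₂) ◁ h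
    rw [MonoidalCategory.tensorHom_def]
    exact e)
  actionUnitIso_hom_naturality f := Mod.hom_ext _ _ (rightUnitor_naturality f.hom).symm
  actionHomRight_whiskerRight f c m :=
    Mod.hom_ext _ _ (MonoidalRightAction.actionHomRight_whiskerRight f c m.X)
  whiskerRight_actionHomLeft c _ _ f m :=
    Mod.hom_ext _ _ (MonoidalRightAction.whiskerRight_actionHomLeft c f m.X)
  actionHom_associator c c' c'' m :=
    Mod.hom_ext _ _ (MonoidalRightAction.actionHom_associator c c' c'' m.X)
  actionHom_leftUnitor c m :=
    Mod.hom_ext _ _ (MonoidalRightAction.actionHom_leftUnitor c m.X)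
  actionHom_rightUnitor c m :=
    Mod.hom_ext _ _ (MonoidalRightAction.actionHom_rightUnitor c m.X)

variable {A} in
lemma mod_smul_hom {m m' : Mod C A} (f : m ⟶ m') :
    γ[A, m.X] ≫ f.hom = A ◁ f.hom ≫ γ[A, m'.X] :=
  f.isModHom.smul_hom

section Linear

variable [Preadditive C] [MonoidalPreadditive C]

instance (m m' : Mod C A) : Zero (m ⟶ m') where
  zero := Mod.Hom.mk' 0 (by
    change γ[A, m.X] ≫ 0 = A ◁ 0 ≫ γ[A, m'.X]
    simp)

instance (m m' : Mod C A) : Add (m ⟶ m') where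
  add f g := Mod.Hom.mk' (f.hom + g.hom) (by
    change γ[A, m.X] ≫ (f.hom + g.hom) = A ◁ (f.hom + g.hom) ≫ γ[A, m'.X]
    simp only [Preadditive.comp_add, MonoidalPreadditive.whiskerLeft_add, Preadditive.add_comp,
      mod_smul_hom])

instance (m m' : Mod C A) : Neg (m ⟶ m') where
  neg f := Mod.Hom.mk' (-f.hom) (by
    change γ[A, m.X] ≫ (-f.hom) = A ◁ (-f.hom) ≫ γ[A, m'.X]
    have h : A ◁ (-f.hom) = -(A ◁ f.hom) := (tensorLeft A).map_neg
    rw [h, Preadditive.comp_neg, Preadditive.neg_comp, mod_smul_hom])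

instance (m m' : Mod C A) : AddCommGroup (m ⟶ m') where
  add_assoc f g h := Mod.hom_ext _ _ (add_assoc f.hom g.hom h.hom)
  zero_add f := Mod.hom_ext _ _ (zero_add f.hom)
  add_zero f := Mod.hom_ext _ _ (add_zero f.hom)
  neg_add_cancel f := Mod.hom_ext _ _ (neg_add_cancel f.hom)
  add_comm f g := Mod.hom_ext _ _ (add_comm f.hom g.hom)
  nsmul := nsmulRec
  zsmul := zsmulRec

variable {A} in
@[simp] lemma mod_zero_hom (m m' : Mod C A) : (0 : m ⟶ m').hom = 0 := rfl

variable {A} in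
@[simp] lemma mod_add_hom {m m' : Mod C A} (f g : m ⟶ m') : (f + g).hom = f.hom + g.hom := rfl

instance : Preadditive (Mod C A) where
  add_comp := by intros; ext; simp
  comp_add := by intros; ext; simp

variable (k : Type w) [Field k] [Linear k C] [MonoidalLinear k C]

instance (m m' : Mod C A) : SMul k (m ⟶ m') where
  smul r f := Mod.Hom.mk' (r • f.hom) (by
    change γ[A, m.X] ≫ (r • f.hom) = A ◁ (r • f.hom) ≫ γ[A, m'.X]
    rw [MonoidalLinear.whiskerLeft_smul, Linear.comp_smul, Linear.smul_comp, mod_smul_hom])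

variable {A k} in
@[simp] lemma mod_smul_hom' {m m' : Mod C A} (r : k) (f : m ⟶ m') :
    (r • f).hom = r • f.hom := rfl

instance (m m' : Mod C A) : Module k (m ⟶ m') where
  one_smul f := Mod.hom_ext _ _ (one_smul k f.hom)
  mul_smul r s f := Mod.hom_ext _ _ (mul_smul r s f.hom)
  smul_zero r := Mod.hom_ext _ _ (smul_zero (A := m.X ⟶ m'.X) r)
  smul_add r f g := Mod.hom_ext _ _ (smul_add r f.hom g.hom)
  add_smul r s f := Mod.hom_ext _ _ (add_smul r s f.hom)
  zero_smul f := Mod.hom_ext _ _ (zero_smul k f.hom)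

instance : Linear k (Mod C A) where
  smul_comp := by intros; ext; simp
  comp_smul := by intros; ext; simp

end Linear

end Algebras

section Separable

variable (k : Type w) [Field k] (C : Type u) [Category.{v} C] [Preadditive C] [Linear k C]
  [MonoidalCategory C] [MonoidalPreadditive C] [MonoidalLinear k C]

/-- A linear right `C`-module category is separable if it is finite semisimple and equivalent, as
a right `C`-module category, to the category of left modules over a separable algebra in `C`. -/
structure IsSeparableModCat (M : Type u₁) [Category.{v₁} M] [Preadditive M] [Linear k M]
    [MonoidalRightAction C M] [BilinearAction k C M] : Prop where
  finite : IsFiniteCat k M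
  semisimple : IsSemisimpleCat M
  separable : ∃ (A : C) (_ : MonObj A), IsSeparableAlg A ∧ ModEquivalent k C M (Mod C A)

/-! ## The 2-category of separable right module categories -/

/-- A separable right `C`-module category. -/
structure SepMod where
  carrier : Type (max u v)
  [category : Category.{v} carrier]
  [preadditive : Preadditive carrier]
  [linear : Linear k carrier]
  [action : MonoidalRightAction C carrier]
  [bilinear : BilinearAction k C carrier]
  isSeparable : IsSeparableModCat k C carrier

end Separable

namespace SepMod

attribute [instance] category preadditive linear action bilinear

instance (k : Type w) [Field k] (C : Type u) [Category.{v} C] [Preadditive C] [Linear k C]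
    [MonoidalCategory C] [MonoidalPreadditive C] [MonoidalLinear k C] :
    CoeSort (SepMod k C) (Type (max u v)) := ⟨carrier⟩

variable {k : Type w} [Field k] {C : Type u} [Category.{v} C] [Preadditive C] [Linear k C]
  [MonoidalCategory C] [MonoidalPreadditive C] [MonoidalLinear k C]

open Functor.LaxRightLinear

/-- The 2-category `Mod(C)`: objects are separable right `C`-module categories, 1-morphisms are
linear module functors, 2-morphisms are module natural transformations. -/
instance : Bicategory (SepMod k C) where
  Hom M N := ModFunctor k C M N
  id M := ModFunctor.id k C M
  comp F G := F.comp G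
  homCategory _ _ := inferInstance
  whiskerLeft {_ _ _} F {G H} η :=
    { nat := Functor.whiskerLeft F.functor η.nat
      comm := by
        intro m c
        change (μᵣ G.functor (F.functor.obj m) c ≫ G.functor.map (μᵣ F.functor m c)) ≫
            η.nat.app (F.functor.obj (m ⊙ᵣ c)) =
          η.nat.app (F.functor.obj m) ⊵ᵣ c ≫ μᵣ H.functor (F.functor.obj m) c ≫
            H.functor.map (μᵣ F.functor m c)
        rw [Category.assoc, η.nat.naturality, reassoc_of% η.comm] }
  whiskerRight {_ _ _} {F G} η H :=
    { nat := Functor.whiskerRight η.nat H.functor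
      comm := by
        intro m c
        change (μᵣ H.functor (F.functor.obj m) c ≫ H.functor.map (μᵣ F.functor m c)) ≫
            H.functor.map (η.nat.app (m ⊙ᵣ c)) =
          H.functor.map (η.nat.app m) ⊵ᵣ c ≫ μᵣ H.functor (G.functor.obj m) c ≫
            H.functor.map (μᵣ G.functor m c)
        rw [Category.assoc, ← Functor.map_comp, η.comm, Functor.map_comp,
          μᵣ_naturality_left_assoc] }
  associator F G H := ModFunctor.isoMk (Functor.associator _ _ _) (by
    intro m c
    change (μᵣ H.functor (G.functor.obj (F.functor.obj m)) c ≫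
        H.functor.map (μᵣ G.functor (F.functor.obj m) c ≫ G.functor.map (μᵣ F.functor m c))) ≫
          𝟙 _ =
      𝟙 _ ⊵ᵣ c ≫ (μᵣ H.functor (G.functor.obj (F.functor.obj m)) c ≫
        H.functor.map (μᵣ G.functor (F.functor.obj m) c)) ≫
          H.functor.map (G.functor.map (μᵣ F.functor m c))
    simp)
  leftUnitor F := ModFunctor.isoMk (Functor.leftUnitor _) (by
    intro m c
    change (μᵣ F.functor m c ≫ F.functor.map (𝟙 _)) ≫ 𝟙 _ = 𝟙 _ ⊵ᵣ c ≫ μᵣ F.functor m c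
    simp)
  rightUnitor F := ModFunctor.isoMk (Functor.rightUnitor _) (by
    intro m c
    change (𝟙 _ ≫ μᵣ F.functor m c) ≫ 𝟙 _ = 𝟙 _ ⊵ᵣ c ≫ μᵣ F.functor m c
    simp)
  id_whiskerLeft η := ModFunctor.hom_ext fun m => by
    change η.nat.app m = 𝟙 _ ≫ η.nat.app m ≫ 𝟙 _
    simp
  comp_whiskerLeft F G _ _ η := ModFunctor.hom_ext fun m => by
    change η.nat.app (G.functor.obj (F.functor.obj m)) = 𝟙 _ ≫ η.nat.app _ ≫ 𝟙 _
    simp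
  whiskerRight_id η := ModFunctor.hom_ext fun m => by
    change η.nat.app m = 𝟙 _ ≫ η.nat.app m ≫ 𝟙 _
    simp
  whiskerRight_comp η G H := ModFunctor.hom_ext fun m => by
    change H.functor.map (G.functor.map (η.nat.app m)) = 𝟙 _ ≫ H.functor.map _ ≫ 𝟙 _
    simp
  whisker_assoc F _ _ η H := ModFunctor.hom_ext fun m => by
    change H.functor.map (η.nat.app (F.functor.obj m)) = 𝟙 _ ≫ H.functor.map _ ≫ 𝟙 _
    simp
  pentagon F G H I := ModFunctor.hom_ext fun m => by
    change I.functor.map (𝟙 _) ≫ 𝟙 _ ≫ 𝟙 _ = 𝟙 _ ≫ 𝟙 _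
    simp
  triangle F G := ModFunctor.hom_ext fun m => by
    change 𝟙 _ ≫ 𝟙 _ = G.functor.map (𝟙 _)
    simp

instance (M N : SepMod k C) : Preadditive (M ⟶ N) :=
  inferInstanceAs (Preadditive (ModFunctor k C M N))

end SepMod

/-! ## Equivalence classes of objects, simple and indecomposable objects -/

open Bicategory in
lemma equivalence_trans {B : Type u₁} [Bicategory.{v₁, u₂} B] {X Y Z : B}
    (e : Nonempty (X ≌ Y)) (f : Nonempty (Y ≌ Z)) : Nonempty (X ≌ Z) := by
  obtain ⟨e⟩ := e
  obtain ⟨f⟩ := f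
  exact ⟨Equivalence.mkOfAdjointifyCounit (f := e.hom ≫ f.hom) (g := f.inv ≫ e.inv)
    (e.unit ≪≫ whiskerLeftIso e.hom
      ((leftUnitor e.inv).symm ≪≫ whiskerRightIso f.unit e.inv ≪≫
        associator f.hom f.inv e.inv) ≪≫
      (associator e.hom f.hom (f.inv ≫ e.inv)).symm)
    (associator f.inv e.inv (e.hom ≫ f.hom) ≪≫ whiskerLeftIso f.inv
      ((associator e.inv e.hom f.hom).symm ≪≫ whiskerRightIso e.counit f.hom ≪≫
        leftUnitor f.hom) ≪≫
      f.counit)⟩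

open Bicategory in
lemma equivalence_symm {B : Type u₁} [Bicategory.{v₁, u₂} B] {X Y : B}
    (e : Nonempty (X ≌ Y)) : Nonempty (Y ≌ X) := by
  obtain ⟨e⟩ := e
  exact ⟨Equivalence.mkOfAdjointifyCounit e.counit.symm e.unit.symm⟩

namespace SepMod

variable {k : Type w} [Field k] {C : Type u} [Category.{v} C] [Preadditive C] [Linear k C]
  [MonoidalCategory C] [MonoidalPreadditive C] [MonoidalLinear k C]

/-- An object of the 2-category is simple if its identity 1-morphism is a simple object of its
category of endomorphisms. -/
def IsSimpleObject (M : SepMod k C) : Prop :=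
  Simple (𝟙 M : M ⟶ M)

/-- A nonzero module category which is not a direct sum of two nonzero ones. -/
def IsIndecomposable (M : SepMod k C) : Prop :=
  IsNonzeroCat M ∧ ∀ M₁ M₂ : SepMod k C, IsDirectSum k C M M₁ M₂ →
    ¬ IsNonzeroCat M₁ ∨ ¬ IsNonzeroCat M₂

/-- `M'` is a direct summand of the module category `N`. -/
def IsSummandOf (M' : SepMod k C) (N : Type u₁) [Category.{v₁} N] [Preadditive N] [Linear k N]
    [MonoidalRightAction C N] : Prop :=
  ∃ M'' : SepMod k C, IsDirectSum k C N M' M''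

variable (k C)

/-- Simple objects of the 2-category, up to equivalence in the 2-category. -/
def simpleSetoid : Setoid {M : SepMod k C // M.IsSimpleObject} where
  r M N := Nonempty (Bicategory.Equivalence M.1 N.1)
  iseqv :=
    { refl := fun M => ⟨Bicategory.Equivalence.id M.1⟩
      symm := equivalence_symm
      trans := equivalence_trans }

/-- The type of equivalence classes of simple objects of the 2-category. -/
def SimpleClasses := Quotient (simpleSetoid k C)

end SepMod

/-! ## Extension of scalars of a module category -/

/-- For a field extension `K / k`, the objects of the Deligne tensor product `Vect_K ⊠ M` over `k`,
realised as the objects of `M` with a `k`-linear action of `K`. -/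
structure BaseChange (k : Type w) [Field k] (K : Type u₂) [Field K] [Algebra k K]
    (M : Type u₁) [Category.{v₁} M] [Preadditive M] [Linear k M] where
  obj : M
  act : K →ₐ[k] End obj

namespace BaseChange

section

variable {k : Type w} [Field k] {K : Type u₂} [Field K] [Algebra k K]
  {M : Type u₁} [Category.{v₁} M] [Preadditive M] [Linear k M]

/-- The action of a scalar, as a morphism of the underlying object. -/
def scalar (X : BaseChange k K M) (a : K) : X.obj ⟶ X.obj := X.act a

/-- Morphisms commute with the action of `K`. -/
@[ext]
structure Hom (X Y : BaseChange k K M) where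
  hom : X.obj ⟶ Y.obj
  comm : ∀ a : K, X.scalar a ≫ hom = hom ≫ Y.scalar a

instance : Category (BaseChange k K M) where
  Hom X Y := Hom X Y
  id X := { hom := 𝟙 _, comm := by simp }
  comp f g := { hom := f.hom ≫ g.hom, comm := by simp [reassoc_of% f.comm, g.comm] }

@[ext]
lemma hom_ext {X Y : BaseChange k K M} {f g : X ⟶ Y} (h : f.hom = g.hom) : f = g :=
  Hom.ext h

@[simp] lemma id_hom (X : BaseChange k K M) : Hom.hom (𝟙 X) = 𝟙 _ := rfl

@[simp] lemma comp_hom {X Y Z : BaseChange k K M} (f : X ⟶ Y) (g : Y ⟶ Z) :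
    (f ≫ g).hom = f.hom ≫ g.hom := rfl

instance (X Y : BaseChange k K M) : Zero (X ⟶ Y) where
  zero := { hom := 0, comm := by simp }

instance (X Y : BaseChange k K M) : Add (X ⟶ Y) where
  add f g := { hom := f.hom + g.hom, comm := by simp [f.comm, g.comm] }

instance (X Y : BaseChange k K M) : Neg (X ⟶ Y) where
  neg f := { hom := -f.hom, comm := by simp [f.comm] }

instance (X Y : BaseChange k K M) : SMul k (X ⟶ Y) where
  smul r f := { hom := r • f.hom, comm := by simp [f.comm] }

instance (X Y : BaseChange k K M) : AddCommGroup (X ⟶ Y) where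
  add_assoc f g h := Hom.ext (add_assoc f.hom g.hom h.hom)
  zero_add f := Hom.ext (zero_add f.hom)
  add_zero f := Hom.ext (add_zero f.hom)
  neg_add_cancel f := Hom.ext (neg_add_cancel f.hom)
  add_comm f g := Hom.ext (add_comm f.hom g.hom)
  nsmul := nsmulRec
  zsmul := zsmulRec

@[simp] lemma zero_hom (X Y : BaseChange k K M) : (0 : X ⟶ Y).hom = 0 := rfl

@[simp] lemma add_hom {X Y : BaseChange k K M} (f g : X ⟶ Y) :
    (f + g).hom = f.hom + g.hom := rfl

@[simp] lemma smul_hom {X Y : BaseChange k K M} (r : k) (f : X ⟶ Y) :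
    (r • f).hom = r • f.hom := rfl

instance (X Y : BaseChange k K M) : Module k (X ⟶ Y) where
  one_smul f := Hom.ext (one_smul k f.hom)
  mul_smul r s f := Hom.ext (mul_smul r s f.hom)
  smul_zero r := Hom.ext (smul_zero (A := X.obj ⟶ Y.obj) r)
  smul_add r f g := Hom.ext (smul_add r f.hom g.hom)
  add_smul r s f := Hom.ext (add_smul r s f.hom)
  zero_smul f := Hom.ext (zero_smul k f.hom)

instance : Preadditive (BaseChange k K M) where
  add_comp := by intros; ext; simp
  comp_add := by intros; ext; simp

instance : Linear k (BaseChange k K M) where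
  smul_comp := by intros; ext; simp
  comp_smul := by intros; ext; simp

variable {C : Type u} [Category.{v} C] [MonoidalCategory C] [Preadditive C] [Linear k C]
  [MonoidalRightAction C M] [BilinearAction k C M]

/-- `C` acts on the underlying object, and `K` acts by functoriality. -/
def tensor (X : BaseChange k K M) (c : C) : BaseChange k K M where
  obj := X.obj ⊙ᵣ c
  act := AlgHom.ofLinearMap
    { toFun := fun a => End.of (X.scalar a ⊵ᵣ c)
      map_add' := fun a b => by
        change X.scalar (a + b) ⊵ᵣ c = X.scalar a ⊵ᵣ c + X.scalar b ⊵ᵣ c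
        have h : X.scalar (a + b) = X.scalar a + X.scalar b := map_add X.act a b
        rw [h, BilinearAction.add_left (k := k)]
      map_smul' := fun r a => by
        change X.scalar (r • a) ⊵ᵣ c = r • (X.scalar a ⊵ᵣ c)
        have h : X.scalar (r • a) = r • X.scalar a := map_smul X.act r a
        rw [h, BilinearAction.smul_left] }
    (by
      change X.scalar 1 ⊵ᵣ c = 𝟙 _
      have h : X.scalar 1 = 𝟙 _ := map_one X.act
      rw [h, id_actionHomLeft])
    (fun a b => by
      change X.scalar (a * b) ⊵ᵣ c = X.scalar b ⊵ᵣ c ≫ X.scalar a ⊵ᵣ c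
      have h : X.scalar (a * b) = X.scalar b ≫ X.scalar a := map_mul X.act a b
      rw [h, comp_actionHomLeft])

instance : MonoidalRightActionStruct C (BaseChange k K M) where
  actionObj := tensor
  actionHomLeft {X Y} f c :=
    { hom := f.hom ⊵ᵣ c
      comm := fun a => by
        change X.scalar a ⊵ᵣ c ≫ f.hom ⊵ᵣ c = f.hom ⊵ᵣ c ≫ Y.scalar a ⊵ᵣ c
        rw [← comp_actionHomLeft, f.comm, comp_actionHomLeft] }
  actionHomRight X {c c'} g :=
    { hom := X.obj ⊴ᵣ g
      comm := fun a => (action_exchange (X.scalar a) g).symm }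
  actionAssocIso X c c' :=
    { hom :=
        { hom := (αᵣ X.obj c c').hom
          comm := fun a => by
            change X.scalar a ⊵ᵣ (c ⊗ c') ≫ (αᵣ X.obj c c').hom =
              (αᵣ X.obj c c').hom ≫ (X.scalar a ⊵ᵣ c) ⊵ᵣ c'
            simp }
      inv :=
        { hom := (αᵣ X.obj c c').inv
          comm := fun a => by
            change (X.scalar a ⊵ᵣ c) ⊵ᵣ c' ≫ (αᵣ X.obj c c').inv =
              (αᵣ X.obj c c').inv ≫ X.scalar a ⊵ᵣ (c ⊗ c')
            simp }
      hom_inv_id := Hom.ext (αᵣ X.obj c c').hom_inv_id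
      inv_hom_id := Hom.ext (αᵣ X.obj c c').inv_hom_id }
  actionUnitIso X :=
    { hom :=
        { hom := (ρᵣ X.obj).hom
          comm := fun a => by
            change X.scalar a ⊵ᵣ (𝟙_ C) ≫ (ρᵣ X.obj).hom = (ρᵣ X.obj).hom ≫ X.scalar a
            simp }
      inv :=
        { hom := (ρᵣ X.obj).inv
          comm := fun a => by
            change X.scalar a ≫ (ρᵣ X.obj).inv = (ρᵣ X.obj).inv ≫ X.scalar a ⊵ᵣ (𝟙_ C)
            simp }
      hom_inv_id := Hom.ext (ρᵣ X.obj).hom_inv_id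
      inv_hom_id := Hom.ext (ρᵣ X.obj).inv_hom_id }

instance : MonoidalRightAction C (BaseChange k K M) where
  actionHom_def _ _ := rfl
  actionHomRight_id c X := Hom.ext (actionHomRight_id c X.obj)
  id_actionHomLeft c X := Hom.ext (id_actionHomLeft c X.obj)
  actionHom_comp f f' g g' := Hom.ext (by
    have e := actionHom_comp f.hom f'.hom g g'
    simp only [actionHom_def] at e
    exact e)
  actionAssocIso_hom_naturality f g h := Hom.ext (by
    have e := actionAssocIso_hom_naturality f.hom g h
    simp only [actionHom_def] at e
    exact e)
  actionUnitIso_hom_naturality f := Hom.ext (actionUnitIso_hom_naturality f.hom)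
  actionHomRight_whiskerRight f c X := Hom.ext (actionHomRight_whiskerRight f c X.obj)
  whiskerRight_actionHomLeft c _ _ f X := Hom.ext (whiskerRight_actionHomLeft c f X.obj)
  actionHom_associator c c' c'' X := Hom.ext (actionHom_associator c c' c'' X.obj)
  actionHom_leftUnitor c X := Hom.ext (actionHom_leftUnitor c X.obj)
  actionHom_rightUnitor c X := Hom.ext (actionHom_rightUnitor c X.obj)

instance : BilinearAction k C (BaseChange k K M) where
  add_left f g c := Hom.ext (BilinearAction.add_left (k := k) f.hom g.hom c)
  smul_left r f c := Hom.ext (BilinearAction.smul_left r f.hom c)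
  add_right X _ _ f g := Hom.ext (BilinearAction.add_right (k := k) X.obj f g)
  smul_right X _ _ r f := Hom.ext (BilinearAction.smul_right X.obj r f)

end

end BaseChange

end TensorModule

end

/-! Write a separable module category as `Mod C A` with `A` separable. An object of it with an
action of `K` is a module over the algebra `K ⊗ A`, built in `C` as a sum of copies of `A`
(`copower`), and `toModFunctor` makes this an equivalence of module categories. When `K/k` is
separable, `K` has a separability element in `K ⊗ K`; multiplying it with the section for `A` shows
that `K ⊗ A` is separable (`isSeparableAlg_copower`). Hence the extension of scalars is again a
separable module category.

Semisimplicity is handled through von Neumann regularity: every `f` admits `g` with `f g f = f`.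
Together with finite biproducts, split idempotents, finite-dimensional Hom spaces and a generator
(`IsFinSS`), this characterises finite semisimple categories. It passes from `C` to `Mod C B` for
separable `B` by averaging, as in Maschke's theorem (`IsFinSS.mod`), and the same averaging makes
transformations between module functors regular (`NatSection.exists_regular`).

A simple summand comes from an idempotent of the identity module functor. Such an idempotent is
determined by its value on the regular module, so finite dimensionality of `End A` yields a minimal
nonzero one, `z` (`exists_minimal_central`). The idempotents `z` and `1 - z` cut `Mod C A` into
module categories over two separable corner algebras (`exists_corner`, `isDirectSum_of_corners`). By
minimality the identity of the first piece has only trivial idempotents. This excludes a nontrivial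
direct sum decomposition, and with regularity it makes the identity functor simple.

For the dimension bound, `K` acts by endomorphisms on every object of the extension of scalars,
hence on every object of a summand. On a simple object the resulting ring map from the field `K` is
injective (`finrank_le_of_isSummandOf`). If the separable closure is infinite over `k`, it has
finite subextensions of arbitrarily large degree. Starting from modules over the unit algebra, one
gets simple objects of the 2-category whose simple constituents have endomorphism algebras of
dimension at least any given `n`; since equivalences preserve these dimensions, infinitely many
classes occur (`SepMod.infinite_simpleClasses`). -/

noncomputable section

namespace TensorModule

open MonoidalCategory MonoidalRightAction Limits

/-! ## Finite semisimple categories via von Neumann regularity -/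

/-- The intrinsic properties of a finite semisimple `k`-linear category. -/
structure IsFinSS (k : Type w) [Field k] (M : Type u₁) [Category.{v₁} M] [Preadditive M]
    [Linear k M] : Prop where
  biproducts : HasFiniteBiproducts M
  idem : IsIdempotentComplete M
  fd : ∀ X Y : M, Module.Finite k (X ⟶ Y)
  regular : ∀ {X Y : M} (f : X ⟶ Y), ∃ g : Y ⟶ X, f ≫ g ≫ f = f
  generator : ∃ P : M, ∀ X : M, ∃ (n : ℕ) (a : Fin n → (X ⟶ P)) (b : Fin n → (P ⟶ X)),
    ∑ j, a j ≫ b j = 𝟙 X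

/-! ### Invariance under equivalence -/

section Transfer

variable {k : Type w} [Field k] {M : Type u₁} [Category.{v₁} M] [Preadditive M] [Linear k M]
  {N : Type u₂} [Category.{v₂} N] [Preadditive N] [Linear k N]

lemma IsFinSS.of_equivalence (h : IsFinSS k N) (F : M ⥤ N) [F.Additive] [F.Linear k]
    [F.IsEquivalence] : IsFinSS k M where
  biproducts := by
    have := h.biproducts
    have : HasFiniteProducts M :=
      ⟨fun n => Adjunction.hasLimitsOfShape_of_equivalence F⟩
    exact HasFiniteBiproducts.of_hasFiniteProducts
  idem := (Idempotents.isIdempotentComplete_iff_of_equivalence F.asEquivalence).2 h.idem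
  fd X Y := by
    have := h.fd (F.obj X) (F.obj Y)
    exact Module.Finite.of_injective (F.mapLinearMap k (X := X) (Y := Y)) F.map_injective
  regular {X Y} f := by
    obtain ⟨g, hg⟩ := h.regular (F.map f)
    exact ⟨F.preimage g, F.map_injective (by simpa using hg)⟩
  generator := by
    obtain ⟨P, hP⟩ := h.generator
    refine ⟨F.objPreimage P, fun X => ?_⟩
    obtain ⟨n, a, b, hab⟩ := hP (F.obj X)
    refine ⟨n, fun j => F.preimage (a j ≫ (F.objObjPreimageIso P).inv),
      fun j => F.preimage ((F.objObjPreimageIso P).hom ≫ b j), F.map_injective ?_⟩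
    simp [F.map_sum, hab]

end Transfer

/-! ### Decomposition into simple objects -/

section Semisimple

variable {k : Type w} [Field k] {M : Type u₁} [Category.{v₁} M] [Preadditive M] [Linear k M]

/-- A nonzero object with only trivial idempotents is simple if all morphisms into it are
regular. -/
lemma simple_of_trivial_idempotents {Y : M} (h0 : 𝟙 Y ≠ 0)
    (he : ∀ e : Y ⟶ Y, e ≫ e = e → e = 0 ∨ e = 𝟙 Y)
    (hreg : ∀ {Z : M} (f : Z ⟶ Y), ∃ g : Y ⟶ Z, f ≫ g ≫ f = f) : Simple Y where
  mono_isIso_iff_nonzero {Z} f _ := by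
    constructor
    · rintro h rfl
      apply h0
      have := IsIso.inv_hom_id (0 : Z ⟶ Y)
      simpa using this.symm
    · intro hf
      obtain ⟨g, hg⟩ := hreg f
      rcases he (g ≫ f) (by simp [hg]) with h | h
      · rw [h, comp_zero] at hg
        exact absurd hg.symm hf
      · exact ⟨g, by rw [← cancel_mono f]; simp [hg], h⟩

/-- The object is a finite direct sum of simple objects. -/
def IsSumOfSimples (X : M) : Prop :=
  ∃ (J : Type) (_ : Fintype J) (_ : DecidableEq J) (S : J → M) (i : ∀ j, S j ⟶ X)
    (p : ∀ j, X ⟶ S j), (∀ j, Simple (S j)) ∧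
    (∀ j, i j ≫ p j = 𝟙 (S j)) ∧ (∀ j j', j ≠ j' → i j ≫ p j' = 0) ∧
    ∑ j, p j ≫ i j = 𝟙 X

/-- Decompositions are indexed by arbitrary finite types so that two of them combine over a sum
type; reindexing by `Fin n` is postponed to this point. -/
lemma IsSumOfSimples.exists_bicone {X : M} (h : IsSumOfSimples X) :
    ∃ (n : ℕ) (S : Fin n → M) (b : Bicone S),
      (∀ i, Simple (S i)) ∧ Nonempty b.IsBilimit ∧ Nonempty (X ≅ b.pt) := by
  obtain ⟨J, _, _, S, i, p, hS, hip, hip0, hpi⟩ := h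
  let e := (Fintype.equivFin J).symm
  refine ⟨Fintype.card J, fun a => S (e a),
    { pt := X, π := fun a => p (e a), ι := fun a => i (e a), ι_π := ?_ }, fun a => hS _,
    ⟨isBilimitOfTotal _ ?_⟩, ⟨Iso.refl _⟩⟩
  · intro a b
    by_cases hab : a = b
    · subst hab
      simp [hip]
    · rw [dif_neg hab, hip0 _ _ fun h => hab (e.injective h)]
  · change ∑ a, p (e a) ≫ i (e a) = 𝟙 X
    rw [← hpi]
    exact e.sum_comp (fun j => p j ≫ i j)

lemma IsSumOfSimples.of_split {X Y Z : M} (iY : Y ⟶ X) (pY : X ⟶ Y) (iZ : Z ⟶ X) (pZ : X ⟶ Z)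
    (hY : iY ≫ pY = 𝟙 Y) (hZ : iZ ≫ pZ = 𝟙 Z) (hX : pY ≫ iY + pZ ≫ iZ = 𝟙 X)
    (h₁ : IsSumOfSimples Y) (h₂ : IsSumOfSimples Z) : IsSumOfSimples X := by
  -- Orthogonality is automatic: sandwiching `hX` between `iY` and `pZ` gives `x + x = x` for `x =
  -- iY ≫ pZ`.
  have hYZ : iY ≫ pZ = 0 := by
    have := iY ≫= hX =≫ pZ
    simp only [Preadditive.comp_add, Preadditive.add_comp, Category.assoc, hZ, reassoc_of% hY,
      Category.comp_id, Category.id_comp] at this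
    simpa using this
  have hZY : iZ ≫ pY = 0 := by
    have := iZ ≫= hX =≫ pY
    simp only [Preadditive.comp_add, Preadditive.add_comp, Category.assoc, hY, reassoc_of% hZ,
      Category.comp_id, Category.id_comp] at this
    simpa using this
  obtain ⟨J, _, _, S, i, p, hS, hip, hip0, hpi⟩ := h₁
  obtain ⟨J', _, _, S', i', p', hS', hip', hip0', hpi'⟩ := h₂
  refine ⟨J ⊕ J', inferInstance, inferInstance, Sum.elim S S',
    fun j => match j with
      | .inl j => i j ≫ iY
      | .inr j => i' j ≫ iZ,
    fun j => match j with
      | .inl j => pY ≫ p j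
      | .inr j => pZ ≫ p' j, ?_, ?_, ?_, ?_⟩
  · rintro (j | j)
    · exact hS j
    · exact hS' j
  · rintro (j | j)
    · change (i j ≫ iY) ≫ pY ≫ p j = 𝟙 (S j)
      simp [reassoc_of% hY, hip]
    · change (i' j ≫ iZ) ≫ pZ ≫ p' j = 𝟙 (S' j)
      simp [reassoc_of% hZ, hip']
  · rintro (j | j) (l | l) hjl
    · change (i j ≫ iY) ≫ pY ≫ p l = 0
      simp [reassoc_of% hY, hip0 j l (fun h => hjl (h ▸ rfl))]
    · change (i j ≫ iY) ≫ pZ ≫ p' l = 0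
      simp [reassoc_of% hYZ]
    · change (i' j ≫ iZ) ≫ pY ≫ p l = 0
      simp [reassoc_of% hZY]
    · change (i' j ≫ iZ) ≫ pZ ≫ p' l = 0
      simp [reassoc_of% hZ, hip0' j l (fun h => hjl (h ▸ rfl))]
  · have h₁ : ∑ j, (pY ≫ p j) ≫ i j ≫ iY = pY ≫ iY := by
      have := pY ≫= hpi =≫ iY
      simpa [Preadditive.sum_comp, Preadditive.comp_sum] using this
    have h₂ : ∑ j, (pZ ≫ p' j) ≫ i' j ≫ iZ = pZ ≫ iZ := by
      have := pZ ≫= hpi' =≫ iZ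
      simpa [Preadditive.sum_comp, Preadditive.comp_sum] using this
    rw [Fintype.sum_sum_type, ← hX]
    exact congrArg₂ (· + ·) h₁ h₂

lemma IsSumOfSimples.of_simple {X : M} (h : Simple X) : IsSumOfSimples X :=
  ⟨Unit, inferInstance, inferInstance, fun _ => X, fun _ => 𝟙 X, fun _ => 𝟙 X, fun _ => h,
    by simp, fun _ _ h => absurd rfl h, by simp⟩

lemma IsSumOfSimples.of_zero {X : M} (h : 𝟙 X = 0) : IsSumOfSimples X :=
  ⟨Empty, inferInstance, inferInstance, Empty.elim, fun j => j.elim, fun j => j.elim,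
    fun j => j.elim, fun j => j.elim, fun j => j.elim, by simp [h]⟩

/-- The endomorphisms of a proper direct summand form a smaller space. -/
lemma finrank_end_lt {X Y Z : M} (iY : Y ⟶ X) (pY : X ⟶ Y) (iZ : Z ⟶ X) (pZ : X ⟶ Z)
    (hY : iY ≫ pY = 𝟙 Y) (hZ : iZ ≫ pZ = 𝟙 Z) (hYZ : iY ≫ pZ = 0) (hZ0 : 𝟙 Z ≠ 0)
    [Module.Finite k (X ⟶ X)] : Module.finrank k (Y ⟶ Y) < Module.finrank k (X ⟶ X) := by
  let φ : (Y ⟶ Y) →ₗ[k] (X ⟶ X) :=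
    { toFun := fun f => pY ≫ f ≫ iY
      map_add' := by intros; simp
      map_smul' := by intros; simp }
  have hφ : Function.Injective φ := by
    intro f g h
    have h' : pY ≫ f ≫ iY = pY ≫ g ≫ iY := h
    have := iY ≫= h' =≫ pY
    simpa [hY, reassoc_of% hY] using this
  rw [← LinearMap.finrank_range_of_inj hφ]
  apply Submodule.finrank_lt
  intro htop
  -- The idempotent of the complementary summand is not in the range: compressing to `Z` sends it to
  -- `𝟙 Z` but kills every `pY ≫ f ≫ iY`.
  have hmem : pZ ≫ iZ ∈ LinearMap.range φ := htop ▸ Submodule.mem_top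
  obtain ⟨f, hf⟩ := hmem
  have hf' : pY ≫ f ≫ iY = pZ ≫ iZ := hf
  apply hZ0
  have h2 := iZ ≫= hf' =≫ pZ
  simpa [hZ, reassoc_of% hZ, hYZ] using h2.symm

/-- Induction on the dimension of the endomorphism space. Without nontrivial idempotents, regularity
gives simplicity; otherwise `e` and `1 - e` split off two summands with strictly smaller
endomorphism spaces. -/
lemma IsFinSS.isSumOfSimples (h : IsFinSS k M) (X : M) : IsSumOfSimples X := by
  have := h.idem
  induction hn : Module.finrank k (X ⟶ X) using Nat.strong_induction_on generalizing X with
  | _ n ih =>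
  by_cases h0 : 𝟙 X = 0
  · exact .of_zero h0
  by_cases he : ∀ e : X ⟶ X, e ≫ e = e → e = 0 ∨ e = 𝟙 X
  · exact .of_simple (simple_of_trivial_idempotents h0 he h.regular)
  push Not at he
  obtain ⟨e, hee, he0, he1⟩ := he
  obtain ⟨Y, iY, pY, hY, hYe⟩ := IsIdempotentComplete.idempotents_split X e hee
  obtain ⟨Z, iZ, pZ, hZ, hZe⟩ := IsIdempotentComplete.idempotents_split X (𝟙 X - e)
    (Idempotents.idem_of_id_sub_idem e hee)
  have hYZ : iY ≫ pZ = 0 := by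
    have : iY ≫ pZ = iY ≫ (pY ≫ iY) ≫ (pZ ≫ iZ) ≫ pZ := by simp [hZ, reassoc_of% hY]
    rw [this, hYe, hZe]
    simp [reassoc_of% hee]
  have hZY : iZ ≫ pY = 0 := by
    have : iZ ≫ pY = iZ ≫ (pZ ≫ iZ) ≫ (pY ≫ iY) ≫ pY := by simp [hY, reassoc_of% hZ]
    rw [this, hYe, hZe]
    simp [reassoc_of% hee]
  have hY0 : 𝟙 Y ≠ 0 := by
    intro h
    apply he0
    rw [← hYe, ← Category.id_comp iY, h]
    simp
  have hZ0 : 𝟙 Z ≠ 0 := by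
    intro h
    apply he1
    have : 𝟙 X - e = 0 := by
      rw [← hZe, ← Category.id_comp iZ, h]
      simp
    exact (sub_eq_zero.1 this).symm
  have := h.fd X X
  refine .of_split iY pY iZ pZ hY hZ (by rw [hYe, hZe]; abel) ?_ ?_
  · exact ih _ (hn ▸ finrank_end_lt (k := k) iY pY iZ pZ hY hZ hYZ hZ0) Y rfl
  · exact ih _ (hn ▸ finrank_end_lt (k := k) iZ pZ iY pY hZ hY hZY hY0) Z rfl

lemma IsFinSS.isSemisimpleCat (h : IsFinSS k M) : IsSemisimpleCat M :=
  fun X => (h.isSumOfSimples X).exists_bicone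

end Semisimple

/-! ### Reconstruction as modules over an endomorphism algebra -/

section Finite

variable {k : Type w} [Field k] {M : Type u₁} [Category.{v₁} M] [Preadditive M] [Linear k M]

lemma op_end_smul {P X : M} (a : End P) (f : P ⟶ X) : MulOpposite.op a • f = a ≫ f := rfl

instance (P X : M) : IsScalarTower k (End P)ᵐᵒᵖ (P ⟶ X) where
  smul_assoc r a f := by
    induction a with | _ a
    change ((r • a : End P) : P ⟶ P) ≫ f = r • ((a : P ⟶ P) ≫ f)
    exact Linear.smul_comp _ _ _ _ _ _

/-- The functor `Hom(P, -)` to modules over the opposite of the endomorphism algebra of `P`. -/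
def homFunctor (h : IsFinSS k M) (P : M) : M ⥤ FGModuleCat.{v₁} (End P)ᵐᵒᵖ where
  obj X :=
    { obj := (preadditiveCoyonedaObj P).obj X
      property := by
        have := h.fd P X
        exact Module.Finite.of_restrictScalars_finite k (End P)ᵐᵒᵖ (P ⟶ X) }
  map f := ObjectProperty.homMk ((preadditiveCoyonedaObj P).map f)
  map_id X := by
    ext f
    exact Category.comp_id (f : P ⟶ X)
  map_comp f g := by
    ext a
    exact (Category.assoc (a : P ⟶ _) f g).symm

instance (h : IsFinSS k M) (P : M) : (homFunctor h P).Additive where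
  map_add {X Y f g} := by
    ext a
    exact Preadditive.comp_add P X Y a f g

instance (h : IsFinSS k M) (P : M) : (homFunctor h P).Linear k where
  map_smul {X Y} f r := by
    have H : ∀ a : P ⟶ X, a ≫ (r • f) = (r • 𝟙 P) ≫ a ≫ f := by simp
    ext a
    exact H a

/-- Morita theory: `hP` makes each `X` a retract of a power of `P`, so morphisms out of `X` are
determined by, and can be rebuilt from, their effect on maps `P ⟶ X`. A module `Q` is reached by
lifting a finite presentation of it to `f` between powers of `P`; regularity of `f` provides the
cokernel as a direct summand. -/
lemma homFunctor_isEquivalence (h : IsFinSS k M) (P : M)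
    (hP : ∀ X : M, ∃ (n : ℕ) (a : Fin n → (X ⟶ P)) (b : Fin n → (P ⟶ X)),
      ∑ j, a j ≫ b j = 𝟙 X) : (homFunctor h P).IsEquivalence where
  faithful := by
    refine ⟨fun {X Y f g} hfg => ?_⟩
    obtain ⟨n, a, b, hab⟩ := hP X
    have key : ∀ t : P ⟶ X, t ≫ f = t ≫ g := fun t =>
      congrArg (fun φ : (homFunctor h P).obj X ⟶ (homFunctor h P).obj Y => φ.hom.hom t) hfg
    rw [← Category.id_comp f, ← Category.id_comp g, ← hab]
    simp [Preadditive.sum_comp, key]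
  full := by
    refine ⟨fun {X Y} T => ?_⟩
    obtain ⟨n, a, b, hab⟩ := hP X
    let T' : (P ⟶ X) →ₗ[(End P)ᵐᵒᵖ] (P ⟶ Y) := T.hom.hom
    have hT : ∀ (c : P ⟶ P) (t : P ⟶ X), T' (c ≫ t) = c ≫ T' t := fun c t =>
      T'.map_smul (MulOpposite.op c) t
    refine ⟨∑ j, a j ≫ T' (b j), ?_⟩
    suffices H : ∀ t : P ⟶ X, t ≫ ∑ j, a j ≫ T' (b j) = T' t by
      ext t
      exact H t
    intro t
    rw [Preadditive.comp_sum]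
    conv_rhs => rw [← Category.comp_id t, ← hab, Preadditive.comp_sum, map_sum]
    refine Finset.sum_congr rfl fun j _ => ?_
    rw [← Category.assoc, ← Category.assoc, hT]
  essSurj := by
    refine ⟨fun Q => ?_⟩
    have := h.biproducts
    have := h.idem
    obtain ⟨n, q, hq⟩ := Module.Finite.exists_fin (R := (End P)ᵐᵒᵖ) (M := Q)
    let Pn : M := ⨁ fun _ : Fin n => P
    let p : (P ⟶ Pn) →ₗ[(End P)ᵐᵒᵖ] Q :=
      { toFun := fun t => ∑ j, MulOpposite.op (End.of (t ≫ biproduct.π _ j)) • q j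
        map_add' := fun s t => by
          rw [← Finset.sum_add_distrib]
          refine Finset.sum_congr rfl fun j _ => ?_
          rw [← add_smul, Preadditive.add_comp]
          rfl
        map_smul' := fun r t => by
          rw [RingHom.id_apply, Finset.smul_sum]
          refine Finset.sum_congr rfl fun j _ => ?_
          rw [← mul_smul]
          congr 1
          induction r with | _ r
          change MulOpposite.op (End.of (((r : P ⟶ P) ≫ t) ≫ _)) = _
          rw [Category.assoc]
          rfl }
    have hp : Function.Surjective p := by
      rw [← LinearMap.range_eq_top, eq_top_iff, ← hq, Submodule.span_le]
      rintro _ ⟨j, rfl⟩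
      refine ⟨biproduct.ι (fun _ : Fin n => P) j, ?_⟩
      change ∑ l, MulOpposite.op (End.of
        (biproduct.ι (fun _ : Fin n => P) j ≫ biproduct.π (fun _ : Fin n => P) l)) • q l = q j
      rw [Finset.sum_eq_single j]
      · rw [biproduct.ι_π_self]
        exact one_smul _ _
      · intro l _ hl
        rw [biproduct.ι_π_ne _ hl.symm]
        exact zero_smul _ _
      · simp
    have : IsNoetherian (End P)ᵐᵒᵖ (P ⟶ Pn) := by
      have := h.fd P Pn
      exact isNoetherian_of_tower k inferInstance
    obtain ⟨m, s, hs⟩ := Submodule.fg_iff_exists_fin_generating_family.1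
      (IsNoetherian.noetherian (LinearMap.ker p))
    let f : (⨁ fun _ : Fin m => P) ⟶ Pn := biproduct.desc s
    have hker : ∀ t : P ⟶ Pn, p t = 0 ↔ ∃ t', t = t' ≫ f := by
      intro t
      rw [← LinearMap.mem_ker, ← hs]
      constructor
      · intro ht
        induction ht using Submodule.span_induction with
        | mem x hx =>
          obtain ⟨j, rfl⟩ := hx
          exact ⟨biproduct.ι (fun _ : Fin m => P) j, (biproduct.ι_desc _ _).symm⟩
        | zero => exact ⟨0, by simp⟩
        | add x y _ _ hx hy =>
          obtain ⟨x', rfl⟩ := hx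
          obtain ⟨y', rfl⟩ := hy
          exact ⟨x' + y', by simp⟩
        | smul r x _ hx =>
          obtain ⟨x', rfl⟩ := hx
          exact ⟨(r.unop : P ⟶ P) ≫ x', (Category.assoc _ _ _).symm⟩
      · rintro ⟨t', rfl⟩
        have : t' ≫ f = ∑ j, MulOpposite.op (End.of (t' ≫ biproduct.π _ j)) • s j := by
          rw [← Category.id_comp f, ← biproduct.total]
          simp only [Preadditive.sum_comp, Preadditive.comp_sum]
          refine Finset.sum_congr rfl fun j _ => ?_
          rw [Category.assoc, biproduct.ι_desc, op_end_smul, End.of, Category.assoc]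
        rw [this]
        exact Submodule.sum_mem _ fun j _ =>
          Submodule.smul_mem _ _ (Submodule.subset_span ⟨j, rfl⟩)
    -- `g ≫ f` is an idempotent of `Pn` with the same image as `f`, so the object `X` split off by
    -- its complement is the cokernel of `f`.
    obtain ⟨g, hg⟩ := h.regular f
    have hgf : (g ≫ f) ≫ g ≫ f = g ≫ f := by rw [Category.assoc, hg]
    obtain ⟨X, i, r, hir, hri⟩ := IsIdempotentComplete.idempotents_split Pn (𝟙 Pn - g ≫ f)
      (Idempotents.idem_of_id_sub_idem _ hgf)
    let ψ : (P ⟶ X) →ₗ[(End P)ᵐᵒᵖ] Q :=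
      p.comp ((preadditiveCoyonedaObj P).map i).hom
    have hψ : ∀ t : P ⟶ X, ψ t = p (t ≫ i) := fun t => rfl
    have hbij : Function.Bijective ψ := by
      constructor
      · rw [injective_iff_map_eq_zero]
        intro t ht
        rw [hψ, hker] at ht
        obtain ⟨t', ht'⟩ := ht
        have h1 : i ≫ (𝟙 Pn - g ≫ f) = i := by rw [← hri, reassoc_of% hir]
        have h2 : t ≫ i = 0 := by
          rw [← h1, ← Category.assoc, ht']
          simp [hg]
        rw [← Category.comp_id t, ← hir, reassoc_of% h2, zero_comp]
      · intro y
        obtain ⟨t, rfl⟩ := hp y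
        refine ⟨t ≫ r, ?_⟩
        have h0 : p ((t ≫ g) ≫ f) = 0 := (hker _).2 ⟨_, rfl⟩
        rw [hψ, Category.assoc, hri, Preadditive.comp_sub, Category.comp_id, map_sub,
          ← Category.assoc, h0, sub_zero]
    let L := LinearEquiv.ofBijective ψ hbij
    have : Module.Finite (End P)ᵐᵒᵖ (P ⟶ X) := ((homFunctor h P).obj X).property
    exact ⟨X, ⟨L.toFGModuleCatIso⟩⟩

lemma IsFinSS.isFiniteCat (h : IsFinSS k M) : IsFiniteCat k M := by
  obtain ⟨P, hP⟩ := h.generator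
  have := homFunctor_isEquivalence h P hP
  have : FiniteDimensional k (End P)ᵐᵒᵖ := by
    have : Module.Finite k (End P) := h.fd P P
    exact Module.Finite.equiv (MulOpposite.opLinearEquiv k)
  exact ⟨(End P)ᵐᵒᵖ, inferInstance, inferInstance, this, (homFunctor h P).asEquivalence,
    inferInstanceAs (homFunctor h P).Additive, inferInstanceAs ((homFunctor h P).Linear k)⟩

end Finite

/-! ### From the definition of finite semisimple to the intrinsic properties -/

section OfFinite

/-- Semisimplicity of the source gives a section of `f` over its range, and semisimplicity of the
target extends that section to all of `Y`. -/
lemma exists_regular_of_isSemisimpleModule {R : Type*} [Ring R] {X Y : Type*} [AddCommGroup X]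
    [Module R X] [AddCommGroup Y] [Module R Y] [IsSemisimpleModule R X] [IsSemisimpleModule R Y]
    (f : X →ₗ[R] Y) : ∃ g : Y →ₗ[R] X, f ∘ₗ g ∘ₗ f = f := by
  obtain ⟨s, hs⟩ := IsSemisimpleModule.lifting_property f.rangeRestrict f.surjective_rangeRestrict
    LinearMap.id
  obtain ⟨g, hg⟩ := IsSemisimpleModule.extension_property (LinearMap.range f).subtype
    (LinearMap.range f).injective_subtype s
  refine ⟨g, LinearMap.ext fun x => ?_⟩
  have h1 : g (f x) = s (f.rangeRestrict x) := LinearMap.congr_fun hg (f.rangeRestrict x)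
  have h2 : f.rangeRestrict (s (f.rangeRestrict x)) = f.rangeRestrict x :=
    LinearMap.congr_fun hs _
  rw [LinearMap.comp_apply, LinearMap.comp_apply, h1]
  exact congrArg Subtype.val h2

variable {R : Type v₁} [Ring R]

/-- The Noetherian hypothesis keeps every submodule inside the category, so each inclusion can be
tested against categorical simplicity. -/
lemma isSimpleModule_of_simple [IsNoetherianRing R] (X : FGModuleCat.{v₁} R) [Simple X] :
    IsSimpleModule R X := by
  have hnt : Nontrivial X := by
    by_contra h
    rw [not_nontrivial_iff_subsingleton] at h
    apply id_nonzero X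
    ext x
    exact Subsingleton.elim _ _
  rw [isSimpleModule_iff]
  refine ⟨fun N => ?_⟩
  let j : FGModuleCat.of R N ⟶ X := FGModuleCat.ofHom N.subtype
  have : Mono j := by
    refine ⟨fun a b hab => ?_⟩
    ext x
    exact congrArg (fun φ : _ ⟶ X => φ.hom.hom x) hab
  by_cases hj : j = 0
  · left
    rw [eq_bot_iff]
    intro x hx
    exact congrArg (fun φ : FGModuleCat.of R N ⟶ X => φ.hom.hom (⟨x, hx⟩ : N)) hj
  · right
    have := isIso_of_mono_of_nonzero hj
    rw [eq_top_iff]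
    intro x _
    have h1 : j.hom.hom ((inv j).hom.hom x) = x :=
      congrArg (fun φ : X ⟶ X => φ.hom.hom x) (IsIso.inv_hom_id j)
    rw [← h1]
    exact ((inv j).hom.hom x : N).2

lemma sum_hom_hom_apply {J : Type*} {X Y : FGModuleCat.{v₁} R} (s : Finset J) (f : J → (X ⟶ Y))
    (x : X) : (∑ j ∈ s, f j).hom.hom x = ∑ j ∈ s, (f j).hom.hom x := by
  classical
  induction s using Finset.induction_on with
  | empty => rfl
  | insert a s ha ih =>
    rw [Finset.sum_insert ha, Finset.sum_insert ha, ← ih]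
    rfl

open ModuleCat in
lemma finite_hom_fgModuleCat (k : Type w) [Field k] [Algebra k R] [FiniteDimensional k R]
    (X Y : FGModuleCat.{v₁} R) : Module.Finite k (X ⟶ Y) := by
  have : Module.Finite k Y.obj := Module.Finite.trans (R := k) R Y.obj
  obtain ⟨n, q, hq⟩ := Module.Finite.exists_fin (R := R) (M := X)
  let φ : (X ⟶ Y) →ₗ[k] (Fin n → Y.obj) :=
    { toFun := fun f j => f.hom.hom (q j)
      map_add' := fun _ _ => rfl
      map_smul' := fun _ _ => rfl }
  refine Module.Finite.of_injective φ fun f g hfg => ?_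
  ext x
  refine LinearMap.congr_fun (LinearMap.ext_on_range hq fun j => ?_) x
  exact congrFun hfg j

lemma isSemisimpleModule_of_bilimit [IsNoetherianRing R] {X : FGModuleCat.{v₁} R} {n : ℕ}
    {S : Fin n → FGModuleCat.{v₁} R} (i : ∀ j, S j ⟶ X) (p : ∀ j, X ⟶ S j)
    (hS : ∀ j, Simple (S j)) (hpi : ∑ j, p j ≫ i j = 𝟙 X) : IsSemisimpleModule R X := by
  have : ∀ j, IsSimpleModule R (S j) := fun j => isSimpleModule_of_simple (S j)
  let φ : (∀ j, S j) →ₗ[R] X := ∑ j, (i j).hom.hom ∘ₗ LinearMap.proj j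
  refine IsSemisimpleModule.of_surjective φ fun x => ?_
  refine ⟨fun j => (p j).hom.hom x, ?_⟩
  have h := sum_hom_hom_apply Finset.univ (fun j => p j ≫ i j) x
  rw [hpi] at h
  simp only [φ, LinearMap.sum_apply]
  exact h.symm

/-- The decompositions are carried across the equivalence to make every finitely generated
`R`-module semisimple; the intrinsic properties then hold for modules and are pulled back. -/
lemma IsFinSS.of_isFiniteCat {k : Type w} [Field k] {M : Type u₁} [Category.{v₁} M]
    [Preadditive M] [Linear k M] (hf : IsFiniteCat k M) (hs : IsSemisimpleCat M) :
    IsFinSS k M := by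
  obtain ⟨R, _, _, _, E, _, _⟩ := hf
  have : IsNoetherianRing R := IsNoetherianRing.of_finite k R
  have hss : ∀ X : FGModuleCat.{v₁} R, IsSemisimpleModule R X := by
    intro X
    obtain ⟨n, S, b, hS, ⟨hb⟩, ⟨e⟩⟩ := hs (E.inverse.obj X)
    let e' : E.functor.obj b.pt ≅ X := E.functor.mapIso e.symm ≪≫ E.counitIso.app X
    refine isSemisimpleModule_of_bilimit (S := fun j => E.functor.obj (S j))
      (fun j => E.functor.map (b.ι j) ≫ e'.hom) (fun j => e'.inv ≫ E.functor.map (b.π j))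
      (fun j => ?_) ?_
    · have := hS j
      exact simple_obj E.functor (S j)
    · have h1 : ∑ j, b.π j ≫ b.ι j = 𝟙 b.pt := IsBilimit.total hb
      have h2 := e'.inv ≫= congrArg E.functor.map h1 =≫ e'.hom
      simpa [E.functor.map_sum, Preadditive.sum_comp, Preadditive.comp_sum] using h2
  have : IsFinSS k (FGModuleCat.{v₁} R) :=
    { biproducts := HasFiniteBiproducts.of_hasFiniteProducts
      idem := inferInstance
      fd := finite_hom_fgModuleCat k
      regular := by
        intro X Y f
        have := hss X
        have := hss Y
        obtain ⟨g, hg⟩ := exists_regular_of_isSemisimpleModule f.hom.hom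
        refine ⟨ObjectProperty.homMk (ModuleCat.ofHom g), ?_⟩
        ext x
        exact LinearMap.congr_fun hg x
      generator := ⟨FGModuleCat.of R R, fun X => by
        -- The generator is `R`: a surjection from `R^n` onto `X` splits, and the coordinates of the
        -- splitting are the required maps.
        obtain ⟨n, φ, hφ⟩ := Module.Finite.exists_fin' R X
        have : IsSemisimpleModule R (Fin n → R) := hss (FGModuleCat.of R (Fin n → R))
        obtain ⟨s, hs⟩ := IsSemisimpleModule.lifting_property φ hφ LinearMap.id
        refine ⟨n, fun j => FGModuleCat.ofHom (LinearMap.proj j ∘ₗ s),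
          fun j => FGModuleCat.ofHom (φ ∘ₗ LinearMap.single R (fun _ => R) j), ?_⟩
        have h : ∑ j, LinearMap.single R (fun _ : Fin n => R) j ∘ₗ LinearMap.proj j =
            LinearMap.id := by
          ext; simp
        ext x
        rw [sum_hom_hom_apply]
        change ∑ j, φ (Pi.single j (s x j)) = x
        rw [← map_sum, Finset.univ_sum_single]
        exact LinearMap.congr_fun hs x⟩ }
  exact this.of_equivalence E.functor

end OfFinite

/-! ## Modules over separable algebras -/

section ModBasics

open MonObj

variable {C : Type u} [Category.{v} C] [MonoidalCategory C] {B : C} [MonObj B]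

/-- The action morphism of a module. -/
def act (m : Mod C B) : B ⊗ m.X ⟶ m.X := γ[B, m.X]

lemma one_act (m : Mod C B) : η[B] ▷ m.X ≫ act m = (λ_ m.X).hom := ModObj.one_smul_self B m.X

lemma mul_act (m : Mod C B) :
    μ[B] ▷ m.X ≫ act m = (α_ B B m.X).hom ≫ B ◁ act m ≫ act m := ModObj.mul_smul_self B m.X

lemma act_hom {m n : Mod C B} (f : m ⟶ n) : act m ≫ f.hom = B ◁ f.hom ≫ act n := mod_smul_hom f

lemma one_act_assoc (m : Mod C B) {Z : C} (h : m.X ⟶ Z) :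
    η[B] ▷ m.X ≫ act m ≫ h = (λ_ m.X).hom ≫ h := by
  rw [reassoc_of% one_act m]

lemma mul_act_assoc (m : Mod C B) {Z : C} (h : m.X ⟶ Z) :
    μ[B] ▷ m.X ≫ act m ≫ h = (α_ B B m.X).hom ≫ B ◁ act m ≫ act m ≫ h := by
  rw [reassoc_of% mul_act m]

lemma act_hom_assoc {m n : Mod C B} (f : m ⟶ n) {Z : C} (h : n.X ⟶ Z) :
    act m ≫ f.hom ≫ h = B ◁ f.hom ≫ act n ≫ h := by
  rw [reassoc_of% act_hom f]

/-- Constructor for modules. -/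
def mkMod (X : C) (a : B ⊗ X ⟶ X) (h₁ : η[B] ▷ X ≫ a = (λ_ X).hom)
    (h₂ : μ[B] ▷ X ≫ a = (α_ B B X).hom ≫ B ◁ a ≫ a) : Mod C B where
  X := X
  mod := { smul := a, one_smul := h₁, mul_smul := h₂ }

/-- Constructor for morphisms of modules. -/
def mkHom {m n : Mod C B} (f : m.X ⟶ n.X) (h : act m ≫ f = B ◁ f ≫ act n) : m ⟶ n :=
  Mod.Hom.mk' f h

lemma action_X (m : Mod C B) (c : C) : (m ⊙ᵣ c).X = m.X ⊗ c := rfl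

lemma act_action (m : Mod C B) (c : C) : act (m ⊙ᵣ c) = (α_ B m.X c).inv ≫ act m ▷ c := rfl

/-- The counit of the free module adjunction. -/
def counit (m : Mod C B) : Mod.regular B ⊙ᵣ m.X ⟶ m :=
  mkHom (act m) (by
    have h : ((α_ B B m.X).inv ≫ μ[B] ▷ m.X) ≫ act m = B ◁ act m ≫ act m := by
      rw [Category.assoc, mul_act]
      simp
    exact h)

lemma counit_naturality {m n : Mod C B} (f : m ⟶ n) :
    counit m ≫ f = Mod.regular B ⊴ᵣ f.hom ≫ counit n :=
  Mod.hom_ext _ _ (act_hom f)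

section Section

variable (s : B ⟶ B ⊗ B)

/-- The section of the counit given by a separability section. -/
def unitHom (m : Mod C B) : m.X ⟶ B ⊗ m.X :=
  (λ_ m.X).inv ≫ η[B] ▷ m.X ≫ s ▷ m.X ≫ (α_ B B m.X).hom ≫ B ◁ act m

variable {s}

lemma unitHom_act (hs : s ≫ μ[B] = 𝟙 B) (m : Mod C B) : unitHom s m ≫ act m = 𝟙 m.X := by
  simp only [unitHom, Category.assoc]
  rw [← mul_act, ← comp_whiskerRight_assoc s, hs, id_whiskerRight, Category.id_comp, one_act,
    Iso.inv_hom_id]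

/-- Write `s(1) = Σ x ⊗ y`, so that `unitHom` is `v ↦ Σ x ⊗ y v`. Left linearity gives `b s(1) =
s(b)`. The right-hand side is chosen to match that of `act_unitHom`; the two together say that
`unitHom` is `B`-linear. -/
lemma whiskerLeft_unitHom (hl : B ◁ s ≫ (α_ B B B).inv ≫ μ[B] ▷ B = μ[B] ≫ s) (m : Mod C B) :
    B ◁ unitHom s m ≫ (α_ B B m.X).inv ≫ μ[B] ▷ m.X =
      s ▷ m.X ≫ (α_ B B m.X).hom ≫ B ◁ act m := by
  have h1 : B ◁ B ◁ act m ≫ (α_ B B m.X).inv ≫ μ[B] ▷ m.X =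
      (α_ B B _).inv ≫ μ[B] ▷ _ ≫ B ◁ act m := by
    rw [associator_inv_naturality_right_assoc, whisker_exchange]
  have h2 := congrArg (fun f => (B ◁ η[B] ≫ f) ▷ m.X) hl
  simp only [mul_one_assoc] at h2
  simp only [unitHom, MonoidalCategory.whiskerLeft_comp, Category.assoc, h1]
  calc _ = B ◁ (λ_ m.X).inv ≫ (α_ B (𝟙_ C) m.X).inv ≫
        (B ◁ η[B] ≫ B ◁ s ≫ (α_ B B B).inv ≫ μ[B] ▷ B) ▷ m.X ≫ (α_ B B m.X).hom ≫
        B ◁ act m := by monoidal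
    _ = _ := by
      rw [h2]
      simp

/-- Here `y (b v) = (y b) v` and right linearity gives `s(1) b = s(b)`. -/
lemma act_unitHom (hr : s ▷ B ≫ (α_ B B B).hom ≫ B ◁ μ[B] = μ[B] ≫ s) (m : Mod C B) :
    act m ≫ unitHom s m = s ▷ m.X ≫ (α_ B B m.X).hom ≫ B ◁ act m := by
  have h2 := congrArg (fun f => (η[B] ▷ B ≫ f) ▷ m.X) hr
  simp only [one_mul_assoc] at h2
  calc _ = (λ_ _).inv ≫ (𝟙_ C) ◁ act m ≫ η[B] ▷ m.X ≫ s ▷ m.X ≫ (α_ B B m.X).hom ≫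
        B ◁ act m := by
        simp [unitHom]
    _ = (λ_ _).inv ≫ η[B] ▷ (B ⊗ m.X) ≫ s ▷ (B ⊗ m.X) ≫ (α_ B B _).hom ≫
        B ◁ B ◁ act m ≫ B ◁ act m := by
        rw [whisker_exchange_assoc, whisker_exchange_assoc]
        simp
    _ = (λ_ _).inv ≫ η[B] ▷ (B ⊗ m.X) ≫ s ▷ (B ⊗ m.X) ≫ (α_ B B _).hom ≫
        B ◁ (α_ B B m.X).inv ≫ B ◁ μ[B] ▷ m.X ≫ B ◁ act m := by
        have : B ◁ act m ≫ act m = (α_ B B m.X).inv ≫ μ[B] ▷ m.X ≫ act m := by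
          simp [mul_act]
        rw [← MonoidalCategory.whiskerLeft_comp, this]
        simp
    _ = (λ_ B).inv ▷ m.X ≫ (η[B] ▷ B ≫ s ▷ B ≫ (α_ B B B).hom ≫ B ◁ μ[B]) ▷ m.X ≫
        (α_ B B m.X).hom ≫ B ◁ act m := by monoidal
    _ = _ := by
      rw [h2]
      simp

/-- The natural section of the counit over a separable algebra. -/
def sectionHom (hl : B ◁ s ≫ (α_ B B B).inv ≫ μ[B] ▷ B = μ[B] ≫ s)
    (hr : s ▷ B ≫ (α_ B B B).hom ≫ B ◁ μ[B] = μ[B] ≫ s) (m : Mod C B) :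
    m ⟶ Mod.regular B ⊙ᵣ m.X :=
  mkHom (unitHom s m) ((act_unitHom hr m).trans (whiskerLeft_unitHom hl m).symm)

end Section

lemma unitHom_naturality (s : B ⟶ B ⊗ B) {m n : Mod C B} (f : m ⟶ n) :
    f.hom ≫ unitHom s n = unitHom s m ≫ B ◁ f.hom := by
  simp only [unitHom, Category.assoc, ← MonoidalCategory.whiskerLeft_comp, act_hom]
  rw [leftUnitor_inv_naturality_assoc, whisker_exchange_assoc, whisker_exchange_assoc,
    MonoidalCategory.whiskerLeft_comp, associator_naturality_right_assoc]

lemma unitHom_action (s : B ⟶ B ⊗ B) (m : Mod C B) (c : C) :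
    unitHom s (m ⊙ᵣ c) = unitHom s m ▷ c ≫ (α_ B m.X c).hom := by
  simp only [unitHom, act_action, action_X]
  simp

/-- Data making every module a natural direct summand of a free one. -/
structure NatSection (B : C) [MonObj B] where
  app (m : Mod C B) : m ⟶ Mod.regular B ⊙ᵣ m.X
  app_counit (m : Mod C B) : app m ≫ counit m = 𝟙 m
  naturality {m n : Mod C B} (f : m ⟶ n) : f ≫ app n = app m ≫ Mod.regular B ⊴ᵣ f.hom
  app_action (m : Mod C B) (c : C) :
    app (m ⊙ᵣ c) = app m ⊵ᵣ c ≫ (αᵣ (Mod.regular B) m.X c).inv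

/-- The map `v ↦ Σ x ⊗ y v` involves only the left action, hence it is natural and compatible with
tensoring by `c` on the right. -/
lemma IsSeparableAlg.exists_natSection (h : IsSeparableAlg B) : Nonempty (NatSection B) := by
  obtain ⟨s, hs, hl, hr⟩ := h
  exact ⟨{
    app := sectionHom hl hr
    app_counit := fun m => Mod.hom_ext _ _ (unitHom_act hs m)
    naturality := fun f => Mod.hom_ext _ _ (unitHom_naturality s f)
    app_action := fun m c => Mod.hom_ext _ _ (unitHom_action s m c) }⟩

end ModBasics

/-! ### Averaging of transformations between module functors -/

section Regular

open Functor.LaxRightLinear Functor.OplaxRightLinear Functor.RightLinear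

variable {k : Type w} [Field k] {C : Type u} [Category.{v} C] [MonoidalCategory C]
  [Preadditive C] [Linear k C] [MonoidalPreadditive C] [MonoidalLinear k C]

instance (B : C) [MonObj B] : BilinearAction k C (Mod C B) where
  add_left _ _ _ := Mod.hom_ext _ _ (MonoidalPreadditive.add_whiskerRight ..)
  smul_left _ _ _ := Mod.hom_ext _ _ (MonoidalLinear.smul_whiskerRight ..)
  add_right _ _ _ _ _ := Mod.hom_ext _ _ (MonoidalPreadditive.whiskerLeft_add ..)
  smul_right _ _ _ _ _ := Mod.hom_ext _ _ (MonoidalLinear.whiskerLeft_smul ..)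

variable {B : C} [MonObj B]
  {N : Type u₂} [Category.{v₂} N] [Preadditive N] [Linear k N] [MonoidalRightAction C N]

-- The module compatibility needed for `NatSection.extend`, with the section and the counit replaced
-- by arbitrary maps `i` and `q` through `P ⊙ᵣ X`.
omit [Preadditive C] [Linear k C] [MonoidalPreadditive C] [MonoidalLinear k C] in
lemma conj_action {M : Type u₁} [Category.{v₁} M] [Preadditive M] [Linear k M]
    [MonoidalRightAction C M] (F G : ModFunctor k C M N) {P m n : M} {X : C}
    (g : F.functor.obj P ⟶ G.functor.obj P) (i : m ⟶ P ⊙ᵣ X) (q : P ⊙ᵣ X ⟶ n) (c : C) :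
    μᵣ F.functor m c ≫ F.functor.map (i ⊵ᵣ c ≫ (αᵣ P X c).inv) ≫ δᵣ F.functor P (X ⊗ c) ≫
        g ⊵ᵣ (X ⊗ c) ≫ μᵣ G.functor P (X ⊗ c) ≫ G.functor.map ((αᵣ P X c).hom ≫ q ⊵ᵣ c) =
      (F.functor.map i ≫ δᵣ F.functor P X ≫ g ⊵ᵣ X ≫ μᵣ G.functor P X ≫
        G.functor.map q) ⊵ᵣ c ≫ μᵣ G.functor n c := by
  simp only [Functor.map_comp, Category.assoc, comp_actionHomLeft]
  rw [← μᵣ_naturality_left_assoc, ← δᵣ_associativity_inv_assoc, μᵣ_comp_δᵣ_assoc,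
    μᵣ_associativity_assoc, ← μᵣ_naturality_left]
  simp

/-- The module transformation extending a morphism at the regular module. -/
def NatSection.extend (S : NatSection B) {F G : ModFunctor k C (Mod C B) N}
    (g : F.functor.obj (Mod.regular B) ⟶ G.functor.obj (Mod.regular B)) : F ⟶ G where
  nat :=
    { app := fun m => F.functor.map (S.app m) ≫ δᵣ F.functor (Mod.regular B) m.X ≫
        g ⊵ᵣ m.X ≫ μᵣ G.functor (Mod.regular B) m.X ≫ G.functor.map (counit m)
      naturality := fun m n f => by
        rw [← Functor.map_comp_assoc, S.naturality, Functor.map_comp_assoc]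
        simp only [Category.assoc, ← Functor.map_comp, counit_naturality]
        rw [δᵣ_naturality_right_assoc, action_exchange_assoc, μᵣ_naturality_right_assoc,
          Functor.map_comp] }
  comm m c := by
    exact (congrArg (fun t : m ⊙ᵣ c ⟶ Mod.regular B ⊙ᵣ (m.X ⊗ c) =>
      μᵣ F.functor m c ≫ F.functor.map t ≫ δᵣ F.functor (Mod.regular B) (m.X ⊗ c) ≫
        g ⊵ᵣ (m.X ⊗ c) ≫ μᵣ G.functor (Mod.regular B) (m.X ⊗ c) ≫
          G.functor.map (counit (m ⊙ᵣ c))) (S.app_action m c)).trans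
      (conj_action F G g (S.app m) (counit m) c)

/-- On a free module `a` is its component at the regular module tensored with an object, so a
quasi-inverse `g` there works on all free modules. Since every module is a natural retract of a free
one, conjugating by section and counit extends `g` everywhere. -/
lemma NatSection.exists_regular (S : NatSection B)
    (hN : ∀ {X Y : N} (f : X ⟶ Y), ∃ g : Y ⟶ X, f ≫ g ≫ f = f)
    {F G : ModFunctor k C (Mod C B) N} (a : F ⟶ G) : ∃ b : G ⟶ F, a ≫ b ≫ a = a := by
  obtain ⟨g, hg⟩ := hN (a.nat.app (Mod.regular B))
  refine ⟨S.extend g, ModFunctor.hom_ext fun m => ?_⟩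
  change a.nat.app m ≫ (G.functor.map (S.app m) ≫ δᵣ G.functor (Mod.regular B) m.X ≫
    g ⊵ᵣ m.X ≫ μᵣ F.functor (Mod.regular B) m.X ≫ F.functor.map (counit m)) ≫ a.nat.app m = _
  have h1 : a.nat.app (Mod.regular B ⊙ᵣ m.X) ≫ δᵣ G.functor (Mod.regular B) m.X =
      δᵣ F.functor (Mod.regular B) m.X ≫ a.nat.app (Mod.regular B) ⊵ᵣ m.X := by
    rw [← cancel_epi (μᵣ F.functor (Mod.regular B) m.X), reassoc_of% a.comm]
    simp
  have h2 := a.comm (Mod.regular B) m.X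
  simp only [Category.assoc, a.nat.naturality, ← a.nat.naturality_assoc, reassoc_of% h1,
    reassoc_of% h2, ← comp_actionHomLeft_assoc, hg]
  rw [← reassoc_of% h2, δᵣ_comp_μᵣ_assoc, ← a.nat.naturality, ← Functor.map_comp_assoc,
    S.app_counit, CategoryTheory.Functor.map_id, Category.id_comp]

end Regular

/-! ### Finite semisimplicity of categories of modules -/

section FinSS

variable {k : Type w} [Field k] {C : Type u} [Category.{v} C] [MonoidalCategory C]
  [Preadditive C] [Linear k C] [MonoidalPreadditive C] [MonoidalLinear k C] (B : C) [MonObj B]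

/-- The forgetful functor as an additive map. -/
def homAddHom (m n : Mod C B) : (m ⟶ n) →+ (m.X ⟶ n.X) where
  toFun f := f.hom
  map_zero' := rfl
  map_add' _ _ := rfl

variable {B} in
lemma mod_sum_hom {J : Type*} (t : Finset J) {m n : Mod C B} (f : J → (m ⟶ n)) :
    (∑ j ∈ t, f j).hom = ∑ j ∈ t, (f j).hom := map_sum (homAddHom B m n) f t

/-- The direct sum of modules. -/
def sumMod [HasFiniteBiproducts C] {n : ℕ} (F : Fin n → Mod C B) : Mod C B :=
  mkMod (⨁ fun j => (F j).X) (biproduct.lift fun j => B ◁ biproduct.π _ j ≫ act (F j))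
    (by
      refine biproduct.hom_ext _ _ fun j => ?_
      rw [Category.assoc, biproduct.lift_π, ← whisker_exchange_assoc, one_act]
      simp)
    (by
      refine biproduct.hom_ext _ _ fun j => ?_
      simp only [Category.assoc, biproduct.lift_π, ← whisker_exchange_assoc, mul_act]
      rw [← MonoidalCategory.whiskerLeft_comp_assoc, biproduct.lift_π]
      simp)

lemma hasFiniteBiproducts_mod [HasFiniteBiproducts C] : HasFiniteBiproducts (Mod C B) := by
  refine ⟨fun n => ⟨fun F => ?_⟩⟩
  let b : Bicone F :=
    { pt := sumMod B F
      π := fun j => mkHom (biproduct.π (fun j => (F j).X) j) (biproduct.lift_π _ _)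
      ι := fun j => mkHom (biproduct.ι (fun j => (F j).X) j) (by
        have h : act (F j) ≫ biproduct.ι (fun j => (F j).X) j =
            B ◁ biproduct.ι (fun j => (F j).X) j ≫
              biproduct.lift fun j => B ◁ biproduct.π _ j ≫ act (F j) := by
          refine biproduct.hom_ext _ _ fun l => ?_
          rw [Category.assoc, Category.assoc, biproduct.lift_π,
            ← MonoidalCategory.whiskerLeft_comp_assoc]
          by_cases h : j = l
          · subst h
            simp
          · simp [biproduct.ι_π_ne _ h]
        exact h)
      ι_π := fun j l => by
        refine Mod.hom_ext _ _ ?_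
        by_cases h : j = l
        · subst h
          rw [dif_pos rfl]
          exact biproduct.ι_π_self _ _
        · rw [dif_neg h]
          exact biproduct.ι_π_ne _ h }
  refine hasBiproduct_of_total b (Mod.hom_ext _ _ ?_)
  rw [mod_sum_hom]
  exact biproduct.total (f := fun j => (F j).X)

omit [Preadditive C] [MonoidalPreadditive C] in
lemma isIdempotentComplete_mod [IsIdempotentComplete C] : IsIdempotentComplete (Mod C B) := by
  refine ⟨fun m p hp => ?_⟩
  have hp' : p.hom ≫ p.hom = p.hom := congrArg Mod.Hom.hom hp
  obtain ⟨Y, i, e, hie, hei⟩ := IsIdempotentComplete.idempotents_split m.X p.hom hp'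
  have hpe : p.hom ≫ e = e := by rw [← hei, Category.assoc, hie, Category.comp_id]
  have hip : i ≫ p.hom = i := by rw [← hei, reassoc_of% hie]
  let a : B ⊗ Y ⟶ Y := B ◁ i ≫ act m ≫ e
  have hae : act m ≫ e = B ◁ e ≫ a := by
    simp only [a]
    rw [← MonoidalCategory.whiskerLeft_comp_assoc, hei, ← act_hom_assoc, hpe]
  have hai : a ≫ i = B ◁ i ≫ act m := by
    simp only [a, Category.assoc]
    rw [hei, act_hom, ← MonoidalCategory.whiskerLeft_comp_assoc, hip]
  refine ⟨mkMod Y a ?_ ?_, mkHom i hai, mkHom e hae, Mod.hom_ext _ _ hie, Mod.hom_ext _ _ hei⟩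
  · simp only [a]
    rw [← whisker_exchange_assoc, one_act_assoc]
    simp [hie]
  · simp only [a]
    have h1 : B ◁ (B ◁ i ≫ act m ≫ e) ≫ B ◁ i = B ◁ (B ◁ i ≫ act m) := by
      rw [← MonoidalCategory.whiskerLeft_comp]
      exact congrArg (B ◁ ·) hai
    rw [← whisker_exchange_assoc, mul_act_assoc, reassoc_of% h1]
    simp

variable {B}

/-- Maschke's argument: every `B`-module is a natural retract of the free module on its underlying
object, so regularity and a generator are inherited from `C`. -/
lemma IsFinSS.mod (h : IsFinSS k C) (hB : IsSeparableAlg B) : IsFinSS k (Mod C B) := by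
  obtain ⟨S⟩ := hB.exists_natSection
  exact
    { biproducts := by
        have := h.biproducts
        exact hasFiniteBiproducts_mod B
      idem := by
        have := h.idem
        exact isIdempotentComplete_mod B
      fd := fun m n => by
        have := h.fd m.X n.X
        let φ : (m ⟶ n) →ₗ[k] (m.X ⟶ n.X) :=
          { toFun := fun f => f.hom
            map_add' := fun _ _ => rfl
            map_smul' := fun _ _ => rfl }
        exact Module.Finite.of_injective φ fun f g hfg => Mod.hom_ext f g hfg
      regular := fun {m n} f => by
        obtain ⟨g, hg⟩ := h.regular f.hom
        -- The average of `g`, which itself need not be `B`-linear. Naturality moves both copies of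
        -- `f` into the free part, where `f g f = f` applies.
        refine ⟨S.app n ≫ Mod.regular B ⊴ᵣ g ≫ counit m, ?_⟩
        simp only [Category.assoc]
        rw [reassoc_of% S.naturality, counit_naturality,
          ← actionHomRight_comp_assoc, ← actionHomRight_comp_assoc, Category.assoc, hg,
            ← counit_naturality,
          reassoc_of% S.app_counit]
      generator := by
        obtain ⟨P, hP⟩ := h.generator
        refine ⟨Mod.regular B ⊙ᵣ P, fun m => ?_⟩
        obtain ⟨n, a, b, hab⟩ := hP m.X
        refine ⟨n, fun j => S.app m ≫ Mod.regular B ⊴ᵣ a j,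
          fun j => Mod.regular B ⊴ᵣ b j ≫ counit m, ?_⟩
        have h1 : ∑ j, Mod.regular B ⊴ᵣ a j ≫ Mod.regular B ⊴ᵣ b j =
            𝟙 (Mod.regular B ⊙ᵣ m.X) := by
          refine Mod.hom_ext _ _ ?_
          rw [mod_sum_hom]
          have := congrArg (fun f => B ◁ f) hab
          simp only [CategoryTheory.whiskerLeft_sum, MonoidalCategory.whiskerLeft_comp,
            MonoidalCategory.whiskerLeft_id] at this
          exact this
        have h2 := S.app m ≫= h1 =≫ counit m
        rw [Category.id_comp, S.app_counit] at h2
        rw [← h2]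
        simp [Preadditive.sum_comp, Preadditive.comp_sum] }

lemma IsSeparableAlg.isSeparableModCat (h : IsFinSS k C) (hB : IsSeparableAlg B) :
    IsSeparableModCat k C (Mod C B) where
  finite := (h.mod hB).isFiniteCat
  semisimple := (h.mod hB).isSemisimpleCat
  separable := ⟨B, inferInstance, hB, ModFunctor.id k C _,
    inferInstanceAs (𝟭 (Mod C B)).IsEquivalence⟩

/-- The separable module category of modules over a separable algebra. -/
def SepMod.ofAlg (h : IsFinSS k C) (B : C) [MonObj B] (hB : IsSeparableAlg B) : SepMod k C where
  carrier := Mod C B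
  isSeparable := hB.isSeparableModCat h

lemma isSeparableModCat_of_equivalence (h : IsFinSS k C) (hB : IsSeparableAlg B)
    {M : Type u₁} [Category.{v} M] [Preadditive M] [Linear k M] [MonoidalRightAction C M]
    [BilinearAction k C M] (F : ModFunctor k C M (Mod C B)) [F.functor.IsEquivalence] :
    IsSeparableModCat k C M where
  finite := ((h.mod hB).of_equivalence F.functor).isFiniteCat
  semisimple := ((h.mod hB).of_equivalence F.functor).isSemisimpleCat
  separable := ⟨B, inferInstance, hB, F, inferInstance⟩

-- Supplies the starting point `Mod C (𝟙_ C)` for the infinitude of classes.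
omit [Preadditive C] [MonoidalPreadditive C] in
lemma isSeparableAlg_unit : IsSeparableAlg (𝟙_ C) := by
  refine ⟨(λ_ _).inv, ?_, ?_, ?_⟩
  · exact Iso.inv_hom_id _
  · change _ ≫ _ ≫ (λ_ (𝟙_ C)).hom ▷ _ = (λ_ (𝟙_ C)).hom ≫ _
    monoidal
  · change _ ≫ _ ≫ _ ◁ (λ_ (𝟙_ C)).hom = (λ_ (𝟙_ C)).hom ≫ _
    monoidal

end FinSS

/-! ## Extension of scalars of an algebra -/

section Copower

variable {k : Type w} [Field k] (K : Type u₂) [Field K] [Algebra k K] [FiniteDimensional k K]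
  {C : Type u} [Category.{v} C] [Preadditive C] [Linear k C] [HasFiniteBiproducts C]

/-- The tensor product of an object with the vector space `K`. -/
def copower (k : Type w) [Field k] (K : Type u₂) [Field K] [Algebra k K] (A : C) : C :=
  ⨁ fun _ : Fin (Module.finrank k K) => A

/-- The coordinates of the tensor product of an object with `K`. -/
def copowerProj (k : Type w) [Field k] (K : Type u₂) [Field K] [Algebra k K] (A : C)
    (j : Fin (Module.finrank k K)) : copower k K A ⟶ A :=
  biproduct.π (fun _ : Fin (Module.finrank k K) => A) j

/-- The coinclusions of the tensor product of an object with `K`. -/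
def copowerIncl (k : Type w) [Field k] (K : Type u₂) [Field K] [Algebra k K] (A : C)
    (j : Fin (Module.finrank k K)) : A ⟶ copower k K A :=
  biproduct.ι (fun _ : Fin (Module.finrank k K) => A) j

/-- The inclusion `x ↦ a ⊗ x` of an object in its tensor product with `K`. -/
def inn (k : Type w) [Field k] (K : Type u₂) [Field K] [Algebra k K] [FiniteDimensional k K]
    {C : Type u} [Category.{v} C] [Preadditive C] [Linear k C]
      [HasFiniteBiproducts C] (A : C) : K →ₗ[k] (A ⟶ copower k K A) :=
  ∑ j, ((Module.finBasis k K).coord j).smulRight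
    (copowerIncl k K A j)

variable {K}

lemma inn_apply (A : C) (a : K) :
    inn k K A a = ∑ j, (Module.finBasis k K).repr a j • copowerIncl k K A j := by
  simp [inn]

lemma inn_proj (A : C) (a : K) (j : Fin (Module.finrank k K)) :
    inn k K A a ≫ copowerProj k K A j = (Module.finBasis k K).repr a j • 𝟙 A := by
  rw [inn_apply, Preadditive.sum_comp, Finset.sum_eq_single j]
  · rw [Linear.smul_comp]
    exact congrArg _ (biproduct.ι_π_self _ _)
  · intro l _ hl
    rw [Linear.smul_comp]
    have : copowerIncl k K A l ≫ copowerProj k K A j = 0 := biproduct.ι_π_ne _ hl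
    rw [this, smul_zero]
  · simp

variable (k K) in
lemma sum_proj_inn (A : C) :
    ∑ j, copowerProj k K A j ≫ inn k K A (Module.finBasis k K j) = 𝟙 (copower k K A) := by
  refine Eq.trans (Finset.sum_congr rfl fun j _ => ?_)
    (biproduct.total (f := fun _ : Fin (Module.finrank k K) => A))
  change _ = copowerProj k K A j ≫ copowerIncl k K A j
  congr 1
  rw [inn_apply, Finset.sum_eq_single j]
  · simp
  · intro l _ hl
    simp [Finsupp.single_eq_of_ne hl]
  · simp

section Desc

variable {D : Type u₁} [Category.{v₁} D] [Preadditive D] [Linear k D] (F : C ⥤ D) [F.Additive]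

-- Reduces identities on `K ⊗ A` to the elements `a ⊗ x`. An arbitrary additive `F` is allowed so
-- that this also applies after tensoring on either side.
omit [Linear k D] in
lemma copower_hom_ext {A : C} {Z : D} {f g : F.obj (copower k K A) ⟶ Z}
    (h : ∀ a : K, F.map (inn k K A a) ≫ f = F.map (inn k K A a) ≫ g) : f = g := by
  have h1 := congrArg F.map (sum_proj_inn k K A)
  rw [F.map_sum, F.map_id] at h1
  rw [← Category.id_comp f, ← Category.id_comp g, ← h1]
  simp [Preadditive.sum_comp, h]

/-- The morphism out of the tensor product with `K` given by a linear family of morphisms. -/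
def desc (A : C) (Z : D) : (K →ₗ[k] (F.obj A ⟶ Z)) →ₗ[k] (F.obj (copower k K A) ⟶ Z) where
  toFun φ := ∑ j, F.map (copowerProj k K A j) ≫ φ (Module.finBasis k K j)
  map_add' _ _ := by simp [Finset.sum_add_distrib]
  map_smul' _ _ := by simp [Finset.smul_sum]

omit [F.Additive] in
lemma inn_desc [F.Linear k] (A : C) (Z : D) (φ : K →ₗ[k] (F.obj A ⟶ Z)) (a : K) :
    F.map (inn k K A a) ≫ desc F A Z φ = φ a := by
  conv_rhs => rw [← (Module.finBasis k K).sum_repr a, map_sum]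
  simp only [desc, LinearMap.coe_mk, AddHom.coe_mk, Preadditive.comp_sum]
  refine Finset.sum_congr rfl fun j _ => ?_
  rw [← Functor.map_comp_assoc, inn_proj, Functor.map_smul, CategoryTheory.Functor.map_id,
    Linear.smul_comp,
    Category.id_comp, map_smul]

end Desc

variable [MonoidalCategory C] [MonoidalPreadditive C]

lemma whiskerRight_inn_ext {A Y Z : C} {f g : copower k K A ⊗ Y ⟶ Z}
    (h : ∀ a : K, inn k K A a ▷ Y ≫ f = inn k K A a ▷ Y ≫ g) : f = g :=
  copower_hom_ext (tensorRight Y) h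

lemma whiskerLeft_inn_ext {A Y Z : C} {f g : Y ⊗ copower k K A ⟶ Z}
    (h : ∀ a : K, Y ◁ inn k K A a ≫ f = Y ◁ inn k K A a ≫ g) : f = g :=
  copower_hom_ext (tensorLeft Y) h

lemma inn_tensor_ext {A A' Z : C} {f g : copower k K A ⊗ copower k K A' ⟶ Z}
    (h : ∀ a b : K, (inn k K A a ⊗ₘ inn k K A' b) ≫ f = (inn k K A a ⊗ₘ inn k K A' b) ≫
      g) : f = g := by
  refine whiskerRight_inn_ext fun a => whiskerLeft_inn_ext fun b => ?_
  have := h a b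
  rw [MonoidalCategory.tensorHom_def'] at this
  simpa using this

lemma inn_tensor_whiskerRight_ext {A A' Y Z : C}
    {f g : (copower k K A ⊗ copower k K A') ⊗ Y ⟶ Z}
    (h : ∀ a b : K, (inn k K A a ⊗ₘ inn k K A' b) ▷ Y ≫ f = (inn k K A a ⊗ₘ inn k K A' b) ▷ Y ≫ g) :
    f = g := by
  refine copower_hom_ext (tensorRight (copower k K A') ⋙ tensorRight Y) fun a =>
    copower_hom_ext (tensorLeft A ⋙ tensorRight Y) fun b => ?_
  have := h a b
  rw [MonoidalCategory.tensorHom_def', comp_whiskerRight, Category.assoc, Category.assoc] at this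
  exact this

variable [MonoidalLinear k C]

/-- The morphism `K ⊗ A ⊗ Y ⟶ Z` given by a linear family of morphisms. -/
def descRight (A Y Z : C) : (K →ₗ[k] (A ⊗ Y ⟶ Z)) →ₗ[k] (copower k K A ⊗ Y ⟶ Z) :=
  desc (tensorRight Y) A Z

/-- The morphism `Y ⊗ K ⊗ A ⟶ Z` given by a linear family of morphisms. -/
def descLeft (A Y Z : C) : (K →ₗ[k] (Y ⊗ A ⟶ Z)) →ₗ[k] (Y ⊗ copower k K A ⟶ Z) :=
  desc (tensorLeft Y) A Z

lemma whiskerRight_inn_descRight (A Y Z : C) (φ : K →ₗ[k] (A ⊗ Y ⟶ Z)) (a : K) :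
    inn k K A a ▷ Y ≫ descRight A Y Z φ = φ a :=
  inn_desc (tensorRight Y) A Z φ a

lemma whiskerLeft_inn_descLeft (A Y Z : C) (φ : K →ₗ[k] (Y ⊗ A ⟶ Z)) (a : K) :
    Y ◁ inn k K A a ≫ descLeft A Y Z φ = φ a :=
  inn_desc (tensorLeft Y) A Z φ a

open MonObj

variable (A : C) [MonObj A]

/-- The multiplications `x ⊗ y ↦ a b ⊗ x y` of the extension of scalars. -/
def mulFamily : K →ₗ[k] K →ₗ[k] (A ⊗ A ⟶ copower k K A) :=
  (LinearMap.mul k K).compr₂ (Linear.leftComp k (copower k K A) μ[A] ∘ₗ inn k K A)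

variable (k K) in
/-- The multiplication of the extension of scalars. -/
def copowerMul : copower k K A ⊗ copower k K A ⟶ copower k K A :=
  descRight _ _ _ (descLeft _ _ _ ∘ₗ mulFamily A)

/-- The defining rule of the multiplication; all later computations rest on it and never unfold
`copowerMul`. -/
lemma inn_inn_mul (a b : K) :
    (inn k K A a ⊗ₘ inn k K A b) ≫ copowerMul k K A = μ[A] ≫ inn k K A (a * b) := by
  rw [MonoidalCategory.tensorHom_def', Category.assoc, copowerMul, whiskerRight_inn_descRight,
    LinearMap.comp_apply, whiskerLeft_inn_descLeft]
  rfl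

instance copowerMonObj : MonObj (copower k K A) where
  one := η[A] ≫ inn k K A (1 : K)
  mul := copowerMul k K A
  one_mul := by
    refine whiskerLeft_inn_ext fun a => ?_
    have h : 𝟙_ C ◁ inn k K A a ≫ (η[A] ≫ inn k K A (1 : K)) ▷ copower k K A =
        η[A] ▷ A ≫ (inn k K A (1 : K) ⊗ₘ inn k K A a) := by
      rw [whisker_exchange, MonoidalCategory.tensorHom_def]
      simp
    rw [reassoc_of% h, inn_inn_mul]
    simp
  mul_one := by
    refine whiskerRight_inn_ext fun a => ?_
    have h : inn k K A a ▷ 𝟙_ C ≫ copower k K A ◁ (η[A] ≫ inn k K A (1 : K)) =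
        A ◁ η[A] ≫ (inn k K A a ⊗ₘ inn k K A (1 : K)) := by
      rw [← whisker_exchange, MonoidalCategory.tensorHom_def']
      simp
    rw [reassoc_of% h, inn_inn_mul]
    simp
  mul_assoc := by
    refine inn_tensor_whiskerRight_ext fun a b => whiskerLeft_inn_ext fun c => ?_
    have h1 : (A ⊗ A) ◁ inn k K A c ≫ (inn k K A a ⊗ₘ inn k K A b) ▷ copower k K A =
        ((inn k K A a ⊗ₘ inn k K A b) ⊗ₘ inn k K A c) :=
      (MonoidalCategory.tensorHom_def' _ _).symm
    have h2 : ((inn k K A a ⊗ₘ inn k K A b) ⊗ₘ inn k K A c) ≫ copowerMul k K A ▷ copower k K A =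
        μ[A] ▷ A ≫ (inn k K A (a * b) ⊗ₘ inn k K A c) := by
      rw [← MonoidalCategory.tensorHom_id, MonoidalCategory.tensorHom_comp_tensorHom, inn_inn_mul,
        ← MonoidalCategory.tensorHom_id, MonoidalCategory.tensorHom_comp_tensorHom]
      simp
    have h3 : (inn k K A a ⊗ₘ inn k K A b ⊗ₘ inn k K A c) ≫ copower k K A ◁ copowerMul k K A =
        A ◁ μ[A] ≫ (inn k K A a ⊗ₘ inn k K A (b * c)) := by
      rw [← MonoidalCategory.id_tensorHom, MonoidalCategory.tensorHom_comp_tensorHom, inn_inn_mul,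
        ← MonoidalCategory.id_tensorHom, MonoidalCategory.tensorHom_comp_tensorHom]
      simp
    rw [reassoc_of% h1, reassoc_of% h1, reassoc_of% h2, inn_inn_mul,
      associator_naturality_assoc, reassoc_of% h3, inn_inn_mul]
    simp [_root_.mul_assoc]

lemma copower_one : η[copower k K A] = η[A] ≫ inn k K A (1 : K) := rfl

lemma copower_mul : μ[copower k K A] = copowerMul k K A := rfl

section Separable

variable (s : A ⟶ A ⊗ A)

/-- The elements `Σ s₁ x ⊗ s₂ y` of the extension of scalars. -/
def sepInsert : TensorProduct k K K →ₗ[k] (A ⟶ copower k K A ⊗ copower k K A) :=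
  TensorProduct.lift (LinearMap.mk₂ k (fun x y => s ≫ (inn k K A x ⊗ₘ inn k K A y))
    (by simp [MonoidalPreadditive.add_tensor])
    (by simp [MonoidalCategory.tensorHom_def])
    (by simp [MonoidalPreadditive.tensor_add])
    (by simp [MonoidalCategory.tensorHom_def]))

omit [MonObj A] in
lemma sepInsert_tmul (x y : K) : sepInsert A s (x ⊗ₜ[k] y) = s ≫ (inn k K A x ⊗ₘ inn k K A y) := by
  simp [sepInsert]

-- The section is `a ⊗ x ↦ (a ⊗ 1) t · s(x)`, the product of the section of `K` given by a
-- separability element `t` with the section `s` of `A`. Each identity is checked on pure tensors of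
-- `K ⊗ K` and extended by linearity.
open TensorProduct in
lemma isSeparableAlg_copower [Algebra.IsSeparable k K] (h : IsSeparableAlg A) :
    IsSeparableAlg (copower k K A) := by
  obtain ⟨s, hs, hl, hr⟩ := h
  have := Algebra.FormallyUnramified.of_isSeparable k K
  -- A separable extension is formally unramified, which provides `t` with product `1` and
  -- annihilated by `1 ⊗ b - b ⊗ 1`.
  obtain ⟨t, ht, ht1⟩ :=
    (Algebra.FormallyUnramified.iff_exists_tensorProduct (R := k) (S := K)).1 inferInstance
  let φ : K →ₗ[k] (A ⟶ copower k K A ⊗ copower k K A) :=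
    sepInsert A s ∘ₗ LinearMap.mulRight k t ∘ₗ Algebra.TensorProduct.includeLeft.toLinearMap
  let s' : copower k K A ⟶ copower k K A ⊗ copower k K A := desc (𝟭 C) A _ φ
  have hs' : ∀ a, inn k K A a ≫ s' = sepInsert A s ((a ⊗ₜ 1) * t) := fun a => inn_desc (𝟭 C) A _ φ a
  have hmul : ∀ τ : K ⊗[k] K,
      sepInsert A s τ ≫ copowerMul k K A = inn k K A (Algebra.TensorProduct.lmul' k τ) := by
    intro τ
    induction τ with
    | zero => simp
    | add x y hx hy => simp [hx, hy]
    | tmul x y => simp [sepInsert_tmul, inn_inn_mul, reassoc_of% hs]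
  have hleft : ∀ (a : K) (τ : K ⊗[k] K), inn k K A a ▷ A ≫ copower k K A ◁ sepInsert A s τ ≫
      (α_ _ _ _).inv ≫ copowerMul k K A ▷ copower k K A = μ[A] ≫ sepInsert A s ((a ⊗ₜ 1) * τ) := by
    intro a τ
    induction τ with
    | zero => simp
    | add x y hx hy => simp [mul_add, hx, hy]
    | tmul x y =>
      simp only [sepInsert_tmul, Algebra.TensorProduct.tmul_mul_tmul, _root_.one_mul]
      rw [MonoidalCategory.whiskerLeft_comp_assoc, ← whisker_exchange_assoc]
      have h1 : inn k K A a ▷ (A ⊗ A) ≫ copower k K A ◁ (inn k K A x ⊗ₘ inn k K A y) =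
          (inn k K A a ⊗ₘ inn k K A x ⊗ₘ inn k K A y) := (MonoidalCategory.tensorHom_def _ _).symm
      have h2 : ((inn k K A a ⊗ₘ inn k K A x) ⊗ₘ inn k K A y) ≫ copowerMul k K A ▷ copower k K A =
          μ[A] ▷ A ≫ (inn k K A (a * x) ⊗ₘ inn k K A y) := by
        rw [← MonoidalCategory.tensorHom_id, MonoidalCategory.tensorHom_comp_tensorHom,
          inn_inn_mul, ← MonoidalCategory.tensorHom_id, MonoidalCategory.tensorHom_comp_tensorHom]
        simp
      rw [reassoc_of% h1, associator_inv_naturality_assoc, h2, reassoc_of% hl]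
  have hright : ∀ (b : K) (τ : K ⊗[k] K), A ◁ inn k K A b ≫ sepInsert A s τ ▷ copower k K A ≫
      (α_ _ _ _).hom ≫ copower k K A ◁ copowerMul k K A =
        μ[A] ≫ sepInsert A s ((1 ⊗ₜ b) * τ) := by
    intro b τ
    induction τ with
    | zero => simp
    | add x y hx hy => simp [mul_add, hx, hy]
    | tmul x y =>
      simp only [sepInsert_tmul, Algebra.TensorProduct.tmul_mul_tmul, _root_.one_mul]
      rw [comp_whiskerRight_assoc, whisker_exchange_assoc]
      have h1 : (A ⊗ A) ◁ inn k K A b ≫ (inn k K A x ⊗ₘ inn k K A y) ▷ copower k K A =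
          ((inn k K A x ⊗ₘ inn k K A y) ⊗ₘ inn k K A b) :=
            (MonoidalCategory.tensorHom_def' _ _).symm
      have h2 : (inn k K A x ⊗ₘ inn k K A y ⊗ₘ inn k K A b) ≫ copower k K A ◁ copowerMul k K A =
          A ◁ μ[A] ≫ (inn k K A x ⊗ₘ inn k K A (y * b)) := by
        rw [← MonoidalCategory.id_tensorHom, MonoidalCategory.tensorHom_comp_tensorHom,
          inn_inn_mul, ← MonoidalCategory.id_tensorHom, MonoidalCategory.tensorHom_comp_tensorHom]
        simp
      rw [reassoc_of% h1, associator_naturality_assoc, h2, reassoc_of% hr, mul_comm y b]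
  refine ⟨s', ?_, ?_, ?_⟩
  · refine copower_hom_ext (𝟭 C) fun a => ?_
    change inn k K A a ≫ s' ≫ copowerMul k K A = inn k K A a ≫ 𝟙 _
    rw [reassoc_of% hs', hmul, map_mul, ht1]
    simp
  · refine inn_tensor_ext fun a b => ?_
    rw [copower_mul, reassoc_of% inn_inn_mul (k := k) (A := A) a b, hs',
      MonoidalCategory.tensorHom_def, Category.assoc,
      ← MonoidalCategory.whiskerLeft_comp_assoc, hs', hleft, ← _root_.mul_assoc]
    simp
  · refine inn_tensor_ext fun a b => ?_
    rw [copower_mul, reassoc_of% inn_inn_mul (k := k) (A := A) a b, hs',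
      MonoidalCategory.tensorHom_def', Category.assoc,
      ← comp_whiskerRight_assoc, hs', hright, mul_left_comm]
    -- Right linearity is the only place where `b` must cross from the second tensor factor to the
    -- first.
    have hb : ((1 : K) ⊗ₜ[k] b) * t = (b ⊗ₜ 1) * t := by
      rw [← sub_eq_zero, ← sub_mul]
      exact ht b
    rw [hb, ← _root_.mul_assoc]
    simp

end Separable

end Copower

/-! ## Extension of scalars of module categories -/

namespace BaseChange

open Functor.LaxRightLinear Functor.OplaxRightLinear Functor.RightLinear

variable {k : Type w} [Field k] {K : Type u₄} [Field K] [Algebra k K]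

section Objects

variable {M : Type u₁} [Category.{v₁} M] [Preadditive M] [Linear k M]

/-- Constructor for objects with an action of `K`. -/
def mkObj (X : M) (φ : K →ₗ[k] (X ⟶ X)) (h₁ : φ 1 = 𝟙 X) (h₂ : ∀ a b, φ (a * b) = φ b ≫ φ a) :
    BaseChange k K M where
  obj := X
  act := AlgHom.ofLinearMap
    { toFun := fun a => End.of (φ a)
      map_add' := φ.map_add
      map_smul' := φ.map_smul } h₁ h₂

/-- The scalar action as a linear map. -/
def scalarₗ (X : BaseChange k K M) : K →ₗ[k] (X.obj ⟶ X.obj) where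
  toFun := X.scalar
  map_add' := map_add X.act
  map_smul' := map_smul X.act

@[simp] lemma scalarₗ_apply (X : BaseChange k K M) (a : K) : X.scalarₗ a = X.scalar a := rfl

lemma scalar_one (X : BaseChange k K M) : X.scalar 1 = 𝟙 X.obj := map_one X.act

lemma scalar_mul (X : BaseChange k K M) (a b : K) :
    X.scalar (a * b) = X.scalar b ≫ X.scalar a := map_mul X.act a b

/-- Constructor for isomorphisms. -/
def isoMk {X Y : BaseChange k K M} (e : X.obj ≅ Y.obj)
    (h : ∀ a, X.scalar a ≫ e.hom = e.hom ≫ Y.scalar a) : X ≅ Y where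
  hom := ⟨e.hom, h⟩
  inv := ⟨e.inv, fun a => by rw [Iso.eq_inv_comp, ← reassoc_of% h, e.hom_inv_id, Category.comp_id]⟩
  hom_inv_id := Hom.ext e.hom_inv_id
  inv_hom_id := Hom.ext e.inv_hom_id

end Objects

section Map

variable {C : Type u} [Category.{v} C] [MonoidalCategory C] [Preadditive C] [Linear k C]
  {M : Type u₁} [Category.{v₁} M] [Preadditive M] [Linear k M] [MonoidalRightAction C M]
  [BilinearAction k C M]
  {N : Type u₂} [Category.{v₂} N] [Preadditive N] [Linear k N] [MonoidalRightAction C N]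
  [BilinearAction k C N]

/-- The action of a linear functor on objects with an action of `K`. -/
def mapObj (F : ModFunctor k C M N) (X : BaseChange k K M) : BaseChange k K N :=
  mkObj (F.functor.obj X.obj) (F.functor.mapLinearMap k ∘ₗ X.scalarₗ)
    (by
      change F.functor.map (X.scalar 1) = _
      rw [scalar_one, CategoryTheory.Functor.map_id])
    (fun a b => by
      change F.functor.map (X.scalar (a * b)) =
        F.functor.map (X.scalar b) ≫ F.functor.map (X.scalar a)
      rw [scalar_mul, Functor.map_comp])

variable (K) in
/-- The module functor between extensions of scalars given by a module functor. -/
def mapFunctor (F : ModFunctor k C M N) : ModFunctor k C (BaseChange k K M) (BaseChange k K N) where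
  functor :=
    { obj := mapObj F
      map := fun {X Y} f =>
        { hom := F.functor.map f.hom
          comm := fun a => by
            change F.functor.map (X.scalar a) ≫ F.functor.map f.hom =
              F.functor.map f.hom ≫ F.functor.map (Y.scalar a)
            rw [← Functor.map_comp, f.comm, Functor.map_comp] }
      map_id := fun X => Hom.ext (F.functor.map_id X.obj)
      map_comp := fun f g => Hom.ext (F.functor.map_comp f.hom g.hom) }
  additive := ⟨Hom.ext F.functor.map_add⟩
  linear := ⟨fun f r => Hom.ext (F.functor.map_smul r f.hom)⟩
  rightLinear :=
    { μᵣ := fun X c =>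
        { hom := μᵣ F.functor X.obj c
          comm := fun a => μᵣ_naturality_left F.functor (X.scalar a) c }
      δᵣ := fun X c =>
        { hom := δᵣ F.functor X.obj c
          comm := fun a => δᵣ_naturality_left F.functor (X.scalar a) c }
      μᵣ_naturality_right := fun X _ _ f => Hom.ext (μᵣ_naturality_right F.functor X.obj f)
      μᵣ_naturality_left := fun f c => Hom.ext (μᵣ_naturality_left F.functor f.hom c)
      μᵣ_associativity := fun X c c' => Hom.ext (μᵣ_associativity F.functor X.obj c c')
      μᵣ_unitality := fun X => Hom.ext (μᵣ_unitality F.functor X.obj)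
      δᵣ_naturality_right := fun X _ _ f => Hom.ext (δᵣ_naturality_right F.functor X.obj f)
      δᵣ_naturality_left := fun f c => Hom.ext (δᵣ_naturality_left F.functor f.hom c)
      δᵣ_associativity := fun X c c' => Hom.ext (δᵣ_associativity F.functor X.obj c c')
      δᵣ_unitality_inv := fun X => Hom.ext (δᵣ_unitality_inv F.functor X.obj)
      μᵣ_comp_δᵣ := fun X c => Hom.ext (μᵣ_comp_δᵣ F.functor X.obj c)
      δᵣ_comp_μᵣ := fun X c => Hom.ext (δᵣ_comp_μᵣ F.functor X.obj c) }

instance (F : ModFunctor k C M N) [F.functor.IsEquivalence] :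
    (mapFunctor K F).functor.IsEquivalence where
  faithful := ⟨fun {X Y f g} h => Hom.ext (F.functor.map_injective (congrArg Hom.hom h))⟩
  full := ⟨fun {X Y} g => by
    let g' : F.functor.obj X.obj ⟶ F.functor.obj Y.obj := g.hom
    refine ⟨⟨F.functor.preimage g', fun a => F.functor.map_injective ?_⟩, Hom.ext ?_⟩
    · rw [Functor.map_comp, Functor.map_comp, Functor.map_preimage]
      exact g.comm a
    · exact F.functor.map_preimage g'⟩
  essSurj := ⟨fun Y => by
    let e := F.functor.objObjPreimageIso Y.obj
    -- The action of `K` on `Y` is transported along `e` and lifted through the fully faithful `F`;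
    -- each axiom is checked after applying `F`.
    let ψ : K → (F.functor.objPreimage Y.obj ⟶ F.functor.objPreimage Y.obj) :=
      fun a => F.functor.preimage (e.hom ≫ Y.scalar a ≫ e.inv)
    have hψ : ∀ a, F.functor.map (ψ a) = e.hom ≫ Y.scalar a ≫ e.inv :=
      fun a => F.functor.map_preimage _
    let φ : K →ₗ[k] (F.functor.objPreimage Y.obj ⟶ F.functor.objPreimage Y.obj) :=
      { toFun := ψ
        map_add' := fun a b => F.functor.map_injective (by
          rw [F.functor.map_add, hψ, hψ, hψ, ← scalarₗ_apply, map_add]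
          simp)
        map_smul' := fun r a => F.functor.map_injective (by
          rw [F.functor.map_smul, hψ, hψ, ← scalarₗ_apply, map_smul]
          simp) }
    have h1 : φ 1 = 𝟙 _ := F.functor.map_injective ((hψ 1).trans (by
      rw [scalar_one, Category.id_comp, e.hom_inv_id, CategoryTheory.Functor.map_id]))
    have h2 : ∀ a b, φ (a * b) = φ b ≫ φ a := fun a b => F.functor.map_injective
      ((hψ (a * b)).trans (by
        rw [F.functor.map_comp]
        change _ = F.functor.map (ψ b) ≫ F.functor.map (ψ a)
        rw [hψ, hψ, scalar_mul]
        simp))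
    refine ⟨mkObj _ φ h1 h2, ⟨isoMk e fun a => ?_⟩⟩
    change F.functor.map (ψ a) ≫ e.hom = e.hom ≫ Y.scalar a
    rw [hψ]
    simp⟩

end Map

end BaseChange

/-! ### `A`-modules with an action of `K` as modules over `K ⊗ A` -/

section Modules

open MonObj

variable {k : Type w} [Field k] {K : Type u₄} [Field K] [Algebra k K]
  [FiniteDimensional k K] {C : Type u} [Category.{v} C] [MonoidalCategory C]
  [Preadditive C] [Linear k C] [MonoidalPreadditive C] [MonoidalLinear k C]
  [HasFiniteBiproducts C] {A : C} [MonObj A]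

/-- The linear family of action morphisms of an `A`-module with an action of `K`. -/
def actFamily (X : BaseChange k K (Mod C A)) : K →ₗ[k] (A ⊗ X.obj.X ⟶ X.obj.X) where
  toFun a := act X.obj ≫ (X.scalar a).hom
  map_add' a b := by
    rw [← Preadditive.comp_add, ← mod_add_hom]
    congr 2
    exact map_add X.act a b
  map_smul' r a := by
    rw [RingHom.id_apply, ← Linear.comp_smul, ← mod_smul_hom']
    congr 2
    exact map_smul X.act r a

/-- The action of the extension of scalars of `A` on an `A`-module with an action of `K`. -/
def copowerAct (X : BaseChange k K (Mod C A)) : copower k K A ⊗ X.obj.X ⟶ X.obj.X :=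
  descRight _ _ _ (actFamily X)

lemma inn_copowerAct (X : BaseChange k K (Mod C A)) (a : K) :
    inn k K A a ▷ X.obj.X ≫ copowerAct X = act X.obj ≫ (X.scalar a).hom :=
  whiskerRight_inn_descRight _ _ _ _ a

/-- An `A`-module with an action of `K` as a module over the extension of scalars of `A`. -/
def toModObj (X : BaseChange k K (Mod C A)) : Mod C (copower k K A) :=
  mkMod X.obj.X (copowerAct X)
    (by
      rw [copower_one, comp_whiskerRight, Category.assoc, inn_copowerAct, BaseChange.scalar_one]
      simp [one_act])
    (by
      refine inn_tensor_whiskerRight_ext fun a b => ?_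
      rw [copower_mul, ← comp_whiskerRight_assoc, inn_inn_mul, comp_whiskerRight_assoc,
        inn_copowerAct, mul_act_assoc, MonoidalCategory.tensorHom_def', comp_whiskerRight_assoc,
        associator_naturality_left_assoc, ← whisker_exchange_assoc, inn_copowerAct,
        associator_naturality_middle_assoc, ← MonoidalCategory.whiskerLeft_comp_assoc,
        inn_copowerAct, MonoidalCategory.whiskerLeft_comp_assoc, ← act_hom_assoc,
        BaseChange.scalar_mul]
      rfl)

lemma copowerAct_comp {X Y : BaseChange k K (Mod C A)} (f : X ⟶ Y) :
    copowerAct X ≫ f.hom.hom = copower k K A ◁ f.hom.hom ≫ copowerAct Y := by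
  refine whiskerRight_inn_ext fun a => ?_
  have h : (X.scalar a).hom ≫ f.hom.hom = f.hom.hom ≫ (Y.scalar a).hom :=
    congrArg Mod.Hom.hom (f.comm a)
  rw [reassoc_of% inn_copowerAct X a, h, ← whisker_exchange_assoc, inn_copowerAct, act_hom_assoc]

lemma toModObj_action (X : BaseChange k K (Mod C A)) (c : C) :
    copowerAct (X ⊙ᵣ c) = (α_ _ X.obj.X c).inv ≫ copowerAct X ▷ c := by
  refine whiskerRight_inn_ext fun a => ?_
  rw [inn_copowerAct]
  have h : inn k K A a ▷ (X.obj.X ⊗ c) ≫ (α_ _ X.obj.X c).inv ≫ copowerAct X ▷ c =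
      (α_ _ _ _).inv ≫ (inn k K A a ▷ X.obj.X ≫ copowerAct X) ▷ c := by
    simp
  refine Eq.trans ?_ h.symm
  rw [inn_copowerAct, comp_whiskerRight, ← Category.assoc]
  rfl

variable (k K A) in
/-- The functor from `A`-modules with an action of `K` to modules over the extension of
scalars of `A`. -/
def toMod : BaseChange k K (Mod C A) ⥤ Mod C (copower k K A) where
  obj X := toModObj X
  map {X Y} f := mkHom (m := toModObj X) (n := toModObj Y) f.hom.hom
    (copowerAct_comp f)

variable (k K A) in
/-- The equivalence between `A`-modules with an action of `K` and modules over the extension of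
scalars of `A`, as a module functor. -/
def toModFunctor : ModFunctor k C (BaseChange k K (Mod C A)) (Mod C (copower k K A)) where
  functor := toMod k K A
  additive := ⟨Mod.hom_ext _ _ rfl⟩
  linear := ⟨fun _ _ => Mod.hom_ext _ _ rfl⟩
  rightLinear :=
    { μᵣ := fun X c => mkHom (m := toModObj X ⊙ᵣ c) (n := toModObj (X ⊙ᵣ c)) (𝟙 (X.obj.X ⊗ c))
        (by
          change ((α_ _ X.obj.X c).inv ≫ copowerAct X ▷ c) ≫ 𝟙 _ = _ ◁ 𝟙 _ ≫ copowerAct (X ⊙ᵣ c)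
          rw [toModObj_action, MonoidalCategory.whiskerLeft_id]
          exact (Category.comp_id _).trans (Category.id_comp _).symm)
      δᵣ := fun X c => mkHom (m := toModObj (X ⊙ᵣ c)) (n := toModObj X ⊙ᵣ c) (𝟙 (X.obj.X ⊗ c))
        (by
          change copowerAct (X ⊙ᵣ c) ≫ 𝟙 _ = _ ◁ 𝟙 _ ≫ ((α_ _ X.obj.X c).inv ≫ copowerAct X ▷ c)
          rw [toModObj_action, MonoidalCategory.whiskerLeft_id]
          exact (Category.comp_id _).trans (Category.id_comp _).symm)
      μᵣ_naturality_right := fun _ _ _ _ => Mod.hom_ext _ _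
        ((Category.comp_id _).trans (Category.id_comp _).symm)
      μᵣ_naturality_left := fun _ _ => Mod.hom_ext _ _
        ((Category.comp_id _).trans (Category.id_comp _).symm)
      μᵣ_associativity := fun X c c' => Mod.hom_ext _ _ (by
        change 𝟙 _ ≫ (α_ X.obj.X c c').inv = (α_ X.obj.X c c').inv ≫ 𝟙 _ ▷ c' ≫ 𝟙 _
        simp)
      μᵣ_unitality := fun X => Mod.hom_ext _ _ (Category.id_comp (ρ_ X.obj.X).hom).symm
      δᵣ_naturality_right := fun _ _ _ _ => Mod.hom_ext _ _
        ((Category.comp_id _).trans (Category.id_comp _).symm)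
      δᵣ_naturality_left := fun _ _ => Mod.hom_ext _ _
        ((Category.comp_id _).trans (Category.id_comp _).symm)
      δᵣ_associativity := fun X c c' => Mod.hom_ext _ _ (by
        change 𝟙 _ ≫ (α_ X.obj.X c c').inv = (α_ X.obj.X c c').inv ≫ 𝟙 _ ≫ 𝟙 _ ▷ c'
        simp)
      δᵣ_unitality_inv := fun X => Mod.hom_ext _ _ (Category.comp_id (ρ_ X.obj.X).inv).symm
      μᵣ_comp_δᵣ := fun _ _ => Mod.hom_ext _ _ (Category.id_comp _)
      δᵣ_comp_μᵣ := fun _ _ => Mod.hom_ext _ _ (Category.id_comp _) }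

/-- The scalar action recovered from a module over the extension of scalars. -/
def modScalar (m : Mod C (copower k K A)) (a : K) : m.X ⟶ m.X :=
  (λ_ m.X).inv ≫ (η[A] ≫ inn k K A a) ▷ m.X ≫ act m

lemma modScalar_toModObj (X : BaseChange k K (Mod C A)) (a : K) :
    modScalar (toModObj X) a = (X.scalar a).hom := by
  change (λ_ X.obj.X).inv ≫ (η[A] ≫ inn k K A a) ▷ X.obj.X ≫ copowerAct X = _
  rw [comp_whiskerRight_assoc, inn_copowerAct, one_act_assoc, Iso.inv_hom_id_assoc]

lemma modScalar_naturality {m n : Mod C (copower k K A)} (f : m ⟶ n) (a : K) :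
    modScalar m a ≫ f.hom = f.hom ≫ modScalar n a := by
  rw [modScalar, modScalar, Category.assoc, Category.assoc, act_hom, ← whisker_exchange_assoc,
    leftUnitor_inv_naturality_assoc]

/-- The action of `A` is the restriction of that of `K ⊗ A` along `x ↦ 1 ⊗ x`. -/
lemma act_eq_inn_one_act {X Y : BaseChange k K (Mod C A)}
    (f : X.obj.X ⟶ Y.obj.X) (hf : copowerAct X ≫ f = copower k K A ◁ f ≫ copowerAct Y) :
    act X.obj ≫ f = A ◁ f ≫ act Y.obj := by
  have h : ∀ X : BaseChange k K (Mod C A),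
      act X.obj = inn k K A (1 : K) ▷ X.obj.X ≫ copowerAct X := by
    intro X
    rw [inn_copowerAct, BaseChange.scalar_one]
    simp
  rw [h X, h Y, Category.assoc, hf, whisker_exchange_assoc]

/-- Restriction of scalars to `A` of a module over the extension of scalars. -/
def restrictScalars (m : Mod C (copower k K A)) : Mod C A :=
  mkMod m.X (inn k K A (1 : K) ▷ m.X ≫ act m)
    (by
      rw [← comp_whiskerRight_assoc, ← copower_one, one_act])
    (by
      have h : μ[A] ≫ inn k K A (1 : K) =
          (inn k K A (1 : K) ⊗ₘ inn k K A (1 : K)) ≫ μ[copower k K A] := by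
        rw [copower_mul, inn_inn_mul]
        simp
      rw [← comp_whiskerRight_assoc, h, comp_whiskerRight_assoc, mul_act,
        MonoidalCategory.tensorHom_def, comp_whiskerRight_assoc, associator_naturality_middle_assoc,
        ← MonoidalCategory.whiskerLeft_comp_assoc, associator_naturality_left_assoc,
        ← whisker_exchange_assoc])

/-- This is `(a ⊗ 1)(b ⊗ x) = ab ⊗ x` read on the module; the next lemma is its mirror image. -/
lemma act_modScalar (m : Mod C (copower k K A)) (a b : K) :
    inn k K A b ▷ m.X ≫ act m ≫ modScalar m a = inn k K A (a * b) ▷ m.X ≫ act m := by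
  have h : (λ_ A).inv ≫ η[A] ▷ A ≫ (inn k K A a ⊗ₘ inn k K A b) ≫ μ[copower k K A] =
      inn k K A (a * b) := by
    rw [copower_mul, inn_inn_mul, one_mul_assoc, Iso.inv_hom_id_assoc]
  rw [← h]
  simp only [comp_whiskerRight, Category.assoc, mul_act, MonoidalCategory.tensorHom_def, modScalar]
  simp only [leftUnitor_inv_naturality_assoc, whisker_exchange_assoc]
  simp

lemma whiskerLeft_modScalar_act (m : Mod C (copower k K A)) (a b : K) :
    A ◁ modScalar m a ≫ inn k K A b ▷ m.X ≫ act m = inn k K A (b * a) ▷ m.X ≫ act m := by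
  have h : (ρ_ A).inv ≫ A ◁ η[A] ≫ (inn k K A b ⊗ₘ inn k K A a) ≫ μ[copower k K A] =
      inn k K A (b * a) := by
    rw [copower_mul, inn_inn_mul, mul_one_assoc, Iso.inv_hom_id_assoc]
  rw [← h]
  simp only [comp_whiskerRight, Category.assoc, mul_act, MonoidalCategory.tensorHom_def', modScalar]
  simp only [MonoidalCategory.whiskerLeft_comp, Category.assoc]
  simp [whisker_exchange_assoc]

lemma inn_act (m : Mod C (copower k K A)) (a : K) :
    inn k K A a ▷ m.X ≫ act m = act (restrictScalars m) ≫ modScalar m a := by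
  have h := act_modScalar m a 1
  rw [_root_.mul_one] at h
  rw [← h]
  exact (Category.assoc _ _ _).symm

/-- The elements `a ⊗ 1` and `1 ⊗ x` commute: both products are `a ⊗ x`. -/
lemma modScalar_act (m : Mod C (copower k K A)) (a : K) :
    act (restrictScalars m) ≫ modScalar m a = A ◁ modScalar m a ≫ act (restrictScalars m) := by
  have h := whiskerLeft_modScalar_act m a 1
  rw [_root_.one_mul] at h
  exact (inn_act m a).symm.trans h.symm

lemma modScalar_one (m : Mod C (copower k K A)) : modScalar m 1 = 𝟙 m.X := by
  rw [modScalar, ← copower_one, one_act, Iso.inv_hom_id]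

lemma modScalar_mul (m : Mod C (copower k K A)) (a b : K) :
    modScalar m (a * b) = modScalar m b ≫ modScalar m a := by
  have h := act_modScalar m a b
  rw [modScalar, comp_whiskerRight, Category.assoc, ← h, modScalar.eq_def m b]
  simp

/-- A module over the extension of scalars of `A` as an `A`-module with an action of `K`. -/
def ofModObj (m : Mod C (copower k K A)) : BaseChange k K (Mod C A) :=
  BaseChange.mkObj (restrictScalars m)
    { toFun := fun a => mkHom (m := restrictScalars m) (n := restrictScalars m) (modScalar m a)
        (modScalar_act m a)
      map_add' := fun a b => Mod.hom_ext _ _ (by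
        change modScalar m (a + b) = modScalar m a + modScalar m b
        simp [modScalar])
      map_smul' := fun r a => Mod.hom_ext _ _ (by
        change modScalar m (r • a) = r • modScalar m a
        simp [modScalar]) }
    (Mod.hom_ext _ _ (modScalar_one m)) (fun a b => Mod.hom_ext _ _ (modScalar_mul m a b))

-- Lets the identity of the underlying object serve as a module isomorphism when two actions are
-- provably equal.
omit [Preadditive C] [Linear k C] [MonoidalPreadditive C] [MonoidalLinear k C]
  [HasFiniteBiproducts C] in
lemma act_comp_id_of_eq {B X : C} {f g : B ⊗ X ⟶ X} (h : f = g) : f ≫ 𝟙 X = B ◁ 𝟙 X ≫ g := by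
  simp [h]

lemma copowerAct_ofModObj (m : Mod C (copower k K A)) : copowerAct (ofModObj m) = act m :=
  whiskerRight_inn_ext fun a => (inn_copowerAct (ofModObj m) a).trans (inn_act m a).symm

instance : (toMod k K A).IsEquivalence where
  faithful := ⟨fun {X Y f g} h => BaseChange.hom_ext (Mod.hom_ext _ _
    (congrArg (fun f : toModObj X ⟶ toModObj Y => f.hom) h :))⟩
  full := ⟨fun {X Y} f => ⟨
    { hom := mkHom f.hom (act_eq_inn_one_act f.hom (act_hom f))
      comm := fun a => Mod.hom_ext _ _ (by
        have h := modScalar_naturality f a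
        change modScalar (toModObj X) a ≫ _ = _ ≫ modScalar (toModObj Y) a at h
        rw [modScalar_toModObj, modScalar_toModObj] at h
        exact h) }, Mod.hom_ext _ _ rfl⟩⟩
  essSurj := ⟨fun m => ⟨ofModObj m, ⟨
    { hom := mkHom (m := toModObj (ofModObj m)) (n := m) (𝟙 m.X)
        (act_comp_id_of_eq (copowerAct_ofModObj m))
      inv := mkHom (m := m) (n := toModObj (ofModObj m)) (𝟙 m.X)
        (act_comp_id_of_eq (copowerAct_ofModObj m).symm)
      hom_inv_id := Mod.hom_ext _ _ (Category.comp_id _)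
      inv_hom_id := Mod.hom_ext _ _ (Category.comp_id _) }⟩⟩⟩

instance : (toModFunctor k K A).functor.IsEquivalence :=
  inferInstanceAs (toMod k K A).IsEquivalence

end Modules

/-! ## Central idempotents and direct sum decompositions -/

section Central

open Functor.LaxRightLinear Functor.OplaxRightLinear Functor.RightLinear

variable {k : Type w} [Field k] {C : Type u} [Category.{v} C] [MonoidalCategory C]
  {M : Type u₁} [Category.{v₁} M] [Preadditive M] [Linear k M] [MonoidalRightAction C M]
  {N : Type u₂} [Category.{v₂} N] [Preadditive N] [Linear k N] [MonoidalRightAction C N]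

variable (C) in
/-- A family of endomorphisms is an endomorphism of the identity module functor. -/
structure IsCentral (e : ∀ m : N, m ⟶ m) : Prop where
  naturality {m n : N} (f : m ⟶ n) : f ≫ e n = e m ≫ f
  action (m : N) (c : C) : e (m ⊙ᵣ c) = e m ⊵ᵣ c

lemma isCentral_app (e : ModFunctor.id k C N ⟶ ModFunctor.id k C N) :
    IsCentral C (fun m : N => (e.nat.app m : m ⟶ m)) where
  naturality f := e.nat.naturality f
  action m c := (Category.id_comp _).symm.trans ((e.comm m c).trans (Category.comp_id _))

/-- The image of a central idempotent, as a full module subcategory with chosen splittings. -/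
structure Corner (G : ModFunctor k C M N) (e : ∀ m : N, m ⟶ m) where
  obj : N → M
  ι (m : N) : G.functor.obj (obj m) ⟶ m
  π (m : N) : m ⟶ G.functor.obj (obj m)
  ι_π (m : N) : ι m ≫ π m = 𝟙 _
  π_ι (m : N) : π m ≫ ι m = e m

namespace Corner

variable {G : ModFunctor k C M N} {e : ∀ m : N, m ⟶ m} (D : Corner G e)

lemma ι_e (m : N) : D.ι m ≫ e m = D.ι m := by rw [← D.π_ι, reassoc_of% D.ι_π]

lemma e_π (m : N) : e m ≫ D.π m = D.π m := by rw [← D.π_ι, Category.assoc, D.ι_π, Category.comp_id]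

lemma ι_π_action (m : N) (c : C) : D.ι m ⊵ᵣ c ≫ D.π m ⊵ᵣ c = 𝟙 _ := by
  rw [← comp_actionHomLeft, D.ι_π, id_actionHomLeft]

variable (he : IsCentral C e)
include he

/-- Centrality moves the idempotent across `f`, and `ι` absorbs it; this makes compression to the
image functorial. -/
lemma ι_comp {m n : N} (f : m ⟶ n) : D.ι m ≫ f ≫ D.π n ≫ D.ι n = D.ι m ≫ f := by
  rw [D.π_ι, he.naturality, reassoc_of% D.ι_e]

lemma comp_π {m n : N} (f : m ⟶ n) : D.π m ≫ D.ι m ≫ f ≫ D.π n = f ≫ D.π n := by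
  rw [reassoc_of% D.π_ι, ← reassoc_of% he.naturality f, D.e_π]

lemma ι_action (m : N) (c : C) :
    D.ι m ⊵ᵣ c ≫ D.π (m ⊙ᵣ c) ≫ D.ι (m ⊙ᵣ c) = D.ι m ⊵ᵣ c := by
  rw [D.π_ι, he.action, ← comp_actionHomLeft, D.ι_e]

lemma ι_action' (m : N) (c : C) :
    D.ι (m ⊙ᵣ c) ≫ D.π m ⊵ᵣ c ≫ D.ι m ⊵ᵣ c = D.ι (m ⊙ᵣ c) := by
  rw [← comp_actionHomLeft, D.π_ι, ← he.action, D.ι_e]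

variable [G.functor.Full] [G.functor.Faithful]

omit he [G.functor.Faithful] in
/-- The action on morphisms of the projection onto the image of a central idempotent. -/
def projMap {m n : N} (f : m ⟶ n) : D.obj m ⟶ D.obj n :=
  G.functor.preimage (D.ι m ≫ f ≫ D.π n)

omit he [G.functor.Faithful] in
/-- The lax structure of the projection. -/
def projμ (m : N) (c : C) : D.obj m ⊙ᵣ c ⟶ D.obj (m ⊙ᵣ c) :=
  G.functor.preimage (δᵣ G.functor (D.obj m) c ≫ D.ι m ⊵ᵣ c ≫ D.π (m ⊙ᵣ c))

omit he [G.functor.Faithful] in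
/-- The oplax structure of the projection. -/
def projδ (m : N) (c : C) : D.obj (m ⊙ᵣ c) ⟶ D.obj m ⊙ᵣ c :=
  G.functor.preimage (D.ι (m ⊙ᵣ c) ≫ D.π m ⊵ᵣ c ≫ μᵣ G.functor (D.obj m) c)

omit he [G.functor.Faithful] in
lemma map_projMap {m n : N} (f : m ⟶ n) :
    G.functor.map (D.projMap f) = D.ι m ≫ f ≫ D.π n :=
  G.functor.map_preimage _

omit he [G.functor.Faithful] in
lemma map_projμ (m : N) (c : C) : G.functor.map (D.projμ m c) =
    δᵣ G.functor (D.obj m) c ≫ D.ι m ⊵ᵣ c ≫ D.π (m ⊙ᵣ c) := G.functor.map_preimage _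

omit he [G.functor.Faithful] in
lemma map_projδ (m : N) (c : C) : G.functor.map (D.projδ m c) =
    D.ι (m ⊙ᵣ c) ≫ D.π m ⊵ᵣ c ≫ μᵣ G.functor (D.obj m) c := G.functor.map_preimage _

lemma projμ_projδ (m : N) (c : C) : D.projμ m c ≫ D.projδ m c = 𝟙 _ := by
  apply G.functor.map_injective
  rw [Functor.map_comp, map_projμ, map_projδ]
  simp only [Category.assoc]
  rw [reassoc_of% D.ι_action he, reassoc_of% D.ι_π_action]
  simp

lemma projδ_projμ (m : N) (c : C) : D.projδ m c ≫ D.projμ m c = 𝟙 _ := by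
  apply G.functor.map_injective
  rw [Functor.map_comp, map_projμ, map_projδ]
  simp only [Category.assoc]
  rw [μᵣ_comp_δᵣ_assoc, reassoc_of% D.ι_action' he, D.ι_π, CategoryTheory.Functor.map_id]

lemma projμ_naturality_right (m : N) {c c' : C} (f : c ⟶ c') :
    D.obj m ⊴ᵣ f ≫ D.projμ m c' = D.projμ m c ≫ D.projMap (m ⊴ᵣ f) := by
  apply G.functor.map_injective
  simp only [Functor.map_comp, map_projμ, map_projMap, Category.assoc]
  rw [δᵣ_naturality_right_assoc, action_exchange_assoc, reassoc_of% D.ι_action he]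

lemma projμ_naturality_left {m n : N} (f : m ⟶ n) (c : C) :
    D.projMap f ⊵ᵣ c ≫ D.projμ n c = D.projμ m c ≫ D.projMap (f ⊵ᵣ c) := by
  apply G.functor.map_injective
  simp only [Functor.map_comp, map_projμ, map_projMap, Category.assoc]
  rw [δᵣ_naturality_left_assoc, map_projMap, ← comp_actionHomLeft_assoc, Category.assoc,
    Category.assoc, D.ι_comp he, reassoc_of% D.ι_action he, comp_actionHomLeft_assoc]

lemma projμ_associativity (m : N) (c c' : C) :
    D.projμ m (c ⊗ c') ≫ D.projMap (αᵣ m c c').hom =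
      (αᵣ (D.obj m) c c').hom ≫ D.projμ m c ⊵ᵣ c' ≫ D.projμ (m ⊙ᵣ c) c' := by
  apply G.functor.map_injective
  simp only [Functor.map_comp, map_projμ, map_projMap, Category.assoc]
  rw [reassoc_of% D.ι_action he, δᵣ_naturality_left_assoc, map_projμ, ← comp_actionHomLeft_assoc,
    Category.assoc, Category.assoc, D.ι_action he, comp_actionHomLeft_assoc,
    ← δᵣ_associativity_assoc]
  simp

lemma projμ_unitality (m : N) :
    (ρᵣ (D.obj m)).hom = D.projμ m (𝟙_ C) ≫ D.projMap (ρᵣ m).hom := by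
  apply G.functor.map_injective
  simp only [Functor.map_comp, map_projμ, map_projMap, Category.assoc]
  rw [reassoc_of% D.ι_action he, ← δᵣ_unitality_hom]
  have h : D.ι m ⊵ᵣ (𝟙_ C) ≫ (ρᵣ m).hom = (ρᵣ _).hom ≫ D.ι m := by simp
  rw [reassoc_of% h, D.ι_π, Category.comp_id]

lemma projμ_projδ_whisker (m : N) (c c' : C) :
    (D.projμ m c ⊵ᵣ c' ≫ D.projμ (m ⊙ᵣ c) c') ≫ D.projδ (m ⊙ᵣ c) c' ≫ D.projδ m c ⊵ᵣ c' =
      𝟙 _ := by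
  rw [Category.assoc, reassoc_of% D.projμ_projδ he, ← comp_actionHomLeft,
    D.projμ_projδ he, id_actionHomLeft]

lemma projδ_unitality (m : N) :
    (ρᵣ (D.obj m)).inv = D.projMap (ρᵣ m).inv ≫ D.projδ m (𝟙_ C) := by
  have h : D.projMap (ρᵣ[C] m).inv ≫ D.projMap (ρᵣ[C] m).hom = 𝟙 _ := by
    apply G.functor.map_injective
    simp only [Functor.map_comp, map_projMap, Category.assoc]
    rw [reassoc_of% D.ι_comp he, Iso.inv_hom_id_assoc, D.ι_π, CategoryTheory.Functor.map_id]
  rw [← cancel_mono (ρᵣ (D.obj m)).hom, Iso.inv_hom_id, Category.assoc, D.projμ_unitality he,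
    reassoc_of% D.projδ_projμ he, h]

omit he in
lemma projMap_add {m n : N} (f g : m ⟶ n) :
    D.projMap (f + g) = D.projMap f + D.projMap g :=
  G.functor.map_injective (by
    simp only [Functor.map_add, map_projMap, Preadditive.comp_add, Preadditive.add_comp])

omit he in
lemma projMap_smul (r : k) {m n : N} (f : m ⟶ n) : D.projMap (r • f) = r • D.projMap f :=
  G.functor.map_injective (by
    simp only [Functor.map_smul, map_projMap, Linear.comp_smul, Linear.smul_comp])

omit he [Preadditive M] in
/-- Inverting a square of invertible morphisms. -/
lemma inv_square {X Y Z W : M} {a : X ⟶ Y} {a' : Y ⟶ X} {b : Z ⟶ W} {b' : W ⟶ Z}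
    {f : X ⟶ Z} {g : Y ⟶ W} (ha : a' ≫ a = 𝟙 Y) (hb : b ≫ b' = 𝟙 Z) (h : f ≫ b = a ≫ g) :
    g ≫ b' = a' ≫ f := by
  rw [← Category.id_comp g, ← ha, Category.assoc, Category.assoc, ← reassoc_of% h, hb,
    Category.comp_id]

/-- The projection functor onto the image of a central idempotent. -/
def projFunctor : N ⥤ M where
  obj := D.obj
  map := D.projMap
  map_id m := G.functor.map_injective (by
    rw [map_projMap, Category.id_comp, D.ι_π, CategoryTheory.Functor.map_id])
  map_comp f g := G.functor.map_injective (by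
    simp only [Functor.map_comp, map_projMap, Category.assoc]
    rw [reassoc_of% D.ι_comp he])

/-- The projection onto the image of a central idempotent, as a module functor. -/
def proj : ModFunctor k C N M where
  functor := D.projFunctor he
  additive := ⟨D.projMap_add _ _⟩
  linear := ⟨fun f r => D.projMap_smul r f⟩
  rightLinear :=
    { μᵣ := D.projμ
      δᵣ := D.projδ
      μᵣ_naturality_right := fun m _ _ f => D.projμ_naturality_right he m f
      μᵣ_naturality_left := fun f c => D.projμ_naturality_left he f c
      μᵣ_associativity := fun m c c' => D.projμ_associativity he m c c'
      μᵣ_unitality := fun m => D.projμ_unitality he m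
      -- Since `projδ` is inverse to `projμ`, the oplax naturality and associativity laws are the
      -- lax squares inverted.
      δᵣ_naturality_right := fun m c c' f => inv_square (D.projδ_projμ he m c)
        (D.projμ_projδ he m c') (D.projμ_naturality_right he m f)
      δᵣ_naturality_left := fun {m n} f c => inv_square (D.projδ_projμ he m c)
        (D.projμ_projδ he n c) (D.projμ_naturality_left he f c)
      δᵣ_associativity := fun m c c' => (inv_square (D.projδ_projμ he m (c ⊗ c'))
        (D.projμ_projδ_whisker he m c c')
        (D.projμ_associativity he m c c').symm).symm
      δᵣ_unitality_inv := fun m => D.projδ_unitality he m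
      μᵣ_comp_δᵣ := D.projμ_projδ he
      δᵣ_comp_μᵣ := D.projδ_projμ he }

end Corner

/-- Complementary central idempotents decompose a module category. -/
lemma isDirectSum_of_corners {M' : Type u₃} [Category.{v₃} M'] [Preadditive M'] [Linear k M']
    [MonoidalRightAction C M'] [HasBinaryBiproducts N] {G : ModFunctor k C M N}
    {G' : ModFunctor k C M' N} [G.functor.Full] [G.functor.Faithful] [G'.functor.Full]
    [G'.functor.Faithful] {e e' : ∀ m : N, m ⟶ m} (he : IsCentral C e) (he' : IsCentral C e')
    (h : ∀ m, e m + e' m = 𝟙 m) (D : Corner G e) (D' : Corner G' e')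
    (hG : ∀ n, e (G.functor.obj n) = 𝟙 _) (hG' : ∀ n, e' (G'.functor.obj n) = 𝟙 _) :
    IsDirectSum k C N M M' := by
  have hG0 : ∀ n, e' (G.functor.obj n) = 0 := fun n => by
    simpa [hG n] using h (G.functor.obj n)
  have hG0' : ∀ n, e (G'.functor.obj n) = 0 := fun n => by
    simpa [hG' n] using h (G'.functor.obj n)
  -- From `e + e' = 1` and `e e = e` one gets `e e' = 0`, so the two images are orthogonal.
  have h0 : ∀ m, D.ι m ≫ D'.π m = 0 := fun m => by
    rw [← D'.e_π, ← D.ι_e, Category.assoc]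
    have h1 := e m ≫= h m
    have h2 : e m ≫ e m = e m := by rw [← D.π_ι, Category.assoc, reassoc_of% D.ι_π]
    rw [Preadditive.comp_add, h2, Category.comp_id, add_eq_left] at h1
    rw [reassoc_of% h1, zero_comp, comp_zero]
  have h0' : ∀ m, D'.ι m ≫ D.π m = 0 := fun m => by
    rw [← D.e_π, ← D'.ι_e, Category.assoc]
    have h1 := e' m ≫= h m
    have h2 : e' m ≫ e' m = e' m := by rw [← D'.π_ι, Category.assoc, reassoc_of% D'.ι_π]
    rw [Preadditive.comp_add, h2, Category.comp_id, add_eq_right] at h1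
    rw [reassoc_of% h1, zero_comp, comp_zero]
  -- A morphism is the sum of its two compressions, whence faithfulness; fullness uses the same
  -- formula with prescribed compressions.
  have hdec : ∀ {m n : N} (f : m ⟶ n), f = D.π m ≫ G.functor.map (D.projMap f) ≫ D.ι n +
      D'.π m ≫ G'.functor.map (D'.projMap f) ≫ D'.ι n := fun {m n} f => by
    rw [D.map_projMap, D'.map_projMap]
    simp only [Category.assoc]
    rw [D.ι_comp he, D'.ι_comp he', reassoc_of% D.π_ι, reassoc_of% D'.π_ι, ← Preadditive.add_comp,
      h, Category.id_comp]
  -- The biproduct realises the pair, because `e` kills the image of `G'` and `e'` kills the image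
  -- of `G`.
  have hret : ∀ n₁ n₂, ∃ m, Nonempty (D.obj m ≅ n₁) ∧ Nonempty (D'.obj m ≅ n₂) := by
    intro n₁ n₂
    refine ⟨G.functor.obj n₁ ⊞ G'.functor.obj n₂, ⟨G.functor.preimageIso
      { hom := D.ι _ ≫ biprod.fst
        inv := biprod.inl ≫ D.π _
        hom_inv_id := ?_
        inv_hom_id := ?_ }⟩, ⟨G'.functor.preimageIso
      { hom := D'.ι _ ≫ biprod.snd
        inv := biprod.inr ≫ D'.π _
        hom_inv_id := ?_
        inv_hom_id := ?_ }⟩⟩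
    · have h1 : D.ι (G.functor.obj n₁ ⊞ G'.functor.obj n₂) ≫ biprod.snd = 0 := by
        rw [← D.ι_e, Category.assoc, ← he.naturality, hG0', comp_zero, comp_zero]
      have h2 := D.ι (G.functor.obj n₁ ⊞ G'.functor.obj n₂) ≫= biprod.total =≫ D.π _
      simp only [Preadditive.comp_add, Preadditive.add_comp, Category.assoc, Category.id_comp] at h2
      rw [reassoc_of% h1, zero_comp, add_zero, D.ι_π] at h2
      simpa using h2
    · rw [Category.assoc, reassoc_of% D.π_ι, ← he.naturality, hG, Category.comp_id, biprod.inl_fst]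
    · have h1 : D'.ι (G.functor.obj n₁ ⊞ G'.functor.obj n₂) ≫ biprod.fst = 0 := by
        rw [← D'.ι_e, Category.assoc, ← he'.naturality, hG0, comp_zero, comp_zero]
      have h2 := D'.ι (G.functor.obj n₁ ⊞ G'.functor.obj n₂) ≫= biprod.total =≫ D'.π _
      simp only [Preadditive.comp_add, Preadditive.add_comp, Category.assoc, Category.id_comp] at h2
      rw [reassoc_of% h1, zero_comp, zero_add, D'.ι_π] at h2
      simpa using h2
    · rw [Category.assoc, reassoc_of% D'.π_ι, ← he'.naturality, hG', Category.comp_id,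
        biprod.inr_snd]
  refine ⟨D.proj he, D'.proj he',
    { faithful := ⟨fun {m n f g} hfg => ?_⟩
      full := ⟨fun {m n} g => ?_⟩
      essSurj := ⟨fun n => ?_⟩ }⟩
  · have h1 : D.projMap f = D.projMap g := congrArg Prod.fst hfg
    have h2 : D'.projMap f = D'.projMap g := congrArg Prod.snd hfg
    rw [hdec f, hdec g, h1, h2]
  · let g₁ : D.obj m ⟶ D.obj n := g.1
    let g₂ : D'.obj m ⟶ D'.obj n := g.2
    refine ⟨D.π m ≫ G.functor.map g₁ ≫ D.ι n + D'.π m ≫ G'.functor.map g₂ ≫ D'.ι n,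
      Prod.ext ?_ ?_⟩
    · refine G.functor.map_injective ((D.map_projMap _).trans ?_)
      simp only [Preadditive.add_comp, Category.assoc, D.ι_π, h0', comp_zero,
        add_zero, Category.comp_id]
      rw [reassoc_of% D.ι_π]
      rfl
    · refine G'.functor.map_injective ((D'.map_projMap _).trans ?_)
      simp only [Preadditive.add_comp, Category.assoc, D'.ι_π, h0, comp_zero,
        zero_add, Category.comp_id]
      rw [reassoc_of% D'.ι_π]
      rfl
  · obtain ⟨m, ⟨i₁⟩, ⟨i₂⟩⟩ := hret n.1 n.2
    exact ⟨m, ⟨Iso.prod i₁ i₂⟩⟩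

section Lift

variable {G : ModFunctor k C M N} {e : ∀ m : N, m ⟶ m} (D : Corner G e)

/-- Extension by zero of a central family on the image of a central idempotent. -/
def Corner.lift (a : ∀ n : M, n ⟶ n) (m : N) : m ⟶ m :=
  D.π m ≫ G.functor.map (a (D.obj m)) ≫ D.ι m

/-- Both properties come from naturality of `a`, applied to `projMap f` for morphisms and to the
structure map `projδ` for the action. -/
lemma Corner.isCentral_lift [G.functor.Full] [G.functor.Faithful] (he : IsCentral C e)
    {a : ∀ n : M, n ⟶ n} (ha : IsCentral C a) : IsCentral C (D.lift a) where
  naturality {m n} f := by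
    have h := congrArg G.functor.map (ha.naturality (D.projMap f))
    simp only [Functor.map_comp, D.map_projMap, Category.assoc] at h
    have h' := D.π m ≫= h =≫ D.ι n
    simp only [Category.assoc] at h'
    rw [D.ι_comp he, reassoc_of% D.comp_π he] at h'
    rw [Corner.lift, Corner.lift, h']
    simp only [Category.assoc]
  action m c := by
    have h := congrArg G.functor.map (ha.naturality (D.projδ m c))
    rw [ha.action] at h
    simp only [Functor.map_comp, D.map_projδ, Category.assoc] at h
    have h' := D.π (m ⊙ᵣ c) ≫= h =≫ (δᵣ G.functor (D.obj m) c ≫ D.ι m ⊵ᵣ c)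
    simp only [Category.assoc] at h'
    rw [μᵣ_comp_δᵣ_assoc, D.ι_action' he, δᵣ_naturality_left_assoc, μᵣ_comp_δᵣ_assoc,
      reassoc_of% D.π_ι, he.action, ← comp_actionHomLeft, ← comp_actionHomLeft,
      ← comp_actionHomLeft, reassoc_of% D.e_π] at h'
    exact h'.symm

lemma Corner.ι_lift_π (a : ∀ n : M, n ⟶ n) (m : N) :
    D.ι m ≫ D.lift a m ≫ D.π m = G.functor.map (a (D.obj m)) := by
  simp only [Corner.lift, Category.assoc, D.ι_π, Category.comp_id]
  rw [reassoc_of% D.ι_π]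

end Lift

end Central

/-! ## Corners of algebras -/

section Restriction

open MonObj

variable {C : Type u} [Category.{v} C] [MonoidalCategory C] {A B : C} [MonObj A] [MonObj B]

-- The unit of `A` makes the action morphism a split epimorphism.
omit [MonObj B] in
lemma act_cancel (m : Mod C A) {W : C} {f g : m.X ⟶ W} (h : act m ≫ f = act m ≫ g) : f = g := by
  have h' := (λ_ m.X).inv ≫= η[A] ▷ m.X ≫= h
  rwa [one_act_assoc, one_act_assoc, Iso.inv_hom_id_assoc, Iso.inv_hom_id_assoc] at h'

/-- Restriction of a module along an algebra morphism. -/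
def resObj (p : A ⟶ B) [IsMonHom p] (m : Mod C B) : Mod C A :=
  mkMod m.X (p ▷ m.X ≫ act m)
    (by rw [← comp_whiskerRight_assoc, IsMonHom.one_hom, one_act])
    (by
      rw [← comp_whiskerRight_assoc, IsMonHom.mul_hom, comp_whiskerRight_assoc, mul_act,
        MonoidalCategory.tensorHom_def, comp_whiskerRight_assoc, associator_naturality_middle_assoc,
        ← MonoidalCategory.whiskerLeft_comp_assoc, associator_naturality_left_assoc,
        ← whisker_exchange_assoc])

lemma resObj_linear (p : A ⟶ B) [IsMonHom p] {m n : Mod C B} (f : m.X ⟶ n.X)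
    (h : act m ≫ f = B ◁ f ≫ act n) :
    (p ▷ m.X ≫ act m) ≫ f = A ◁ f ≫ p ▷ n.X ≫ act n := by
  rw [Category.assoc, h, whisker_exchange_assoc]

lemma resObj_action (p : A ⟶ B) [IsMonHom p] (m : Mod C B) (c : C) :
    p ▷ (m.X ⊗ c) ≫ (α_ B m.X c).inv ≫ act m ▷ c =
      (α_ A m.X c).inv ≫ (p ▷ m.X ≫ act m) ▷ c := by
  simp

/-- Restriction of modules along an algebra morphism. -/
def resFunctor (p : A ⟶ B) [IsMonHom p] : Mod C B ⥤ Mod C A where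
  obj := resObj p
  map {m n} f := mkHom (m := resObj p m) (n := resObj p n) f.hom
    (resObj_linear p f.hom (act_hom f))

instance (p : A ⟶ B) [IsMonHom p] : (resFunctor p).Faithful where
  map_injective {m n _ _} h := Mod.hom_ext _ _
    (congrArg (fun f : resObj p m ⟶ resObj p n => f.hom) h :)

/-- `p` is split by `i`, so linearity over `A` forces linearity over `B`. The section `i` need not
be an algebra map. -/
lemma resFunctor_full (p : A ⟶ B) [IsMonHom p] (i : B ⟶ A) (hip : i ≫ p = 𝟙 B) :
    (resFunctor p).Full where
  map_surjective {m n} f := by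
    have h : ∀ (g : m.X ⟶ n.X), (p ▷ m.X ≫ act m) ≫ g = A ◁ g ≫ p ▷ n.X ≫ act n →
        act m ≫ g = B ◁ g ≫ act n := fun g hg => by
      have := i ▷ m.X ≫= hg
      rw [Category.assoc, ← comp_whiskerRight_assoc, hip, id_whiskerRight, Category.id_comp,
        ← whisker_exchange_assoc, ← comp_whiskerRight_assoc, hip, id_whiskerRight,
        Category.id_comp] at this
      exact this
    exact ⟨mkHom f.hom (h f.hom (act_hom f)), Mod.hom_ext _ _ rfl⟩

/-- If `p ≫ i` acts trivially, letting `B` act through `i` is well behaved although `i` is not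
assumed multiplicative: `hY` absorbs the defect. -/
lemma exists_resObj_iso (p : A ⟶ B) [IsMonHom p] (i : B ⟶ A) (hip : i ≫ p = 𝟙 B) (Y : Mod C A)
    (hY : (p ≫ i) ▷ Y.X ≫ act Y = act Y) : ∃ n : Mod C B, Nonempty (resObj p n ≅ Y) := by
  have hμ : μ[B] = (i ⊗ₘ i) ≫ μ[A] ≫ p := by
    rw [IsMonHom.mul_hom, MonoidalCategory.tensorHom_comp_tensorHom_assoc, hip]
    simp
  let n : Mod C B := mkMod Y.X (i ▷ Y.X ≫ act Y)
    (by
      rw [← IsMonHom.one_hom (f := p), ← comp_whiskerRight_assoc, Category.assoc,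
        comp_whiskerRight_assoc, hY, one_act])
    (by
      rw [hμ, ← comp_whiskerRight_assoc, Category.assoc, Category.assoc, ← Category.assoc,
        comp_whiskerRight_assoc, hY, comp_whiskerRight_assoc, mul_act,
        MonoidalCategory.tensorHom_def, comp_whiskerRight_assoc, associator_naturality_middle_assoc,
        ← MonoidalCategory.whiskerLeft_comp_assoc, associator_naturality_left_assoc,
        ← whisker_exchange_assoc])
  have h : p ▷ Y.X ≫ i ▷ Y.X ≫ act Y = act Y := by
    rw [← comp_whiskerRight_assoc, hY]
  exact ⟨n, ⟨
    { hom := mkHom (m := resObj p n) (n := Y) (𝟙 Y.X) (act_comp_id_of_eq h)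
      inv := mkHom (m := Y) (n := resObj p n) (𝟙 Y.X) (act_comp_id_of_eq h.symm)
      hom_inv_id := Mod.hom_ext _ _ (Category.comp_id _)
      inv_hom_id := Mod.hom_ext _ _ (Category.comp_id _) }⟩⟩

variable [Preadditive C] [MonoidalPreadditive C] (k : Type w) [Field k] [Linear k C]
  [MonoidalLinear k C]

/-- Restriction of modules along an algebra morphism, as a module functor. -/
def res (p : A ⟶ B) [IsMonHom p] : ModFunctor k C (Mod C B) (Mod C A) where
  functor := resFunctor p
  additive := ⟨Mod.hom_ext _ _ rfl⟩
  linear := ⟨fun _ _ => Mod.hom_ext _ _ rfl⟩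
  rightLinear :=
    { μᵣ := fun m c => mkHom (m := resObj p m ⊙ᵣ c) (n := resObj p (m ⊙ᵣ c)) (𝟙 (m.X ⊗ c))
        (act_comp_id_of_eq (resObj_action p m c).symm)
      δᵣ := fun m c => mkHom (m := resObj p (m ⊙ᵣ c)) (n := resObj p m ⊙ᵣ c) (𝟙 (m.X ⊗ c))
        (act_comp_id_of_eq (resObj_action p m c))
      μᵣ_naturality_right := fun _ _ _ _ => Mod.hom_ext _ _
        ((Category.comp_id _).trans (Category.id_comp _).symm)
      μᵣ_naturality_left := fun _ _ => Mod.hom_ext _ _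
        ((Category.comp_id _).trans (Category.id_comp _).symm)
      μᵣ_associativity := fun m c c' => Mod.hom_ext _ _ (by
        change 𝟙 _ ≫ (α_ m.X c c').inv = (α_ m.X c c').inv ≫ 𝟙 _ ▷ c' ≫ 𝟙 _
        simp)
      μᵣ_unitality := fun m => Mod.hom_ext _ _ (Category.id_comp (ρ_ m.X).hom).symm
      δᵣ_naturality_right := fun _ _ _ _ => Mod.hom_ext _ _
        ((Category.comp_id _).trans (Category.id_comp _).symm)
      δᵣ_naturality_left := fun _ _ => Mod.hom_ext _ _
        ((Category.comp_id _).trans (Category.id_comp _).symm)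
      δᵣ_associativity := fun m c c' => Mod.hom_ext _ _ (by
        change 𝟙 _ ≫ (α_ m.X c c').inv = (α_ m.X c c').inv ≫ 𝟙 _ ≫ 𝟙 _ ▷ c'
        simp)
      δᵣ_unitality_inv := fun m => Mod.hom_ext _ _ (Category.comp_id (ρ_ m.X).inv).symm
      μᵣ_comp_δᵣ := fun _ _ => Mod.hom_ext _ _ (Category.id_comp _)
      δᵣ_comp_μᵣ := fun _ _ => Mod.hom_ext _ _ (Category.id_comp _) }

instance (p : A ⟶ B) [IsMonHom p] : (res k p).functor.Faithful :=
  inferInstanceAs (resFunctor p).Faithful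

lemma res_full (p : A ⟶ B) [IsMonHom p] (i : B ⟶ A) (hip : i ≫ p = 𝟙 B) :
    (res k p).functor.Full :=
  resFunctor_full p i hip

end Restriction

/-! ### Split quotients of algebras -/

section Quotient

open MonObj

variable {C : Type u} [Category.{v} C] [MonoidalCategory C] {A B : C} [MonObj A]

/-- The algebra structure on a split quotient of an algebra. -/
abbrev quotientMonObj (i : B ⟶ A) (p : A ⟶ B) (hip : i ≫ p = 𝟙 B)
    (hm : μ[A] ≫ p = (p ≫ i ⊗ₘ p ≫ i) ≫ μ[A] ≫ p) : MonObj B := by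
  -- By `hm` the product followed by `p` depends only on the images of the factors. Thus `p` is
  -- multiplicative, and each axiom reduces to that of `A` by cancelling a split epimorphism.
  have hm' : (p ⊗ₘ p) ≫ (i ⊗ₘ i) ≫ μ[A] ≫ p = μ[A] ≫ p := by
    rw [MonoidalCategory.tensorHom_comp_tensorHom_assoc, ← hm]
  have h1 : p ▷ A ≫ B ◁ p ≫ (i ⊗ₘ i) ≫ μ[A] ≫ p = μ[A] ≫ p := by
    rw [← MonoidalCategory.tensorHom_def_assoc, hm']
  have h2 : A ◁ p ≫ p ▷ B ≫ (i ⊗ₘ i) ≫ μ[A] ≫ p = μ[A] ≫ p := by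
    rw [← MonoidalCategory.tensorHom_def'_assoc, hm']
  exact
    { one := η[A] ≫ p
      mul := (i ⊗ₘ i) ≫ μ[A] ≫ p
      one_mul := by
        have : IsSplitEpi ((𝟙_ C) ◁ p) := ⟨⟨(𝟙_ C) ◁ i, by
          rw [← MonoidalCategory.whiskerLeft_comp, hip, MonoidalCategory.whiskerLeft_id]⟩⟩
        rw [← cancel_epi ((𝟙_ C) ◁ p), whisker_exchange_assoc, comp_whiskerRight_assoc, h1]
        simp
      mul_one := by
        have : IsSplitEpi (p ▷ (𝟙_ C)) := ⟨⟨i ▷ (𝟙_ C), by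
          rw [← comp_whiskerRight, hip, id_whiskerRight]⟩⟩
        rw [← cancel_epi (p ▷ (𝟙_ C)), ← whisker_exchange_assoc,
          MonoidalCategory.whiskerLeft_comp_assoc, h2]
        simp
      mul_assoc := by
        have : IsSplitEpi ((p ⊗ₘ p) ⊗ₘ p) := ⟨⟨(i ⊗ₘ i) ⊗ₘ i, by simp [hip]⟩⟩
        rw [← cancel_epi ((p ⊗ₘ p) ⊗ₘ p)]
        generalize hν : (i ⊗ₘ i) ≫ μ[A] ≫ p = ν at *
        have e1 : ((p ⊗ₘ p) ⊗ₘ p) ≫ ν ▷ B = μ[A] ▷ A ≫ (p ⊗ₘ p) := by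
          rw [← MonoidalCategory.tensorHom_id, MonoidalCategory.tensorHom_comp_tensorHom, hm',
            ← MonoidalCategory.tensorHom_id, MonoidalCategory.tensorHom_comp_tensorHom]
          simp
        have e2 : (p ⊗ₘ p ⊗ₘ p) ≫ B ◁ ν = A ◁ μ[A] ≫ (p ⊗ₘ p) := by
          rw [← MonoidalCategory.id_tensorHom, MonoidalCategory.tensorHom_comp_tensorHom, hm',
            ← MonoidalCategory.id_tensorHom, MonoidalCategory.tensorHom_comp_tensorHom]
          simp
        rw [associator_naturality_assoc, reassoc_of% e1, reassoc_of% e2, hm',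
          MonObj.mul_assoc_assoc] }

/-- A split quotient of a separable algebra by a compatible section is separable. -/
lemma IsSeparableAlg.of_splitEpi [MonObj B] (hA : IsSeparableAlg A) (i : B ⟶ A) (p : A ⟶ B)
    [IsMonHom p] (hip : i ≫ p = 𝟙 B)
    (h : ∀ s : A ⟶ A ⊗ A, A ◁ s ≫ (α_ A A A).inv ≫ μ[A] ▷ A = μ[A] ≫ s →
      (p ≫ i) ≫ s ≫ (p ⊗ₘ p) = s ≫ (p ⊗ₘ p)) : IsSeparableAlg B := by
  obtain ⟨s, hs, hl, hr⟩ := hA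
  have hps := h s hl
  have hpp : IsSplitEpi (p ⊗ₘ p) := ⟨⟨i ⊗ₘ i, by simp [hip]⟩⟩
  have e1 : ((p ⊗ₘ p) ⊗ₘ p) ≫ μ[B] ▷ B = μ[A] ▷ A ≫ (p ⊗ₘ p) := by
    rw [← MonoidalCategory.tensorHom_id, MonoidalCategory.tensorHom_comp_tensorHom,
      ← IsMonHom.mul_hom, ← MonoidalCategory.tensorHom_id,
      MonoidalCategory.tensorHom_comp_tensorHom]
    simp
  have e2 : (p ⊗ₘ p ⊗ₘ p) ≫ B ◁ μ[B] = A ◁ μ[A] ≫ (p ⊗ₘ p) := by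
    rw [← MonoidalCategory.id_tensorHom, MonoidalCategory.tensorHom_comp_tensorHom,
      ← IsMonHom.mul_hom, ← MonoidalCategory.id_tensorHom,
      MonoidalCategory.tensorHom_comp_tensorHom]
    simp
  -- The pushed-forward section therefore composes with `p` to `s ≫ (p ⊗ₘ p)`, and the bimodule
  -- identities descend after cancelling `p ⊗ₘ p`.
  have hps' : p ≫ i ≫ s ≫ (p ⊗ₘ p) = s ≫ (p ⊗ₘ p) := (Category.assoc _ _ _).symm.trans hps
  refine ⟨i ≫ s ≫ (p ⊗ₘ p), ?_, ?_, ?_⟩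
  · rw [Category.assoc, Category.assoc, ← IsMonHom.mul_hom, reassoc_of% hs, hip]
  · rw [← cancel_epi (p ⊗ₘ p), ← IsMonHom.mul_hom_assoc, hps']
    have e3 : (p ⊗ₘ p) ≫ B ◁ (i ≫ s ≫ (p ⊗ₘ p)) = A ◁ s ≫ (p ⊗ₘ p ⊗ₘ p) := by
      rw [← MonoidalCategory.id_tensorHom, MonoidalCategory.tensorHom_comp_tensorHom, hps',
        ← MonoidalCategory.id_tensorHom, MonoidalCategory.tensorHom_comp_tensorHom]
      simp
    rw [reassoc_of% e3, associator_inv_naturality_assoc, e1, reassoc_of% hl]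
  · rw [← cancel_epi (p ⊗ₘ p), ← IsMonHom.mul_hom_assoc, hps']
    have e3 : (p ⊗ₘ p) ≫ (i ≫ s ≫ (p ⊗ₘ p)) ▷ B = s ▷ A ≫ ((p ⊗ₘ p) ⊗ₘ p) := by
      rw [← MonoidalCategory.tensorHom_id, MonoidalCategory.tensorHom_comp_tensorHom, hps',
        ← MonoidalCategory.tensorHom_id, MonoidalCategory.tensorHom_comp_tensorHom]
      simp
    rw [reassoc_of% e3, associator_naturality_assoc, e2, reassoc_of% hr]

end Quotient

/-! ### The corner algebra of a central idempotent -/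

section CornerAlgebra

open MonObj

variable {C : Type u} [Category.{v} C] [MonoidalCategory C] [Preadditive C]
  [MonoidalPreadditive C] (k : Type w) [Field k] [Linear k C] [MonoidalLinear k C]
  {A : C} [MonObj A] {z : ∀ m : Mod C A, m ⟶ m}

-- The action is a module map out of the free module on `m.X`, so naturality shows that a central
-- family acts on every module through its value at the regular module.
omit [Preadditive C] [MonoidalPreadditive C] in
lemma whiskerRight_central_act (hz : IsCentral C z) (m : Mod C A) :
    (z (Mod.regular A)).hom ▷ m.X ≫ act m = act m ≫ (z m).hom := by
  have h := congrArg (fun f : Mod.regular A ⊙ᵣ m.X ⟶ m => f.hom) (hz.naturality (counit m))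
  rw [hz.action] at h
  exact h.symm

/-- The image of a central idempotent is the category of modules over a separable algebra. -/
lemma exists_corner [IsIdempotentComplete C] (hA : IsSeparableAlg A) (hz : IsCentral C z)
    (hzz : ∀ m, z m ≫ z m = z m) :
    ∃ (B : C) (_ : MonObj B) (_ : IsSeparableAlg B) (G : ModFunctor k C (Mod C B) (Mod C A)),
      G.functor.Full ∧ G.functor.Faithful ∧ (∀ n, z (G.functor.obj n) = 𝟙 _) ∧
      Nonempty (Corner G z) := by
  let ζ : A ⟶ A := (z (Mod.regular A)).hom
  have hact : ∀ m : Mod C A, ζ ▷ m.X ≫ act m = act m ≫ (z m).hom := whiskerRight_central_act hz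
  have hζ : ζ ≫ ζ = ζ := congrArg (fun f : Mod.regular A ⟶ Mod.regular A => f.hom) (hzz _)
  have hl : ζ ▷ A ≫ μ[A] = μ[A] ≫ ζ := hact (Mod.regular A)
  have hr : μ[A] ≫ ζ = A ◁ ζ ≫ μ[A] := act_hom (z (Mod.regular A))
  obtain ⟨B, i, p, hip, hpi⟩ := IsIdempotentComplete.idempotents_split A ζ hζ
  have hζp : ζ ≫ p = p := by rw [← hpi, Category.assoc, hip, Category.comp_id]
  have hm : μ[A] ≫ p = (p ≫ i ⊗ₘ p ≫ i) ≫ μ[A] ≫ p := by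
    rw [hpi, MonoidalCategory.tensorHom_def, Category.assoc, ← reassoc_of% hr, hζp,
      reassoc_of% hl, hζp]
  let _ : MonObj B := quotientMonObj i p hip hm
  have : IsMonHom p :=
    { one_hom := rfl
      mul_hom := by
        change _ = (p ⊗ₘ p) ≫ (i ⊗ₘ i) ≫ μ[A] ≫ p
        rw [MonoidalCategory.tensorHom_comp_tensorHom_assoc, ← hm] }
  -- A left linear `s` is a module map `A ⟶ A ⊗ A`; naturality of `z` along it turns `ζ ≫ s` into `s
  -- ≫ ζ ▷ A`, and `p` then absorbs `ζ`.
  have hB : IsSeparableAlg B := hA.of_splitEpi i p hip fun s hs => by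
    have h := congrArg (fun f : Mod.regular A ⟶ Mod.regular A ⊙ᵣ A => f.hom)
      (hz.naturality (mkHom (m := Mod.regular A) (n := Mod.regular A ⊙ᵣ A) s hs.symm))
    rw [hz.action] at h
    have h' : s ≫ ζ ▷ A = ζ ≫ s := h
    rw [hpi, ← reassoc_of% h', MonoidalCategory.tensorHom_def, ← comp_whiskerRight_assoc, hζp]
  have := res_full k p i hip
  have hres : ∀ n, z ((res k p).functor.obj n) = 𝟙 _ := fun n => by
    refine Mod.hom_ext _ _ ?_
    have h : ζ ▷ n.X ≫ p ▷ n.X ≫ act n = act (resObj p n) ≫ (z (resObj p n)).hom :=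
      hact (resObj p n)
    rw [← comp_whiskerRight_assoc, hζp] at h
    exact act_cancel (resObj p n) (h.symm.trans (Category.comp_id _).symm)
  have hcorner : ∀ m : Mod C A, ∃ (n : Mod C B) (j : resObj p n ⟶ m)
      (q : m ⟶ resObj p n), j ≫ q = 𝟙 _ ∧ q ≫ j = z m := fun m => by
    have := isIdempotentComplete_mod A
    obtain ⟨Y, j, q, hjq, hqj⟩ := IsIdempotentComplete.idempotents_split m (z m) (hzz m)
    -- On the image of `z m` the family `z` is the identity, so `ζ` acts trivially there and the
    -- `A`-module structure descends to `B`.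
    have hY : z Y = 𝟙 Y := by
      rw [← Category.comp_id (z Y), ← hjq, ← reassoc_of% hz.naturality j, ← hqj]
      simp [hjq]
    have hYact : (p ≫ i) ▷ Y.X ≫ act Y = act Y := by
      rw [hpi, hact, hY]
      exact Category.comp_id _
    obtain ⟨n, ⟨e⟩⟩ := exists_resObj_iso p i hip Y hYact
    refine ⟨n, e.hom ≫ j, q ≫ e.inv, ?_, ?_⟩
    · rw [Category.assoc, reassoc_of% hjq, e.hom_inv_id]
    · rw [Category.assoc, e.inv_hom_id_assoc, hqj]
  choose o inc prj h₁ h₂ using hcorner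
  exact ⟨B, inferInstance, hB, res k p, inferInstance, inferInstance, hres, ⟨⟨o, inc, prj, h₁, h₂⟩⟩⟩

end CornerAlgebra

/-! ## Simple and indecomposable summands -/

section TrivialCenter

variable (C : Type u) [Category.{v} C] [MonoidalCategory C]
  (N : Type u₂) [Category.{v₂} N] [Preadditive N] [MonoidalRightAction C N]

/-- The identity module functor has only the trivial idempotent endomorphisms. -/
def HasTrivialCentralIdempotents : Prop :=
  ∀ a : ∀ n : N, n ⟶ n, IsCentral C a → (∀ n, a n ≫ a n = a n) →
    (∀ n, a n = 0) ∨ ∀ n, a n = 𝟙 n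

end TrivialCenter

section Indecomposable

open Functor.LaxRightLinear Functor.OplaxRightLinear Functor.RightLinear

variable {k : Type w} [Field k] {C : Type u} [Category.{v} C] [MonoidalCategory C]
  [Preadditive C] [Linear k C] [MonoidalPreadditive C] [MonoidalLinear k C]

omit [Preadditive C] [Linear k C] [MonoidalPreadditive C] [MonoidalLinear k C] in
lemma ModFunctor.map_actionHomLeft {M : Type u₁} [Category.{v₁} M] [Preadditive M] [Linear k M]
    [MonoidalRightAction C M] {N : Type u₂} [Category.{v₂} N] [Preadditive N] [Linear k N]
    [MonoidalRightAction C N] (F : ModFunctor k C M N) {m n : M} (f : m ⟶ n) (c : C) :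
    F.functor.map (f ⊵ᵣ c) = δᵣ F.functor m c ≫ F.functor.map f ⊵ᵣ c ≫ μᵣ F.functor n c := by
  rw [μᵣ_naturality_left, δᵣ_comp_μᵣ_assoc]

lemma IsFiniteCat.nonempty {M : Type u₁} [Category.{v₁} M] [Preadditive M] [Linear k M]
    (h : IsFiniteCat k M) : Nonempty M := by
  obtain ⟨R, _, _, _, E, _⟩ := h
  exact ⟨E.inverse.obj (FGModuleCat.of R PUnit)⟩

/-- A decomposition produces the central idempotent `(1, 0)`; if it vanishes the first factor is
zero, and if it is the identity the second one is. -/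
lemma SepMod.isIndecomposable_of_trivial (M : SepMod k C) (hne : IsNonzeroCat M)
    (hT : HasTrivialCentralIdempotents C M) : M.IsIndecomposable := by
  refine ⟨hne, fun M₁ M₂ ⟨F₁, F₂, hF⟩ => ?_⟩
  let P := F₁.functor.prod' F₂.functor
  have hP : P.IsEquivalence := hF
  let a : ∀ m : M, m ⟶ m := fun m =>
    P.preimage ((𝟙 (F₁.functor.obj m), 0) : P.obj m ⟶ P.obj m)
  have ha : ∀ m, P.map (a m) = ((𝟙 (F₁.functor.obj m), 0) : P.obj m ⟶ P.obj m) :=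
    fun m => P.map_preimage _
  have ha₁ : ∀ m, F₁.functor.map (a m) = 𝟙 _ := fun m => congrArg Prod.fst (ha m)
  have ha₂ : ∀ m, F₂.functor.map (a m) = 0 := fun m => congrArg Prod.snd (ha m)
  have hext : ∀ {m n : M} {f g : m ⟶ n}, F₁.functor.map f = F₁.functor.map g →
      F₂.functor.map f = F₂.functor.map g → f = g :=
    fun h₁ h₂ => P.map_injective (Prod.ext h₁ h₂)
  have hsurj₁ : ∀ Y : M₁, ∃ m : M, Nonempty (F₁.functor.obj m ≅ Y) := fun Y => by
    -- Essential surjectivity onto the product needs some object in the other coordinate; which one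
    -- is irrelevant.
    obtain ⟨Z⟩ := M₂.isSeparable.finite.nonempty
    let i := P.objObjPreimageIso (Y, Z)
    exact ⟨_, ⟨(CategoryTheory.Prod.fst _ _).mapIso i⟩⟩
  have hsurj₂ : ∀ Y : M₂, ∃ m : M, Nonempty (F₂.functor.obj m ≅ Y) := fun Y => by
    obtain ⟨Z⟩ := M₁.isSeparable.finite.nonempty
    let i := P.objObjPreimageIso (Z, Y)
    exact ⟨_, ⟨(CategoryTheory.Prod.snd _ _).mapIso i⟩⟩
  have hcentral : IsCentral C a :=
    { naturality := fun f => hext (by simp [ha₁]) (by simp [ha₂])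
      action := fun m c => hext
        (by rw [ModFunctor.map_actionHomLeft, ha₁, ha₁]; simp)
        (by rw [ModFunctor.map_actionHomLeft, ha₂, ha₂, ModFunctor.zero_actionHomLeft k]; simp) }
  rcases hT a hcentral (fun n => hext (by simp [ha₁]) (by simp [ha₂])) with h | h
  · left
    rintro ⟨Y, hY⟩
    obtain ⟨m, ⟨i⟩⟩ := hsurj₁ Y
    have h1 := ha₁ m
    rw [h, Functor.map_zero] at h1
    exact hY (((IsZero.iff_id_eq_zero _).2 h1.symm).of_iso i.symm)
  · right
    rintro ⟨Y, hY⟩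
    obtain ⟨m, ⟨i⟩⟩ := hsurj₂ Y
    have h1 := ha₂ m
    rw [h, CategoryTheory.Functor.map_id] at h1
    exact hY (((IsZero.iff_id_eq_zero _).2 h1).of_iso i.symm)

/-- Averaging makes all transformations into the identity functor regular, so a nonzero monomorphism
into it yields a nonzero idempotent, which must be the identity. -/
lemma simple_id_of_trivial {B : C} [MonObj B] (h : IsFinSS k C) (hB : IsSeparableAlg B)
    (hne : IsNonzeroCat (Mod C B)) (hT : HasTrivialCentralIdempotents C (Mod C B)) :
    Simple (ModFunctor.id k C (Mod C B)) := by
  obtain ⟨S⟩ := hB.exists_natSection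
  obtain ⟨n, hn⟩ := hne
  refine simple_of_trivial_idempotents (fun h0 => hn ?_) (fun e he => ?_)
    (fun f => S.exists_regular (h.mod hB).regular f)
  · rw [IsZero.iff_id_eq_zero]
    exact congrArg (fun e : ModFunctor.id k C (Mod C B) ⟶ ModFunctor.id k C (Mod C B) =>
      (e.nat.app n : n ⟶ n)) h0
  · refine (hT _ (isCentral_app e) fun n => ?_).imp (fun h => ?_) (fun h => ?_)
    · exact congrArg (fun e : ModFunctor.id k C (Mod C B) ⟶ ModFunctor.id k C (Mod C B) =>
        (e.nat.app n : n ⟶ n)) he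
    · exact ModFunctor.hom_ext h
    · exact ModFunctor.hom_ext h

lemma SepMod.isSimpleObject_ofAlg {B : C} [MonObj B] (h : IsFinSS k C) (hB : IsSeparableAlg B)
    (hne : IsNonzeroCat (Mod C B)) (hT : HasTrivialCentralIdempotents C (Mod C B)) :
    (SepMod.ofAlg h B hB).IsSimpleObject :=
  simple_id_of_trivial h hB hne hT

end Indecomposable

/-! ### A minimal central idempotent and its summand -/

section Minimal

open MonObj

variable {k : Type w} [Field k] {C : Type u} [Category.{v} C] [MonoidalCategory C]
  [Preadditive C] [Linear k C] [MonoidalPreadditive C] [MonoidalLinear k C] {A : C} [MonObj A]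

omit [Preadditive C] [MonoidalPreadditive C] in
lemma IsCentral.ext_regular {a b : ∀ m : Mod C A, m ⟶ m} (ha : IsCentral C a) (hb : IsCentral C b)
    (h : a (Mod.regular A) = b (Mod.regular A)) (m : Mod C A) : a m = b m := by
  refine Mod.hom_ext _ _ (act_cancel m ?_)
  rw [← whiskerRight_central_act ha, ← whiskerRight_central_act hb, h]

variable (k) in
omit [MonoidalPreadditive C] [MonoidalLinear k C] in
lemma IsCentral.one_sub {N : Type u₂} [Category.{v₂} N] [Preadditive N] [Linear k N]
    [MonoidalRightAction C N] [BilinearAction k C N] {a : ∀ n : N, n ⟶ n} (ha : IsCentral C a) :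
    IsCentral C (fun n => 𝟙 n - a n) where
  naturality f := by
    rw [Preadditive.comp_sub, Preadditive.sub_comp, ha.naturality]
    simp
  action m c := by
    rw [sub_eq_add_neg, sub_eq_add_neg, BilinearAction.add_left (k := k),
      ModFunctor.neg_actionHomLeft k, ha.action, id_actionHomLeft]

/-- Each nonzero central idempotent `e` is measured by the subspace of endomorphisms of the regular
module of the form `f ≫ e`. Finite dimensionality gives one with minimal subspace. -/
lemma exists_minimal_central (h : IsFinSS k C) (hne : IsNonzeroCat (Mod C A)) :
    ∃ z : ∀ m : Mod C A, m ⟶ m, IsCentral C z ∧ (∀ m, z m ≫ z m = z m) ∧ (∃ m, z m ≠ 0) ∧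
      ∀ a : ∀ m : Mod C A, m ⟶ m, IsCentral C a → (∀ m, a m ≫ a m = a m) →
        (∀ m, a m ≫ z m = a m) → (∀ m, a m = 0) ∨ ∀ m, a m = z m := by
  let R := Mod.regular A
  have hfin : Module.Finite k (R ⟶ R) := by
    have := h.fd A A
    let φ : (R ⟶ R) →ₗ[k] (A ⟶ A) :=
      { toFun := fun f => f.hom
        map_add' := fun _ _ => rfl
        map_smul' := fun _ _ => rfl }
    exact Module.Finite.of_injective φ fun f g hfg => Mod.hom_ext f g hfg
  let V : (R ⟶ R) → Submodule k (R ⟶ R) := fun e => LinearMap.range (Linear.rightComp k R e)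
  let T : Set (Submodule k (R ⟶ R)) := {W | ∃ z : ∀ m : Mod C A, m ⟶ m, IsCentral C z ∧
    (∀ m, z m ≫ z m = z m) ∧ (∃ m, z m ≠ 0) ∧ V (z R) = W}
  obtain ⟨n, hn⟩ := hne
  have hT : T.Nonempty := ⟨_, fun m => 𝟙 m, ⟨by simp, by simp⟩, by simp,
    ⟨n, fun h => hn ((IsZero.iff_id_eq_zero n).2 h)⟩, rfl⟩
  obtain ⟨W, ⟨z, hz, hzz, hz0, rfl⟩, hmin⟩ :=
    (wellFounded_lt (α := Submodule k (R ⟶ R))).has_min T hT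
  refine ⟨z, hz, hzz, hz0, fun a ha haa haz => or_iff_not_imp_left.2 fun h0 => ?_⟩
  push Not at h0
  have hle : V (a R) ≤ V (z R) := by
    rintro _ ⟨f, rfl⟩
    exact ⟨f ≫ a R, by simp [haz]⟩
  have heq : V (a R) = V (z R) :=
    hle.eq_of_not_lt fun hlt => hmin _ ⟨a, ha, haa, h0, rfl⟩ hlt
  -- Then `z = f ≫ a` at `R`, so `z ≫ a = z`; with `a ≫ z = a` and centrality this gives `a = z` at
  -- `R`, hence everywhere.
  have hmem : z R ∈ V (a R) := heq ▸ ⟨𝟙 R, by simp⟩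
  obtain ⟨f, hf⟩ := hmem
  have hf' : f ≫ a R = z R := hf
  refine ha.ext_regular hz ?_
  have h1 : z R ≫ a R = z R := by rw [← hf', Category.assoc, haa]
  exact (haz R).symm.trans ((ha.naturality (z R)).symm.trans h1)

/-- A nonzero category of modules over a separable algebra has a simple indecomposable summand. -/
lemma exists_simple_summand (h : IsFinSS k C) (hA : IsSeparableAlg A)
    (hne : IsNonzeroCat (Mod C A)) :
    ∃ M' M'' : SepMod k C, M'.IsSimpleObject ∧ M'.IsIndecomposable ∧
      IsDirectSum k C (Mod C A) M' M'' := by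
  have := h.idem
  obtain ⟨z, hz, hzz, ⟨m₀, hm₀⟩, hmin⟩ := exists_minimal_central h hne
  have hz' := hz.one_sub k
  have hzz' : ∀ m, (𝟙 m - z m) ≫ (𝟙 m - z m) = 𝟙 m - z m := fun m => by simp [hzz]
  obtain ⟨B, _, hB, G, _, _, hG, ⟨D⟩⟩ := exists_corner k hA hz hzz
  obtain ⟨B', _, hB', G', _, _, hG', ⟨D'⟩⟩ := exists_corner k hA hz' hzz'
  have hneB : IsNonzeroCat (Mod C B) := by
    refine ⟨D.obj m₀, fun h0 => hm₀ ?_⟩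
    rw [← D.π_ι, ← Category.id_comp (D.ι m₀), ← CategoryTheory.Functor.map_id,
      (IsZero.iff_id_eq_zero _).1 h0]
    simp
  have hTB : HasTrivialCentralIdempotents C (Mod C B) := by
    intro a ha haa
    -- The chosen splitting `D.obj (G n)` is only isomorphic to `n`, so `a n` is recovered from its
    -- value there by conjugation.
    have hret : ∀ n, a n = G.functor.preimage (D.π (G.functor.obj n)) ≫
      a (D.obj (G.functor.obj n)) ≫
        G.functor.preimage (D.ι (G.functor.obj n)) := fun n => by
      rw [← ha.naturality, ← Category.assoc]
      refine (Category.id_comp _).symm.trans (congrArg (· ≫ a n) (G.functor.map_injective ?_))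
      rw [Functor.map_comp, Functor.map_preimage, Functor.map_preimage, D.π_ι, hG,
        CategoryTheory.Functor.map_id]
    have hid : ∀ n, G.functor.preimage (D.π (G.functor.obj n)) ≫
        G.functor.preimage (D.ι (G.functor.obj n)) = 𝟙 n := fun n => G.functor.map_injective (by
      rw [Functor.map_comp, Functor.map_preimage, Functor.map_preimage, D.π_ι, hG,
        CategoryTheory.Functor.map_id])
    refine (hmin (D.lift a) (D.isCentral_lift hz ha) (fun m => ?_) (fun m => ?_)).imp
      (fun h n => ?_) (fun h n => ?_)
    · simp only [Corner.lift, Category.assoc]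
      rw [reassoc_of% D.ι_π, ← Functor.map_comp_assoc, haa]
    · simp only [Corner.lift, Category.assoc, D.ι_e]
    · have h1 : a (D.obj (G.functor.obj n)) = 0 := G.functor.map_injective (by
        rw [← D.ι_lift_π, h]
        simp)
      rw [hret, h1, zero_comp, comp_zero]
    · have h1 : a (D.obj (G.functor.obj n)) = 𝟙 _ := G.functor.map_injective (by
        rw [← D.ι_lift_π, h, reassoc_of% D.ι_e, D.ι_π, CategoryTheory.Functor.map_id])
      rw [hret, h1, Category.id_comp, hid]
  have := (h.mod hA).biproducts
  have : HasBinaryBiproducts (Mod C A) := hasBinaryBiproducts_of_finite_biproducts _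
  have hsum : IsDirectSum k C (Mod C A) (Mod C B) (Mod C B') :=
    isDirectSum_of_corners hz hz' (by simp) D D' hG hG'
  exact ⟨SepMod.ofAlg h B hB, SepMod.ofAlg h B' hB',
    SepMod.isSimpleObject_ofAlg h hB hneB hTB,
    SepMod.isIndecomposable_of_trivial _ hneB hTB, hsum⟩

end Minimal

lemma IsDirectSum.of_equivalence {k : Type w} [Field k] {C : Type u} [Category.{v} C]
    [MonoidalCategory C]
    {N : Type u₁} [Category.{v₁} N] [Preadditive N] [Linear k N] [MonoidalRightAction C N]
    {N' : Type u₂} [Category.{v₂} N'] [Preadditive N'] [Linear k N'] [MonoidalRightAction C N']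
    {M₁ : Type u₃} [Category.{v₃} M₁] [Preadditive M₁] [Linear k M₁] [MonoidalRightAction C M₁]
    {M₂ : Type u₄} [Category.{v₄} M₂] [Preadditive M₂] [Linear k M₂] [MonoidalRightAction C M₂]
    (E : ModFunctor k C N N') [E.functor.IsEquivalence] (h : IsDirectSum k C N' M₁ M₂) :
    IsDirectSum k C N M₁ M₂ := by
  obtain ⟨F₁, F₂, hF⟩ := h
  exact ⟨E.comp F₁, E.comp F₂,
    inferInstanceAs (E.functor ⋙ F₁.functor.prod' F₂.functor).IsEquivalence⟩

/-! ## Summands of extensions of scalars -/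

section Fields

/-- A finite subextension is never everything, so adjoining an element outside it raises the degree
by at least one. -/
lemma exists_intermediateField_le_finrank {k : Type u₁} {L : Type u₂} [Field k] [Field L]
    [Algebra k L] [Algebra.IsAlgebraic k L] (h : ¬ FiniteDimensional k L) (n : ℕ) :
    ∃ E : IntermediateField k L, FiniteDimensional k E ∧ n ≤ Module.finrank k E := by
  induction n with
  | zero => exact ⟨⊥, inferInstance, Nat.zero_le _⟩
  | succ n ih =>
    obtain ⟨E, hE, hn⟩ := ih
    obtain ⟨x, hx⟩ : ∃ x, x ∉ E := by
      by_contra! hall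
      apply h
      have : E = ⊤ := SetLike.ext fun x => ⟨fun _ => trivial, fun _ => hall x⟩
      subst this
      exact Module.Finite.equiv IntermediateField.topEquiv.toLinearEquiv
    have : FiniteDimensional k (IntermediateField.adjoin k {x}) :=
      IntermediateField.adjoin.finiteDimensional (Algebra.IsIntegral.isIntegral x)
    have hfin : FiniteDimensional k ↥(E ⊔ IntermediateField.adjoin k {x}) :=
      IntermediateField.finiteDimensional_sup _ _
    refine ⟨E ⊔ IntermediateField.adjoin k {x}, hfin, ?_⟩
    by_contra! hlt
    have := IntermediateField.eq_of_le_of_finrank_le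
      (le_sup_left : E ≤ E ⊔ IntermediateField.adjoin k {x}) (by omega)
    rw [this] at hx
    exact hx ((le_sup_right : _ ≤ E ⊔ IntermediateField.adjoin k {x})
      (IntermediateField.mem_adjoin_simple_self k x))

end Fields

/-! ### Nonvanishing of module categories -/

section Nonzero

open MonObj

variable {k : Type w} [Field k] {K : Type u₄} [Field K] [Algebra k K] [FiniteDimensional k K]
  {C : Type u} [Category.{v} C] [MonoidalCategory C]
  [Preadditive C] [Linear k C] [MonoidalPreadditive C] [MonoidalLinear k C]

lemma isZero_mod_of_id_eq_zero {A : C} [MonObj A] (hA : 𝟙 A = 0) (m : Mod C A) : IsZero m := by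
  rw [IsZero.iff_id_eq_zero]
  refine Mod.hom_ext _ _ (act_cancel m ?_)
  have h : act m = 0 := by
    rw [← Category.id_comp (act m), ← id_whiskerRight, hA]
    simp
  rw [h, zero_comp, zero_comp]

lemma isNonzeroCat_copower [HasFiniteBiproducts C] {A : C} [MonObj A]
    (hne : IsNonzeroCat (Mod C A)) : IsNonzeroCat (Mod C (copower k K A)) := by
  obtain ⟨m, hm⟩ := hne
  refine ⟨Mod.regular _, fun h0 => hm (isZero_mod_of_id_eq_zero ?_ m)⟩
  have h1 : 𝟙 (copower k K A) = 0 :=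
    congrArg (fun f : Mod.regular (copower k K A) ⟶ Mod.regular (copower k K A) => f.hom)
      ((IsZero.iff_id_eq_zero _).1 h0)
  -- `K` has positive dimension, so `A` is a direct summand of `K ⊗ A` through some coordinate.
  let j : Fin (Module.finrank k K) := ⟨0, Module.finrank_pos⟩
  have h2 := inn_proj (k := k) A (Module.finBasis k K j) j
  rw [← Category.comp_id (inn k K A _), h1, comp_zero, zero_comp, Module.Basis.repr_self,
    Finsupp.single_eq_same, one_smul] at h2
  exact h2.symm

lemma IsNonzeroCat.of_faithful {M : Type u₁} [Category.{v₁} M] [Preadditive M] {N : Type u₂}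
    [Category.{v₂} N] [Preadditive N] (F : M ⥤ N) [F.Additive] [F.Faithful]
    (h : IsNonzeroCat M) : IsNonzeroCat N := by
  obtain ⟨X, hX⟩ := h
  refine ⟨F.obj X, fun h0 => hX ?_⟩
  rw [IsZero.iff_id_eq_zero] at h0 ⊢
  exact F.map_injective (by rw [CategoryTheory.Functor.map_id, h0, F.map_zero])

omit [MonoidalLinear k C] in
lemma isNonzeroCat_mod_unit (hne : IsNonzeroCat C) : IsNonzeroCat (Mod C (𝟙_ C)) := by
  obtain ⟨X, hX⟩ := hne
  refine ⟨Mod.regular (𝟙_ C), fun h0 => hX ?_⟩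
  have h1 : 𝟙 (𝟙_ C) = 0 :=
    congrArg (fun f : Mod.regular (𝟙_ C) ⟶ Mod.regular (𝟙_ C) => f.hom)
      ((IsZero.iff_id_eq_zero _).1 h0)
  rw [IsZero.iff_id_eq_zero, ← Iso.inv_hom_id (λ_ X), ← Category.id_comp (λ_ X).hom,
    ← id_whiskerRight, h1]
  simp

end Nonzero

/-! ### Separability, simple summands and the dimension bound -/

section Summands

variable {k : Type w} [Field k] {K : Type u₄} [Field K] [Algebra k K] [FiniteDimensional k K]
  {C : Type u} [Category.{v} C] [MonoidalCategory C]
  [Preadditive C] [Linear k C] [MonoidalPreadditive C] [MonoidalLinear k C]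

lemma IsSeparableModCat.baseChange [Algebra.IsSeparable k K] (h : IsFinSS k C)
    {M : Type u₁} [Category.{v} M] [Preadditive M] [Linear k M] [MonoidalRightAction C M]
    [BilinearAction k C M] (hM : IsSeparableModCat k C M) :
    IsSeparableModCat k C (BaseChange k K M) := by
  have := h.biproducts
  obtain ⟨A, _, hA, F, _⟩ := hM.separable
  let E := (BaseChange.mapFunctor K F).comp (toModFunctor k K A)
  have : E.functor.IsEquivalence :=
    inferInstanceAs ((BaseChange.mapFunctor K F).functor ⋙
      (toModFunctor k K A).functor).IsEquivalence
  exact isSeparableModCat_of_equivalence h (isSeparableAlg_copower (k := k) (K := K) A hA) E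

lemma exists_simple_summand_baseChange [Algebra.IsSeparable k K] (h : IsFinSS k C)
    {M : Type u₁} [Category.{v} M] [Preadditive M] [Linear k M] [MonoidalRightAction C M]
    [BilinearAction k C M] (hM : IsSeparableModCat k C M) (hne : IsNonzeroCat M) :
    ∃ M' : SepMod k C, M'.IsSimpleObject ∧ M'.IsIndecomposable ∧
      M'.IsSummandOf (BaseChange k K M) := by
  have := h.biproducts
  obtain ⟨A, _, hA, F, _⟩ := hM.separable
  let E := (BaseChange.mapFunctor K F).comp (toModFunctor k K A)
  have : E.functor.IsEquivalence :=
    inferInstanceAs ((BaseChange.mapFunctor K F).functor ⋙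
      (toModFunctor k K A).functor).IsEquivalence
  obtain ⟨M', M'', h₁, h₂, h₃⟩ := exists_simple_summand h (isSeparableAlg_copower (k := k) (K :=
    K) A hA)
    (isNonzeroCat_copower (hne.of_faithful F.functor))
  exact ⟨M', h₁, h₂, M'', h₃.of_equivalence E⟩

-- Commutativity of `K` makes its scalars endomorphisms in the extension of scalars, not only of the
-- underlying object. Carried to `Y` by the projection functor, they form a ring map from a field to
-- a nonzero ring.
omit [FiniteDimensional k K] in
lemma finrank_le_of_isSummandOf {M : Type u₁} [Category.{v₁} M] [Preadditive M] [Linear k M]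
    [MonoidalRightAction C M] [BilinearAction k C M] {M' : SepMod k C}
    (hM' : M'.IsSummandOf (BaseChange k K M)) (Y : M') (hY : Simple Y) :
    Module.finrank k K ≤ Module.finrank k (End Y) := by
  obtain ⟨M'', F₁, F₂, hF⟩ := hM'
  obtain ⟨Z⟩ := M''.isSeparable.finite.nonempty
  let P := F₁.functor.prod' F₂.functor
  have hP : P.IsEquivalence := hF
  let X := P.objPreimage (Y, Z)
  let i : F₁.functor.obj X ≅ Y := (CategoryTheory.Prod.fst _ _).mapIso (P.objObjPreimageIso (Y, Z))
  let σ : K → (X ⟶ X) := fun a =>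
    { hom := X.scalar a
      comm := fun b => by rw [← X.scalar_mul, ← X.scalar_mul, mul_comm] }
  let φ : K →ₗ[k] (Y ⟶ Y) :=
    { toFun := fun a => i.inv ≫ F₁.functor.map (σ a) ≫ i.hom
      map_add' := fun a b => by
        have h : σ (a + b) = σ a + σ b := BaseChange.hom_ext (map_add X.scalarₗ a b)
        rw [h, Functor.map_add]
        simp
      map_smul' := fun r a => by
        have h : σ (r • a) = r • σ a := BaseChange.hom_ext (map_smul X.scalarₗ r a)
        rw [h, Functor.map_smul]
        simp }
  have hφ : ∀ a b, φ (a * b) = φ b ≫ φ a := fun a b => by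
    have h : σ (a * b) = σ b ≫ σ a := BaseChange.hom_ext (X.scalar_mul a b)
    change i.inv ≫ F₁.functor.map (σ (a * b)) ≫ i.hom =
      (i.inv ≫ F₁.functor.map (σ b) ≫ i.hom) ≫ i.inv ≫ F₁.functor.map (σ a) ≫ i.hom
    rw [h, Functor.map_comp]
    simp
  have hφ1 : φ 1 = 𝟙 Y := by
    have h : σ 1 = 𝟙 X := BaseChange.hom_ext X.scalar_one
    change i.inv ≫ F₁.functor.map (σ 1) ≫ i.hom = _
    rw [h, CategoryTheory.Functor.map_id]
    simp
  have hinj : Function.Injective φ := by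
    rw [injective_iff_map_eq_zero]
    intro a ha
    by_contra ha0
    apply id_nonzero Y
    rw [← hφ1, ← mul_inv_cancel₀ ha0, hφ, ha, comp_zero]
  -- Needed because `finrank` is `0` on an infinite-dimensional space, where injectivity would give
  -- no bound.
  have hfin : Module.Finite k (Y ⟶ Y) :=
    (IsFinSS.of_isFiniteCat M'.isSeparable.finite M'.isSeparable.semisimple).fd Y Y
  have hle : Module.finrank k K ≤ Module.finrank k (Y ⟶ Y) :=
    LinearMap.finrank_le_finrank_of_injective hinj
  exact hle

end Summands

/-! ### Invariance under equivalence and counting of classes -/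

section Equivalences

lemma exists_simple_of_isSemisimpleCat {M : Type u₁} [Category.{v₁} M] [Preadditive M]
    (hs : IsSemisimpleCat M) (hne : IsNonzeroCat M) : ∃ Y : M, Simple Y := by
  obtain ⟨X, hX⟩ := hne
  obtain ⟨n, S, b, hS, ⟨hb⟩, ⟨i⟩⟩ := hs X
  rcases n with _ | n
  · refine absurd ((IsZero.iff_id_eq_zero _).2 ?_) (fun h => hX (h.of_iso i))
    rw [← IsBilimit.total hb]
    simp
  · exact ⟨S 0, hS 0⟩

variable {k : Type w} [Field k] {C : Type u} [Category.{v} C] [MonoidalCategory C]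
  [Preadditive C] [Linear k C] [MonoidalPreadditive C] [MonoidalLinear k C]

/-- Isomorphic module functors are isomorphic functors. -/
def natIsoOfIso {M : Type u₁} [Category.{v₁} M] [Preadditive M] [Linear k M]
    [MonoidalRightAction C M] {N : Type u₂} [Category.{v₂} N] [Preadditive N] [Linear k N]
    [MonoidalRightAction C N] {F G : ModFunctor k C M N} (i : F ≅ G) : F.functor ≅ G.functor where
  hom := i.hom.nat
  inv := i.inv.nat
  hom_inv_id := congrArg ModFunctor.Hom.nat i.hom_inv_id
  inv_hom_id := congrArg ModFunctor.Hom.nat i.inv_hom_id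

lemma SepMod.isEquivalence_of_equivalence {M N : SepMod k C} (e : Bicategory.Equivalence M N) :
    (show ModFunctor k C M N from e.hom).functor.IsEquivalence := by
  let F : ModFunctor k C M N := e.hom
  let G : ModFunctor k C N M := e.inv
  let η : ModFunctor.id k C M ≅ F.comp G := e.unit
  let ε : G.comp F ≅ ModFunctor.id k C N := e.counit
  exact (CategoryTheory.Equivalence.mk F.functor G.functor (natIsoOfIso η)
    (natIsoOfIso ε)).isEquivalence_functor

lemma finrank_end_obj {M : Type u₁} [Category.{v₁} M] [Preadditive M] [Linear k M]
    {N : Type u₂} [Category.{v₂} N] [Preadditive N] [Linear k N] (F : M ⥤ N) [F.Additive]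
    [F.Linear k] [F.Full] [F.Faithful] (Y : M) :
    Module.finrank k (End (F.obj Y)) = Module.finrank k (End Y) :=
  (LinearEquiv.ofBijective (F.mapLinearMap k (X := Y) (Y := Y))
    ⟨F.map_injective, F.map_surjective⟩).finrank_eq.symm

/-- There are infinitely many classes if the endomorphism algebras of simple objects of simple
module categories get arbitrarily large. -/
lemma SepMod.infinite_simpleClasses
    (h : ∀ n : ℕ, ∃ M : SepMod k C, M.IsSimpleObject ∧ (∃ Y : M, Simple Y) ∧
      ∀ Y : M, Simple Y → n ≤ Module.finrank k (End Y)) : Infinite (SimpleClasses k C) := by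
  choose M hM hY hle using h
  by_contra hfin
  rw [not_infinite_iff_finite] at hfin
  let q : ℕ → SimpleClasses k C := fun n => Quotient.mk (simpleSetoid k C) ⟨M n, hM n⟩
  -- Pigeonhole: infinitely many indices share one class. A fixed simple `Y` in one member is
  -- carried to a simple object of every other, so the dimension of `End Y` bounds all these
  -- indices.
  obtain ⟨c, hc⟩ := Finite.exists_infinite_fiber q
  obtain ⟨m, hm⟩ : (q ⁻¹' {c}).Nonempty := Set.nonempty_coe_sort.1 inferInstance
  obtain ⟨Y, hYs⟩ := hY m
  refine Set.infinite_coe_iff.1 hc ((Set.finite_Iic (Module.finrank k (End Y))).subset ?_)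
  intro n hn
  have hmn : q m = q n := (Set.mem_singleton_iff.1 hm).trans (Set.mem_singleton_iff.1 hn).symm
  obtain ⟨e⟩ : Nonempty (Bicategory.Equivalence (M m) (M n)) := Quotient.exact hmn
  let F : ModFunctor k C (M m) (M n) := e.hom
  have hF : F.functor.IsEquivalence := SepMod.isEquivalence_of_equivalence e
  rw [Set.mem_Iic, ← finrank_end_obj F.functor Y]
  exact hle n _ (simple_obj F.functor Y)

end Equivalences

end TensorModule

end

/-! ### The main theorem -/

theorem mainTheorem7 (k : Type w) [Field k] (hk : ¬ FiniteDimensional k (SeparableClosure k))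
    (C : Type u) [Category.{v} C] [Preadditive C] [Linear k C]
    [MonoidalCategory C] [MonoidalPreadditive C] [MonoidalLinear k C] [RigidCategory C]
    (hfin : TensorModule.IsFiniteCat k C) (hss : TensorModule.IsSemisimpleCat C)
    (hne : TensorModule.IsNonzeroCat C) :
    Infinite (TensorModule.SepMod.SimpleClasses k C) ∧
    ∀ M : TensorModule.SepMod k C, TensorModule.IsNonzeroCat M →
      (∀ (K : Type w) [Field K] [Algebra k K] [FiniteDimensional k K] [Algebra.IsSeparable k K],
        TensorModule.IsSeparableModCat k C (TensorModule.BaseChange k K M) ∧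
        (∃ M' : TensorModule.SepMod k C, M'.IsSimpleObject ∧ M'.IsIndecomposable ∧
          M'.IsSummandOf (TensorModule.BaseChange k K M)) ∧
        ∀ M' : TensorModule.SepMod k C, M'.IsSummandOf (TensorModule.BaseChange k K M) →
          ∀ Y : M', Simple Y → Module.finrank k K ≤ Module.finrank k (End Y)) ∧
      ∀ n : ℕ, ∃ (K : Type w) (_ : Field K) (_ : Algebra k K) (_ : FiniteDimensional k K)
        (_ : Algebra.IsSeparable k K) (M' : TensorModule.SepMod k C),
        n ≤ Module.finrank k K ∧ M'.IsSimpleObject ∧ M'.IsIndecomposable ∧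
        M'.IsSummandOf (TensorModule.BaseChange k K M) ∧
        (∃ Y : M', Simple Y) ∧ ∀ Y : M', Simple Y → n ≤ Module.finrank k (End Y) := by
  have h := TensorModule.IsFinSS.of_isFiniteCat hfin hss
  have key : ∀ M : TensorModule.SepMod k C, TensorModule.IsNonzeroCat M → ∀ n : ℕ,
      ∃ (K : Type w) (_ : Field K) (_ : Algebra k K) (_ : FiniteDimensional k K)
        (_ : Algebra.IsSeparable k K) (M' : TensorModule.SepMod k C),
        n ≤ Module.finrank k K ∧ M'.IsSimpleObject ∧ M'.IsIndecomposable ∧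
        M'.IsSummandOf (TensorModule.BaseChange k K M) ∧
        (∃ Y : M', Simple Y) ∧ ∀ Y : M', Simple Y → n ≤ Module.finrank k (End Y) := by
    intro M hM n
    obtain ⟨E, hE, hn⟩ := TensorModule.exists_intermediateField_le_finrank hk n
    have hsep : Algebra.IsSeparable k E :=
      Algebra.isSeparable_tower_bot_of_isSeparable k E (SeparableClosure k)
    obtain ⟨M', h₁, h₂, h₃⟩ :=
      TensorModule.exists_simple_summand_baseChange (K := E) h M.isSeparable hM
    exact ⟨E, inferInstance, inferInstance, hE, hsep, M', hn, h₁, h₂, h₃,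
      TensorModule.exists_simple_of_isSemisimpleCat M'.isSeparable.semisimple h₂.1,
      fun Y hY => hn.trans (TensorModule.finrank_le_of_isSummandOf h₃ Y hY)⟩
  refine ⟨TensorModule.SepMod.infinite_simpleClasses fun n => ?_, fun M hM =>
    ⟨fun K _ _ _ _ => ⟨M.isSeparable.baseChange h,
      TensorModule.exists_simple_summand_baseChange h M.isSeparable hM,
      fun M' hM' Y hY => TensorModule.finrank_le_of_isSummandOf hM' Y hY⟩, key M hM⟩⟩
  obtain ⟨K, _, _, _, _, M', -, h₁, -, -, h₂, h₃⟩ :=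
    -- Modules over the unit algebra give a nonzero module category to which the second claim
    -- applies.
    key (TensorModule.SepMod.ofAlg h _ (TensorModule.isSeparableAlg_unit (C := C)))
      (TensorModule.isNonzeroCat_mod_unit hne) n
  exact ⟨M', h₁, h₂, h₃⟩
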